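/- Let $M$ be a smooth manifold of dimension $n\ge 2$. A Finsler metric on $M$ is a function $F:TM\to[0,\infty)$ that is smooth on $TM\setminus 0$, positive there and zero on the zero section, positively homogeneous of degree one in $y$, and such that $g_{ij}=\frac12\,\partial^2F^2/\partial y^i\partial y^j$ is positive definite at every $y\neq 0$. In local coordinates $(x^i,y^i)$ put $(g^{ij})=(g_{ij})^{-1}$, $y_k=g_{kr}y^r$, $C_{ijk}=\frac12\,\partial g_{ij}/\partial y^k$, $C^k_{ij}=g^{kl}C_{lij}$, $$G^i=\tfrac14 g^{il}\big([F^2]_{x^ky^l}y^k-[F^2]_{x^l}\big),\quad G^i_j=\partial G^i/\partial y^j,\quad G^i_{jk}=\partial G^i_j/\partial y^k,\quad \delta_i=\partial/\partial x^i-G^r_i\,\partial/\partial y^r,$$ $$\Gamma^k_{ij}=\tfrac12 g^{kl}(\delta_ig_{jl}+\delta_jg_{il}-\delta_lg_{ij}),\qquad R^i{}_k=2\,\partial_{x^k}G^i-y^j\partial_{x^j}G^i_k+2G^jG^i_{jk}-G^i_jG^j_k,\qquad \mathrm{Ric}=R^m{}_m .$$ For a curve $\gamma$ with $\dot\gamma\neq0$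 and a vector field $V$ along it, the derivative of the Cartan $Y$-connection is $$(D^*_{\dot\gamma}V)^k=\dot V^k+V^i\big(\Gamma^k_{ij}\dot\gamma^j+C^k_{ir}(\ddot\gamma^r+G^r_j\dot\gamma^j)\big),$$ with $\Gamma,C,G$ taken at $(\gamma,\dot\gamma)$. A geodesic circle of $F$ is a smooth curve $\gamma$ on an open interval, parametrized by arc length ($F(\dot\gamma)=1$), with $$D^*_{\dot\gamma}D^*_{\dot\gamma}\dot\gamma+g_{\dot\gamma}(D^*_{\dot\gamma}\dot\gamma,D^*_{\dot\gamma}\dot\gamma)\,\dot\gamma=0 .$$ Two Finsler metrics on $M$ are concircular if they have the same geodesic circles up to orientation-preserving smooth changes of parameter. **Theorem.** Let $F$ and $\widetilde F$ be Finsler metrics on $M$ with $\widetilde F=u^{-1}F$ for a smooth function $u>0$ on $M$. Write $u_i=\partial u/\partial x^i$, $u^i=g^{ir}u_r$, $u_{i|j}=\partial_{x^j}u_i-\Gamma^r_{ij}u_r$. (i) $F$ and $\widetilde F$ are concircular if and only if there is a function $\lambda=\lambda(x)$ on $M$ such that $$u_{i|j}=\lambda\, g_{ij},\qquad u^rC^k_{ri}=0\qquad\text{at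 all }(x,y),\ y\ne0. \tag{$*$}$$ (ii) Suppose that $F$ and $\widetilde F$ are concircular. Then each of the following properties holds for $F$ if and only if it holds for $\widetilde F$: - scalar flag curvature: $R^i{}_k=K(F^2\delta^i_k-y^iy_k)$ with some function $K=K(x,y)$; - isotropic flag curvature: the same with some $K=K(x)$; - constant flag curvature: the same with a constant $K$, provided that $n\ge3$ and $M$ is connected; - being an Einstein metric: $\mathrm{Ric}=(n-1)KF^2$ with some $K=K(x)$. Moreover, let $\lambda$ be as in $(*)$, and let $K=K(x,y)$ and $\widetilde K=\widetilde K(x,y)$ be either the flag curvatures of $F$ and $\widetilde F$ (when both are of scalar flag curvature) or the Ricci scalars of $F$ and $\widetilde F$ (defined by $\mathrm{Ric}=(n-1)KF^2$, and likewise for $\widetilde F$). Then, at all $(x,y)$ with $y\neq0$, $$\widetilde K=Ku^2+2\lambda u-u_mu^m .$$ -/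

import Mathlib

open scoped Manifold ContDiff

namespace Finsler

noncomputable section

/-- The coordinate space `ℝⁿ`. -/
abbrev Coord (n : ℕ) : Type := EuclideanSpace ℝ (Fin n)

/-- The `i`-th coordinate vector of `ℝⁿ`. -/
abbrev basisVec {n : ℕ} (i : Fin n) : Coord n := EuclideanSpace.single i (1 : ℝ)

/-! ### Coordinate expressions

In this part `L x y` is the expression of a Finsler metric `F` in a local chart, `x` being the
coordinates of the base point and `y` the components of the tangent vector. -/

/-- `∂T/∂xⁱ` for a function `T = T(x, y)`. -/
def dX {n : ℕ} (i : Fin n) (T : Coord n → Coord n → ℝ) (x y : Coord n) : ℝ :=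
  fderiv ℝ (fun z => T z y) x (basisVec i)

/-- `∂T/∂yⁱ` for a function `T = T(x, y)`. -/
def dY {n : ℕ} (i : Fin n) (T : Coord n → Coord n → ℝ) (x y : Coord n) : ℝ :=
  fderiv ℝ (fun z => T x z) y (basisVec i)

/-- The fundamental tensor `g_ij = ∂²(F²/2)/∂yⁱ∂yʲ`. -/
def metric {n : ℕ} (L : Coord n → Coord n → ℝ) (i j : Fin n) : Coord n → Coord n → ℝ :=
  dY i (dY j (fun x y => L x y ^ 2 / 2))

/-- The inverse matrix `g^ij` of `g_ij`. -/
def metricInv {n : ℕ} (L : Coord n → Coord n → ℝ) (i j : Fin n) (x y : Coord n) : ℝ :=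
  (Matrix.of fun a b => metric L a b x y)⁻¹ i j

/-- `y_k = g_kr yʳ`. -/
def lowerY {n : ℕ} (L : Coord n → Coord n → ℝ) (k : Fin n) (x y : Coord n) : ℝ :=
  ∑ r, metric L k r x y * y r

/-- The Cartan torsion `C_ijk = (1/2) ∂g_ij/∂yᵏ`. -/
def cartanLower {n : ℕ} (L : Coord n → Coord n → ℝ) (i j k : Fin n) (x y : Coord n) : ℝ :=
  dY k (metric L i j) x y / 2

/-- The Cartan torsion `C^k_ij = g^kl C_lij`. -/
def cartan {n : ℕ} (L : Coord n → Coord n → ℝ) (k i j : Fin n) (x y : Coord n) : ℝ :=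
  ∑ l, metricInv L k l x y * cartanLower L l i j x y

/-- The geodesic (spray) coefficients `Gⁱ = (1/4) g^il ([F²]_{xᵏyˡ} yᵏ - [F²]_{xˡ})`. -/
def spray {n : ℕ} (L : Coord n → Coord n → ℝ) (i : Fin n) (x y : Coord n) : ℝ :=
  (∑ l, metricInv L i l x y *
    ((∑ k, dY l (dX k fun a b => L a b ^ 2) x y * y k) - dX l (fun a b => L a b ^ 2) x y)) / 4

/-- `G^i_j = ∂Gⁱ/∂yʲ`. -/
def nonlinearConn {n : ℕ} (L : Coord n → Coord n → ℝ) (i j : Fin n) : Coord n → Coord n → ℝ :=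
  dY j (spray L i)

/-- `δ_i T = ∂T/∂xⁱ - G^r_i ∂T/∂yʳ`. -/
def deltaX {n : ℕ} (L : Coord n → Coord n → ℝ) (i : Fin n) (T : Coord n → Coord n → ℝ)
    (x y : Coord n) : ℝ :=
  dX i T x y - ∑ r, nonlinearConn L r i x y * dY r T x y

/-- The horizontal coefficients of the Cartan (and of the Chern) connection,
`Γ^k_ij = (1/2) g^kl (δ_i g_jl + δ_j g_il - δ_l g_ij)`. -/
def horizCoeff {n : ℕ} (L : Coord n → Coord n → ℝ) (k i j : Fin n) (x y : Coord n) : ℝ :=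
  (∑ l, metricInv L k l x y * (deltaX L i (metric L j l) x y + deltaX L j (metric L i l) x y
    - deltaX L l (metric L i j) x y)) / 2

/-- The Riemann curvature
`R^i_k = 2 ∂_{xᵏ} Gⁱ - yʲ ∂_{xʲ} G^i_k + 2 Gʲ G^i_jk - G^i_j G^j_k`, with `G^i_jk = ∂G^i_j/∂yᵏ`. -/
def riemann {n : ℕ} (L : Coord n → Coord n → ℝ) (i k : Fin n) (x y : Coord n) : ℝ :=
  2 * dX k (spray L i) x y - (∑ j, y j * dX j (nonlinearConn L i k) x y)
    + 2 * (∑ j, spray L j x y * dY k (nonlinearConn L i j) x y)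
    - ∑ j, nonlinearConn L i j x y * nonlinearConn L j k x y

/-- The Ricci curvature `Ric = R^m_m`. -/
def ricci {n : ℕ} (L : Coord n → Coord n → ℝ) (x y : Coord n) : ℝ :=
  ∑ m, riemann L m m x y

/-- `w_i = ∂w/∂xⁱ` for a function `w` of the base point. -/
def grad {n : ℕ} (w : Coord n → ℝ) (i : Fin n) (x : Coord n) : ℝ :=
  fderiv ℝ w x (basisVec i)

/-- `wⁱ = g^ir w_r`. -/
def gradUp {n : ℕ} (L : Coord n → Coord n → ℝ) (w : Coord n → ℝ) (i : Fin n)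
    (x y : Coord n) : ℝ :=
  ∑ r, metricInv L i r x y * grad w r x

/-- `w_{i|j} = δ_j w_i - Γ^r_ij w_r`, the horizontal covariant derivative of `w_i` for the Cartan
(or Chern) connection; `δ_j w_i = ∂_j w_i` because `w_i` does not depend on `y`. -/
def hessian {n : ℕ} (L : Coord n → Coord n → ℝ) (w : Coord n → ℝ) (i j : Fin n)
    (x y : Coord n) : ℝ :=
  grad (grad w i) j x - ∑ r, horizCoeff L r i j x y * grad w r x

/-- The components of the tangent vector of the lifted curve `(c, ċ)` with respect to
`δyᵏ = dyᵏ + G^k_r dxʳ`, that is `c̈ᵏ + G^k_r(c, ċ) ċʳ`. -/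
def verticalPart {n : ℕ} (L : Coord n → Coord n → ℝ) (c : ℝ → Coord n) (t : ℝ) (k : Fin n) : ℝ :=
  deriv (deriv c) t k + ∑ r, nonlinearConn L k r (c t) (deriv c t) * deriv c t r

/-- The covariant derivative `D*_ċ V` of a vector field `V` along a curve `c`, for the Cartan
`Y`-connection induced by `ċ`. It is the Cartan connection
`D ∂_i = (Γ^k_ij dxʲ + C^k_ir δyʳ) ∂_k`, taken at `(c, ċ)` in the direction of the tangent vector of
`(c, ċ)`; see `covDerivAlong_eq_of_extension` for the description by an extension `Y` of `ċ`. -/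
def covDerivAlong {n : ℕ} (L : Coord n → Coord n → ℝ) (c V : ℝ → Coord n) (t : ℝ) : Coord n :=
  WithLp.toLp 2 fun k => deriv V t k + ∑ i, V t i *
    ((∑ j, horizCoeff L k i j (c t) (deriv c t) * deriv c t j)
      + ∑ r, cartan L k i r (c t) (deriv c t) * verticalPart L c t r)

/-- The coefficients of the Cartan `Y`-connection of a vector field `Y` with components `Yⁱ(x)`:
`Γ*^k_ij(x) = Γ^k_ij(x, Y) + C^k_ir(x, Y) Y^r_j`, where `Y^r_j = ∂_j Yʳ + G^r_j(x, Y)`. -/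
def cartanYCoeff {n : ℕ} (L : Coord n → Coord n → ℝ) (Y : Coord n → Coord n) (k i j : Fin n)
    (x : Coord n) : ℝ :=
  horizCoeff L k i j x (Y x) + ∑ r, cartan L k i r x (Y x) *
    (fderiv ℝ Y x (basisVec j) r + nonlinearConn L r j x (Y x))

/-- For every extension `Y` of the velocity of `c`, the derivative `covDerivAlong` is the one of
the Cartan `Y`-connection: `(D*_ċ V)ᵏ = dVᵏ/dt + Vⁱ ċʲ Γ*^k_ij(c)`. -/
theorem covDerivAlong_eq_of_extension {n : ℕ} (L : Coord n → Coord n → ℝ) (c V : ℝ → Coord n)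
    (Y : Coord n → Coord n) (t : ℝ) (hc : DifferentiableAt ℝ c t)
    (hY : DifferentiableAt ℝ Y (c t)) (h : ∀ᶠ s in nhds t, Y (c s) = deriv c s) (k : Fin n) :
    covDerivAlong L c V t k =
      deriv V t k + ∑ i, ∑ j, V t i * deriv c t j * cartanYCoeff L Y k i j (c t) := by
  have h0 : Y (c t) = deriv c t := h.self_of_nhds
  have h1 : deriv (deriv c) t = fderiv ℝ Y (c t) (deriv c t) := by
    have h2 : (fun s => Y (c s)) =ᶠ[nhds t] deriv c := h
    rw [← h2.deriv_eq]
    exact fderiv_comp_deriv t hY hc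
  have h3 : deriv c t = ∑ j, deriv c t j • (basisVec j : Coord n) := by
    ext a
    simp [basisVec, Finset.sum_apply, Pi.single_apply]
  have h4 : ∀ r, deriv (deriv c) t r
      = ∑ j, deriv c t j * fderiv ℝ Y (c t) (basisVec j) r := by
    intro r
    rw [h1]
    conv_lhs => rw [h3]
    simp [map_sum]
  simp only [covDerivAlong, cartanYCoeff, verticalPart, h0, h4]
  congr 1
  refine Finset.sum_congr rfl fun i _ => ?_
  simp only [mul_add, Finset.mul_sum, Finset.sum_add_distrib]
  congr 1
  · exact Finset.sum_congr rfl fun j _ => by ring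
  · congr 1
    · rw [Finset.sum_comm]
      exact Finset.sum_congr rfl fun j _ => Finset.sum_congr rfl fun r _ => by ring
    · rw [Finset.sum_comm]
      exact Finset.sum_congr rfl fun j _ => Finset.sum_congr rfl fun r _ => by ring

/-! ### Finsler manifolds -/

section Manifold

variable {n : ℕ} {M : Type*} [TopologicalSpace M] [ChartedSpace (EuclideanSpace ℝ (Fin n)) M]
  [IsManifold (𝓡 n) ∞ M]

/-- A Finsler metric on `M`: a function on the tangent bundle, smooth away from the zero section,
positive, positively homogeneous of degree one, and with positive definite fundamental tensor
`g_y(v, v) = d²/dt² (F²/2)(y + t v)` at `t = 0`. -/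
structure IsFinslerMetric (F : TangentBundle (𝓡 n) M → ℝ) : Prop where
  smooth : ContMDiffOn (𝓡 n).tangent 𝓘(ℝ, ℝ) ∞ F {v | v.2 ≠ 0}
  map_zero : ∀ p : M, F ⟨p, 0⟩ = 0
  pos : ∀ (p : M) (y : TangentSpace (𝓡 n) p), y ≠ 0 → 0 < F ⟨p, y⟩
  homogeneous : ∀ (p : M) (y : TangentSpace (𝓡 n) p) (a : ℝ), 0 < a → F ⟨p, a • y⟩ = a * F ⟨p, y⟩
  strongly_convex : ∀ (p : M) (y v : TangentSpace (𝓡 n) p), y ≠ 0 → v ≠ 0 →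
    0 < iteratedDeriv 2 (fun t : ℝ => F ⟨p, y + t • v⟩ ^ 2 / 2) 0

/-- The local charts (coordinate systems) of the smooth manifold `M`. -/
abbrev charts (n : ℕ) (M : Type*) [TopologicalSpace M]
    [ChartedSpace (EuclideanSpace ℝ (Fin n)) M] : Set (OpenPartialHomeomorph M (Coord n)) :=
  IsManifold.maximalAtlas (𝓡 n) ∞ M

/-- The tangent vector `yⁱ ∂/∂xⁱ` at the point with coordinates `x` in the chart `e`. -/
def tangentVec (e : OpenPartialHomeomorph M (Coord n)) (x y : Coord n) : TangentBundle (𝓡 n) M :=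
  ⟨e.symm x, mfderiv (𝓡 n) (𝓡 n) e.symm x y⟩

/-- The coordinate expression `F(x, y)` of `F` in the chart `e`. -/
def localExpr (e : OpenPartialHomeomorph M (Coord n)) (F : TangentBundle (𝓡 n) M → ℝ)
    (x y : Coord n) : ℝ :=
  F (tangentVec e x y)

/-- The velocity `dγ/ds`, as a point of the tangent bundle. -/
def velocity (γ : ℝ → M) (s : ℝ) : TangentBundle (𝓡 n) M :=
  ⟨γ s, mfderiv 𝓘(ℝ, ℝ) (𝓡 n) γ s (1 : ℝ)⟩

/-- `γ`, restricted to the open interval `I`, is a geodesic circle of `F` parametrized by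
arc length: `F(γ̇) = 1` and `D*_γ̇ D*_γ̇ γ̇ + g_γ̇(D*_γ̇ γ̇, D*_γ̇ γ̇) γ̇ = 0`, the latter in all local
coordinates. -/
structure IsGeodesicCircle (F : TangentBundle (𝓡 n) M → ℝ) (γ : ℝ → M) (I : Set ℝ) : Prop where
  isOpen : IsOpen I
  isConnected : IsConnected I
  smooth : ContMDiffOn 𝓘(ℝ, ℝ) (𝓡 n) ∞ γ I
  unit_speed : ∀ s ∈ I, F (velocity (n := n) γ s) = 1
  equation : ∀ e ∈ charts n M, ∀ s ∈ I, γ s ∈ e.source →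
    let L := localExpr e F
    let c : ℝ → Coord n := fun t => e (γ t)
    let A : ℝ → Coord n := covDerivAlong L c (deriv c)
    covDerivAlong L c A s
      + (∑ i, ∑ j, metric L i j (c s) (deriv c s) * A s i * A s j) • deriv c s = 0

/-- Every geodesic circle of `F` is, after an orientation preserving change of the parameter, a
geodesic circle of `F₁`. -/
def CirclesAreCircles (F F₁ : TangentBundle (𝓡 n) M → ℝ) : Prop :=
  ∀ (γ : ℝ → M) (I : Set ℝ), IsGeodesicCircle F γ I →
    ∃ (φ : ℝ → ℝ) (J : Set ℝ), ContDiffOn ℝ ∞ φ J ∧ (∀ t ∈ J, 0 < deriv φ t) ∧ φ '' J = I ∧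
      IsGeodesicCircle F₁ (fun t => γ (φ t)) J

/-- `F` and `F₁` are concircular: they have the same geodesic circles, regarded as (oriented)
curves without a distinguished parameter. -/
def Concircular (F F₁ : TangentBundle (𝓡 n) M → ℝ) : Prop :=
  CirclesAreCircles F F₁ ∧ CirclesAreCircles F₁ F

/-- The equations `u_{i|j} = lam g_ij` and `uʳ C^k_ri = 0`, for the metric `F` and with a function
`lam` on `M`. They hold at all `(x, y)` with `y ≠ 0`, in all local coordinates. -/
def ConcircularEquations (F : TangentBundle (𝓡 n) M → ℝ) (u lam : M → ℝ) : Prop :=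
  ∀ e ∈ charts n M, ∀ x ∈ e.target, ∀ y : Coord n, y ≠ 0 →
    (∀ i j, hessian (localExpr e F) (fun z => u (e.symm z)) i j x y
      = lam (e.symm x) * metric (localExpr e F) i j x y) ∧
    (∀ i k, ∑ r, gradUp (localExpr e F) (fun z => u (e.symm z)) r x y
      * cartan (localExpr e F) k r i x y = 0)

/-- `R^i_k = K (F² δ^i_k - yⁱ y_k)` with a function `K` on the tangent bundle. -/
def HasFlagCurvature (F K : TangentBundle (𝓡 n) M → ℝ) : Prop :=
  ∀ e ∈ charts n M, ∀ x ∈ e.target, ∀ y : Coord n, y ≠ 0 → ∀ i k,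
    riemann (localExpr e F) i k x y = K (tangentVec e x y) *
      (localExpr e F x y ^ 2 * (if i = k then 1 else 0) - y i * lowerY (localExpr e F) k x y)

/-- `F` is of scalar flag curvature. -/
def IsOfScalarFlagCurvature (F : TangentBundle (𝓡 n) M → ℝ) : Prop :=
  ∃ K : TangentBundle (𝓡 n) M → ℝ, HasFlagCurvature F K

/-- `F` is of isotropic flag curvature `K = K(x)`. -/
def IsOfIsotropicFlagCurvature (F : TangentBundle (𝓡 n) M → ℝ) : Prop :=
  ∃ K : M → ℝ, HasFlagCurvature F (fun v => K v.proj)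

/-- `F` is of constant flag curvature. -/
def IsOfConstantFlagCurvature (F : TangentBundle (𝓡 n) M → ℝ) : Prop :=
  ∃ K : ℝ, HasFlagCurvature F (fun _ => K)

/-- `Ric = (n - 1) K F²` with a function `K` on the tangent bundle, the Ricci scalar. -/
def HasRicciScalar (F K : TangentBundle (𝓡 n) M → ℝ) : Prop :=
  ∀ e ∈ charts n M, ∀ x ∈ e.target, ∀ y : Coord n, y ≠ 0 →
    ricci (localExpr e F) x y = ((n : ℝ) - 1) * K (tangentVec e x y) * localExpr e F x y ^ 2

/-- `F` is an Einstein metric: its Ricci scalar is a function `K = K(x)` on `M`. -/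
def IsEinstein (F : TangentBundle (𝓡 n) M → ℝ) : Prop :=
  ∃ K : M → ℝ, HasRicciScalar F (fun v => K v.proj)

/-- The relation `K₁ = K u² + 2 lam u - u_m uᵐ`, at all `(x, y)` with `y ≠ 0`. -/
def CurvatureRelation (F : TangentBundle (𝓡 n) M → ℝ) (u lam : M → ℝ)
    (K K₁ : TangentBundle (𝓡 n) M → ℝ) : Prop :=
  ∀ e ∈ charts n M, ∀ x ∈ e.target, ∀ y : Coord n, y ≠ 0 →
    K₁ (tangentVec e x y) = K (tangentVec e x y) * u (e.symm x) ^ 2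
      + 2 * lam (e.symm x) * u (e.symm x)
      - ∑ m, grad (fun z => u (e.symm z)) m x
          * gradUp (localExpr e F) (fun z => u (e.symm z)) m x y

end Manifold

end

end Finsler

open scoped Manifold ContDiff Topology

namespace Finsler

/-! ### Partial derivatives of functions of position and direction -/

section PartialDerivatives

variable {V : Type*} [NormedAddCommGroup V] [NormedSpace ℝ V]
  {W : Type*} [NormedAddCommGroup W] [NormedSpace ℝ W]
  {W' : Type*} [NormedAddCommGroup W'] [NormedSpace ℝ W']

/-! Write E = F²/2, g for the fundamental tensor, N for the derivative of the spray G in y, and B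
for the gradient of u with respect to g. The tensor C is the same for F and F/u, while the spray
changes by (E/u) B − (du(y)/u) y. Let a curve c of F-unit speed be traversed with the arc length of
F/u, that is, through a parameter φ with φ' = u(c∘φ). Then the circle expression of F/u is u³ times
that of F plus u² times the part of D*B along c that is orthogonal to ċ (`circleField_conformal`).
So a circle of F stays a circle exactly when D*B is tangent to it.

Under (*) the gradient B does not depend on y and D*B = λċ, so every circle survives
(`ConcircularEquations.circlesAreCircles`). Conversely, an ODE gives a circle with any position,
unit velocity y and covariant acceleration A orthogonal to y (`exists_circle`), and D*B there is a
term free of A minus C(A, B). Comparing A with 0 shows that C(A, B) is a multiple of y; it is also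
orthogonal to y, so it vanishes. What is left says Hess u(y, ·) = μ g(y, ·), and μ is constant in y
because its y-derivative is zero and the nonzero vectors form a connected set
(`exists_isConcircularGradient`). Differentiating in y restores the full Hessian equation
(`hess_eq`), and the factors λ found in different charts agree (`lam_transition`). The other
inclusion of circles follows by symmetry: 1/u solves the equations for F/u, with −λ + |∇u|²/u in
place of λ (`ConcircularEquations.inv`).

For the curvature, the change of spray is inserted into R and derivatives of B are removed with the
Hessian equation. This adds (2λu − |∇u|²) u⁻² (F² id − y ⊗ g(y, ·)) to R (`curv_concircular`), so K
becomes Ku² + 2λu − |∇u|²; the trace treats Ric. Since B depends on x only, so does |∇u|², which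
covers isotropic curvature and Einstein metrics. For constant K, the Ricci identity for B
(`fderiv_curv`) forces dλ + K du = 0; together with d|∇u|² = 2λ du this makes the new curvature
locally constant.

The geometry is done without indices, by Fréchet derivatives on a normed space; `IsLocalExpr`
carries it over to the coordinate formulas. -/

/-- The partial derivative of `T(x, y)` in the position `x`. -/
noncomputable def pX (T : V → V → W) (x y : V) : V →L[ℝ] W := fderiv ℝ (fun z => T z y) x

/-- The partial derivative of `T(x, y)` in the direction `y`. -/
noncomputable def pY (T : V → V → W) (x y : V) : V →L[ℝ] W := fderiv ℝ (fun z => T x z) y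

/-- `T(x, y)` is smooth for `x ∈ U` and `y ≠ 0`. -/
def SmoothOver (U : Set V) (T : V → V → W) : Prop :=
  ContDiffOn ℝ ∞ (fun p : V × V => T p.1 p.2) (U ×ˢ {0}ᶜ)

variable {U : Set V} {T S : V → V → W} {x y : V}

omit [NormedSpace ℝ V] in
theorem isOpen_slit (hU : IsOpen U) : IsOpen (U ×ˢ ({0}ᶜ : Set V)) :=
  hU.prod isOpen_compl_singleton

omit [NormedSpace ℝ V] in
theorem mem_slit (hx : x ∈ U) (hy : y ≠ 0) : (x, y) ∈ U ×ˢ ({0}ᶜ : Set V) := ⟨hx, hy⟩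

theorem SmoothOver.contDiffAt (h : SmoothOver U T) (hU : IsOpen U) (hx : x ∈ U) (hy : y ≠ 0) :
    ContDiffAt ℝ ∞ (fun p : V × V => T p.1 p.2) (x, y) :=
  ContDiffOn.contDiffAt h ((isOpen_slit hU).mem_nhds (mem_slit hx hy))

theorem SmoothOver.differentiableAt (h : SmoothOver U T) (hU : IsOpen U) (hx : x ∈ U)
    (hy : y ≠ 0) : DifferentiableAt ℝ (fun p : V × V => T p.1 p.2) (x, y) :=
  (h.contDiffAt hU hx hy).differentiableAt (by simp)

theorem hasFDerivAt_slice_left (x y : V) :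
    HasFDerivAt (fun z : V => (z, y)) (ContinuousLinearMap.inl ℝ V V) x := by
  exact (hasFDerivAt_id x).prodMk (hasFDerivAt_const y x)

theorem hasFDerivAt_slice_right (x y : V) :
    HasFDerivAt (fun z : V => (x, z)) (ContinuousLinearMap.inr ℝ V V) y := by
  exact (hasFDerivAt_const x y).prodMk (hasFDerivAt_id y)

theorem pX_eq_comp (h : DifferentiableAt ℝ (fun p : V × V => T p.1 p.2) (x, y)) :
    pX T x y = (fderiv ℝ (fun p : V × V => T p.1 p.2) (x, y)).comp
      (ContinuousLinearMap.inl ℝ V V) :=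
  (HasFDerivAt.comp (f := fun z : V => (z, y)) x h.hasFDerivAt
    (hasFDerivAt_slice_left x y)).fderiv

theorem pY_eq_comp (h : DifferentiableAt ℝ (fun p : V × V => T p.1 p.2) (x, y)) :
    pY T x y = (fderiv ℝ (fun p : V × V => T p.1 p.2) (x, y)).comp
      (ContinuousLinearMap.inr ℝ V V) :=
  (HasFDerivAt.comp (f := fun z : V => (x, z)) y h.hasFDerivAt
    (hasFDerivAt_slice_right x y)).fderiv

theorem SmoothOver.hasFDerivAt_left (h : SmoothOver U T) (hU : IsOpen U) (hx : x ∈ U)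
    (hy : y ≠ 0) : HasFDerivAt (fun z => T z y) (pX T x y) x := by
  have h1 := h.differentiableAt hU hx hy
  rw [pX_eq_comp h1]
  exact HasFDerivAt.comp (f := fun z : V => (z, y)) x h1.hasFDerivAt (hasFDerivAt_slice_left x y)

theorem SmoothOver.hasFDerivAt_right (h : SmoothOver U T) (hU : IsOpen U) (hx : x ∈ U)
    (hy : y ≠ 0) : HasFDerivAt (fun z => T x z) (pY T x y) y := by
  have h1 := h.differentiableAt hU hx hy
  rw [pY_eq_comp h1]
  exact HasFDerivAt.comp (f := fun z : V => (x, z)) y h1.hasFDerivAt (hasFDerivAt_slice_right x y)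

theorem SmoothOver.fderiv_apply (h : SmoothOver U T) (hU : IsOpen U) (hx : x ∈ U)
    (hy : y ≠ 0) (v w : V) :
    fderiv ℝ (fun p : V × V => T p.1 p.2) (x, y) (v, w) = pX T x y v + pY T x y w := by
  have h1 := h.differentiableAt hU hx hy
  rw [pX_eq_comp h1, pY_eq_comp h1]
  simp [← map_add]

theorem SmoothOver.hasFDerivAt (h : SmoothOver U T) (hU : IsOpen U) (hx : x ∈ U)
    (hy : y ≠ 0) : HasFDerivAt (fun p : V × V => T p.1 p.2)
      ((pX T x y).coprod (pY T x y)) (x, y) := by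
  have h1 := (h.differentiableAt hU hx hy).hasFDerivAt
  convert h1 using 1
  ext v
  · simp [h.fderiv_apply hU hx hy]
  · simp [h.fderiv_apply hU hx hy]

/-- The chain rule along a curve of positions and directions. -/
theorem SmoothOver.hasDerivAt (h : SmoothOver U T) (hU : IsOpen U) {c d : ℝ → V} {c' d' : V}
    {t : ℝ} (hx : c t ∈ U) (hy : d t ≠ 0) (hc : HasDerivAt c c' t) (hd : HasDerivAt d d' t) :
    HasDerivAt (fun s => T (c s) (d s)) (pX T (c t) (d t) c' + pY T (c t) (d t) d') t := by
  have := (h.hasFDerivAt hU hx hy).comp_hasDerivAt t (hc.prodMk hd)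
  simpa [Function.comp_def] using this

theorem SmoothOver.fderiv_smooth (h : SmoothOver U T) (hU : IsOpen U) :
    ContDiffOn ℝ ∞ (fderiv ℝ (fun p : V × V => T p.1 p.2)) (U ×ˢ {0}ᶜ) :=
  ContDiffOn.fderiv_of_isOpen h (isOpen_slit hU) (by simp)

theorem SmoothOver.pX (h : SmoothOver U T) (hU : IsOpen U) : SmoothOver U (pX T) := by
  refine ((h.fderiv_smooth hU).clm_comp
    (contDiffOn_const (c := ContinuousLinearMap.inl ℝ V V))).congr ?_
  rintro ⟨a, b⟩ hp
  exact pX_eq_comp (h.differentiableAt hU hp.1 hp.2)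

theorem SmoothOver.pY (h : SmoothOver U T) (hU : IsOpen U) : SmoothOver U (pY T) := by
  refine ((h.fderiv_smooth hU).clm_comp
    (contDiffOn_const (c := ContinuousLinearMap.inr ℝ V V))).congr ?_
  rintro ⟨a, b⟩ hp
  exact pY_eq_comp (h.differentiableAt hU hp.1 hp.2)

theorem SmoothOver.congr (h : SmoothOver U T) (e : ∀ x ∈ U, ∀ y ≠ 0, S x y = T x y) :
    SmoothOver U S :=
  ContDiffOn.congr h fun p hp => e p.1 hp.1 p.2 hp.2

theorem pX_congr (hU : IsOpen U) (hx : x ∈ U) (e : ∀ x ∈ U, S x y = T x y) :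
    pX S x y = pX T x y :=
  Filter.EventuallyEq.fderiv_eq (Filter.eventually_of_mem (hU.mem_nhds hx) fun z hz => e z hz)

theorem pY_congr (hy : y ≠ 0) (e : ∀ y ≠ 0, S x y = T x y) : pY S x y = pY T x y :=
  Filter.EventuallyEq.fderiv_eq
    (Filter.eventually_of_mem (isOpen_compl_singleton.mem_nhds hy) fun z hz => e z hz)

theorem pY_eq_of_hasFDerivAt {T' : V →L[ℝ] W} (hy : y ≠ 0) {f : V → W} (h : HasFDerivAt f T' y)
    (e : ∀ y ≠ 0, S x y = f y) : pY S x y = T' :=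
  (h.congr_of_eventuallyEq (Filter.eventually_of_mem (isOpen_compl_singleton.mem_nhds hy)
    fun z hz => e z hz)).fderiv

theorem pX_eq_of_hasFDerivAt {T' : V →L[ℝ] W} (hU : IsOpen U) (hx : x ∈ U) {f : V → W}
    (h : HasFDerivAt f T' x) (e : ∀ x ∈ U, S x y = f x) : pX S x y = T' :=
  (h.congr_of_eventuallyEq (Filter.eventually_of_mem (hU.mem_nhds hx) fun z hz => e z hz)).fderiv

theorem SmoothOver.isSymm (h : SmoothOver U T) (hU : IsOpen U) (hx : x ∈ U) (hy : y ≠ 0) :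
    IsSymmSndFDerivAt ℝ (fun p : V × V => T p.1 p.2) (x, y) :=
  (h.contDiffAt hU hx hy).isSymmSndFDerivAt
    (by
      rw [minSmoothness_of_isRCLikeNormedField]
      exact WithTop.coe_le_coe.2 (le_top : (2 : ℕ∞) ≤ ⊤))

theorem SmoothOver.hasFDerivAt_fderiv (h : SmoothOver U T) (hU : IsOpen U) (hx : x ∈ U)
    (hy : y ≠ 0) : HasFDerivAt (fderiv ℝ (fun p : V × V => T p.1 p.2))
      (fderiv ℝ (fderiv ℝ (fun p : V × V => T p.1 p.2)) (x, y)) (x, y) :=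
  (((h.fderiv_smooth hU).contDiffAt ((isOpen_slit hU).mem_nhds (mem_slit hx hy))).differentiableAt
    (by simp)).hasFDerivAt

theorem SmoothOver.pX_pY_apply (h : SmoothOver U T) (hU : IsOpen U) (hx : x ∈ U) (hy : y ≠ 0)
    (v w : V) : Finsler.pX (Finsler.pY T) x y v w
      = fderiv ℝ (fderiv ℝ (fun p : V × V => T p.1 p.2)) (x, y) (v, 0) (0, w) := by
  have h1 := HasFDerivAt.comp (f := fun z : V => (z, y)) x (h.hasFDerivAt_fderiv hU hx hy)
    (hasFDerivAt_slice_left x y)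
  have h2 := h1.clm_comp (hasFDerivAt_const (ContinuousLinearMap.inr ℝ V V) x)
  rw [pX_eq_of_hasFDerivAt hU hx h2
    fun z hz => pY_eq_comp (h.differentiableAt hU hz hy)]
  simp

theorem SmoothOver.pY_pX_apply (h : SmoothOver U T) (hU : IsOpen U) (hx : x ∈ U) (hy : y ≠ 0)
    (v w : V) : Finsler.pY (Finsler.pX T) x y v w
      = fderiv ℝ (fderiv ℝ (fun p : V × V => T p.1 p.2)) (x, y) (0, v) (w, 0) := by
  have h1 := HasFDerivAt.comp (f := fun z : V => (x, z)) y (h.hasFDerivAt_fderiv hU hx hy)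
    (hasFDerivAt_slice_right x y)
  have h2 := h1.clm_comp (hasFDerivAt_const (ContinuousLinearMap.inl ℝ V V) y)
  rw [pY_eq_of_hasFDerivAt hy h2
    fun z hz => pX_eq_comp (h.differentiableAt hU hx hz)]
  simp

theorem SmoothOver.pY_pY_apply (h : SmoothOver U T) (hU : IsOpen U) (hx : x ∈ U) (hy : y ≠ 0)
    (v w : V) : Finsler.pY (Finsler.pY T) x y v w
      = fderiv ℝ (fderiv ℝ (fun p : V × V => T p.1 p.2)) (x, y) (0, v) (0, w) := by
  have h1 := HasFDerivAt.comp (f := fun z : V => (x, z)) y (h.hasFDerivAt_fderiv hU hx hy)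
    (hasFDerivAt_slice_right x y)
  have h2 := h1.clm_comp (hasFDerivAt_const (ContinuousLinearMap.inr ℝ V V) y)
  rw [pY_eq_of_hasFDerivAt hy h2
    fun z hz => pY_eq_comp (h.differentiableAt hU hx hz)]
  simp

/-- Both mixed partials are the second derivative of the joint function on V × V at the vectors (v,
0) and (0, w), taken in the two orders. -/
theorem SmoothOver.pY_pX_comm (h : SmoothOver U T) (hU : IsOpen U) (hx : x ∈ U) (hy : y ≠ 0)
    (v w : V) : Finsler.pY (Finsler.pX T) x y v w = Finsler.pX (Finsler.pY T) x y w v := by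
  rw [h.pY_pX_apply hU hx hy, h.pX_pY_apply hU hx hy]
  exact h.isSymm hU hx hy _ _

theorem SmoothOver.pY_pY_comm (h : SmoothOver U T) (hU : IsOpen U) (hx : x ∈ U) (hy : y ≠ 0)
    (v w : V) : Finsler.pY (Finsler.pY T) x y v w = Finsler.pY (Finsler.pY T) x y w v := by
  rw [h.pY_pY_apply hU hx hy, h.pY_pY_apply hU hx hy]
  exact h.isSymm hU hx hy _ _

/-- The partial derivatives of a pointwise application of a family of linear maps. -/
theorem pX_clm_apply {A : V → V → (W →L[ℝ] W')} (hA : SmoothOver U A) (hT : SmoothOver U T)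
    (hU : IsOpen U) (hx : x ∈ U) (hy : y ≠ 0) (v : V) :
    pX (fun x y => A x y (T x y)) x y v = pX A x y v (T x y) + A x y (pX T x y v) := by
  have := (hA.hasFDerivAt_left hU hx hy).clm_apply (hT.hasFDerivAt_left hU hx hy)
  rw [pX, this.fderiv]
  simp [add_comm]

theorem pY_clm_apply {A : V → V → (W →L[ℝ] W')} (hA : SmoothOver U A) (hT : SmoothOver U T)
    (hU : IsOpen U) (hx : x ∈ U) (hy : y ≠ 0) (v : V) :
    pY (fun x y => A x y (T x y)) x y v = pY A x y v (T x y) + A x y (pY T x y v) := by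
  have := (hA.hasFDerivAt_right hU hx hy).clm_apply (hT.hasFDerivAt_right hU hx hy)
  rw [pY, this.fderiv]
  simp [add_comm]

theorem pX_apply {A : V → V → (W →L[ℝ] W')} (hA : SmoothOver U A)
    (hU : IsOpen U) (hx : x ∈ U) (hy : y ≠ 0) (v : V) (w : W) :
    pX (fun x y => A x y w) x y v = pX A x y v w := by
  have := (hA.hasFDerivAt_left hU hx hy).clm_apply (hasFDerivAt_const w x)
  rw [pX, this.fderiv]
  simp

theorem pY_apply {A : V → V → (W →L[ℝ] W')} (hA : SmoothOver U A)
    (hU : IsOpen U) (hx : x ∈ U) (hy : y ≠ 0) (v : V) (w : W) :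
    pY (fun x y => A x y w) x y v = pY A x y v w := by
  have := (hA.hasFDerivAt_right hU hx hy).clm_apply (hasFDerivAt_const w y)
  rw [pY, this.fderiv]
  simp

theorem pY_apply_self {A : V → V → (V →L[ℝ] W')} (hA : SmoothOver U A)
    (hU : IsOpen U) (hx : x ∈ U) (hy : y ≠ 0) (v : V) :
    pY (fun x y => A x y y) x y v = pY A x y v y + A x y v := by
  have := (hA.hasFDerivAt_right hU hx hy).clm_apply (hasFDerivAt_id y)
  rw [pY, HasFDerivAt.fderiv (f := fun z => A x z z) this]
  simp [add_comm]

theorem pX_of_scaling {a r : ℝ} (h : SmoothOver U T) (hU : IsOpen U) (hx : x ∈ U) (hy : y ≠ 0)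
    (e : ∀ x ∈ U, T x (a • y) = r • T x y) : pX T x (a • y) = r • pX T x y := by
  have h1 := (h.hasFDerivAt_left hU hx hy).const_smul r
  exact (h1.congr_of_eventuallyEq (Filter.eventually_of_mem (hU.mem_nhds hx) e)).fderiv

/-- The chain rule produces a factor `a` on the left, so each derivative in y lowers the degree of
homogeneity by one. -/
theorem pY_of_scaling {a r : ℝ} (h : SmoothOver U T) (hU : IsOpen U) (hx : x ∈ U) (hy : y ≠ 0)
    (ha : a ≠ 0) (e : ∀ y ≠ 0, T x (a • y) = r • T x y) :
    a • pY T x (a • y) = r • pY T x y := by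
  have h1 := (h.hasFDerivAt_right hU hx hy).const_smul r
  have h2 := HasFDerivAt.comp (f := fun z : V => a • z) y
    (h.hasFDerivAt_right hU hx (smul_ne_zero ha hy)) ((hasFDerivAt_id y).const_smul a)
  have h3 := h2.unique (h1.congr_of_eventuallyEq
    (Filter.eventually_of_mem (isOpen_compl_singleton.mem_nhds hy) e))
  rw [← h3]
  ext v
  simp

theorem SmoothOver.clm_apply {A : V → V → (W →L[ℝ] W')} (hA : SmoothOver U A)
    (hT : SmoothOver U T) : SmoothOver U (fun x y => A x y (T x y)) :=
  ContDiffOn.clm_apply hA hT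

theorem smoothOver_const (c : W) : SmoothOver U (fun _ _ : V => c) := contDiffOn_const

theorem smoothOver_snd : SmoothOver U (fun _ y : V => y) := contDiffOn_snd

theorem smoothOver_of_left {f : V → W} (hf : ContDiffOn ℝ ∞ f U) :
    SmoothOver U (fun x _ : V => f x) :=
  hf.comp contDiffOn_fst fun _ hp => hp.1

theorem SmoothOver.sub (hT : SmoothOver U T) (hS : SmoothOver U S) :
    SmoothOver U (fun x y => T x y - S x y) := ContDiffOn.sub hT hS

theorem SmoothOver.contDiffOn_left (h : SmoothOver U T) (hy : y ≠ 0) :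
    ContDiffOn ℝ ∞ (fun x => T x y) U :=
  ContDiffOn.comp (g := fun p : V × V => T p.1 p.2) h
    (contDiff_id.prodMk contDiff_const).contDiffOn fun _ hx => mem_slit hx hy

@[simp] theorem pY_of_left (f : V → W) (x y : V) : pY (fun x _ : V => f x) x y = 0 := by
  simp [pY]

theorem pX_of_left (f : V → W) (x y : V) : pX (fun x _ : V => f x) x y = fderiv ℝ f x := rfl

end PartialDerivatives

/-! ### The local geometry of a Finsler metric without indices -/

section LocalGeometry

variable {V : Type*} [NormedAddCommGroup V] [NormedSpace ℝ V]

/-- The fundamental tensor of the energy `E = F² / 2`. -/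
noncomputable abbrev fund (E : V → V → ℝ) := pY (pY E)

/-- The third derivative in the direction, which is twice the Cartan torsion. -/
noncomputable abbrev tors (E : V → V → ℝ) := pY (pY (pY E))

/-- `E = F² / 2` is the energy of a Finsler metric over the open set `U`, `G` its spray and `C` its
Cartan torsion. -/
structure IsLocalFinsler (U : Set V) (E : V → V → ℝ) (G : V → V → V)
    (C : V → V → V →L[ℝ] V →L[ℝ] V) : Prop where
  isOpen : IsOpen U
  smooth : SmoothOver U E
  smooth_spray : SmoothOver U G
  smooth_cartan : SmoothOver U C
  homog : ∀ x ∈ U, ∀ y ≠ 0, ∀ a : ℝ, 0 < a → E x (a • y) = a ^ 2 * E x y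
  pos : ∀ x ∈ U, ∀ y ≠ 0, 0 < E x y
  posDef : ∀ x ∈ U, ∀ y ≠ 0, ∀ v ≠ 0, 0 < fund E x y v v
  spray_eq : ∀ x ∈ U, ∀ y ≠ 0, ∀ v,
    2 * fund E x y (G x y) v = pX (pY E) x y y v - pX E x y v
  cartan_eq : ∀ x ∈ U, ∀ y ≠ 0, ∀ v w z, 2 * fund E x y (C x y v w) z = tors E x y v w z

variable {U : Set V} {E : V → V → ℝ} {G : V → V → V} {C : V → V → V →L[ℝ] V →L[ℝ] V}
  {x y : V}

section
variable (h : SmoothOver U E) (hU : IsOpen U) (hx : x ∈ U) (hy : y ≠ 0)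
include h hU hx hy

theorem SmoothOver.fund_comm (v w : V) : fund E x y v w = fund E x y w v :=
  h.pY_pY_comm hU hx hy v w

theorem SmoothOver.tors_comm (u v w : V) : tors E x y u v w = tors E x y v u w := by
  rw [tors, (h.pY hU).pY_pY_comm hU hx hy u v]

theorem SmoothOver.tors_comm' (u v w : V) : tors E x y u v w = tors E x y u w v := by
  have hf : SmoothOver U (fund E) := (h.pY hU).pY hU
  have h1 := pY_apply (hf.clm_apply (smoothOver_const v)) hU hx hy u w
  have h2 := pY_apply (hf.clm_apply (smoothOver_const w)) hU hx hy u v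
  rw [pY_apply hf hU hx hy] at h1 h2
  rw [← h1, ← h2]
  congr 1
  exact pY_congr hy fun z hz => h.fund_comm hU hx hz v w

end

namespace IsLocalFinsler

variable (h : IsLocalFinsler U E G C)

include h

theorem smooth_pY : SmoothOver U (pY E) := h.smooth.pY h.isOpen
theorem smooth_pX : SmoothOver U (pX E) := h.smooth.pX h.isOpen
theorem smooth_fund : SmoothOver U (fund E) := h.smooth_pY.pY h.isOpen
theorem smooth_conn : SmoothOver U (pY G) := h.smooth_spray.pY h.isOpen

variable (hx : x ∈ U) (hy : y ≠ 0)
include hx hy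

theorem fund_comm (v w : V) : fund E x y v w = fund E x y w v :=
  h.smooth.fund_comm h.isOpen hx hy v w

/-- Positive definiteness makes g nondegenerate. Hence G, C and gradients are pinned down by their
pairings with g, and no inverse of g is needed in the index-free theory. -/
theorem eq_of_fund {v w : V} (e : ∀ z, fund E x y v z = fund E x y w z) : v = w := by
  by_contra hne
  have := h.posDef x hx y hy (v - w) (sub_ne_zero.2 hne)
  simp [e] at this

/-- Euler's relation: differentiate a ↦ E(x, ay) at a = 1. -/
theorem pY_self : pY E x y y = 2 * E x y := by
  have h1 : HasDerivAt (fun a : ℝ => E x (a • y)) (pY E x y y) 1 := by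
    have := h.smooth.hasFDerivAt_right h.isOpen hx (y := (1 : ℝ) • y) (by simpa using hy)
    have h2 := this.comp_hasDerivAt (1 : ℝ) ((hasDerivAt_id (1 : ℝ)).smul_const y)
    simpa [Function.comp_def] using h2
  have h2 : HasDerivAt (fun a : ℝ => a ^ 2 * E x y) (2 * E x y) 1 := by
    simpa using (hasDerivAt_pow 2 (1 : ℝ)).mul_const (E x y)
  refine h1.unique (h2.congr_of_eventuallyEq ?_)
  filter_upwards [lt_mem_nhds (zero_lt_one (α := ℝ))] with a ha
  exact h.homog x hx y hy a ha

theorem fund_self_right (v : V) : fund E x y v y = pY E x y v := by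
  have h1 := pY_apply_self h.smooth_pY h.isOpen hx hy v
  have h2 : pY (fun x y => pY E x y y) x y = (2 : ℝ) • pY E x y :=
    pY_eq_of_hasFDerivAt hy ((h.smooth.hasFDerivAt_right h.isOpen hx hy).const_smul (2 : ℝ))
      fun z hz => h.pY_self hx hz
  rw [h2] at h1
  simp at h1
  linarith

theorem fund_self_left (v : V) : fund E x y y v = pY E x y v := by
  rw [h.fund_comm hx hy, h.fund_self_right hx hy]

theorem fund_self : fund E x y y y = 2 * E x y := by
  rw [h.fund_self_left hx hy, h.pY_self hx hy]

theorem tors_comm (u v w : V) : tors E x y u v w = tors E x y v u w :=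
  h.smooth.tors_comm h.isOpen hx hy u v w

theorem tors_comm' (u v w : V) : tors E x y u v w = tors E x y u w v :=
  h.smooth.tors_comm' h.isOpen hx hy u v w

/-- Euler's relation differentiated twice in y. By the symmetry of the torsion, y is then
annihilated in every slot. -/
theorem tors_self_right (u v : V) : tors E x y u v y = 0 := by
  have h1 := pY_apply_self (h.smooth_fund.clm_apply (smoothOver_const v)) h.isOpen hx hy u
  rw [pY_apply h.smooth_fund h.isOpen hx hy,
    pY_congr hy (S := fun x y => fund E x y v y) (T := fun x y => pY E x y v)
      fun z hz => h.fund_self_right hx hz v, pY_apply h.smooth_pY h.isOpen hx hy,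
    h.fund_comm hx hy] at h1
  linarith

theorem tors_self_mid (u v : V) : tors E x y u y v = 0 := by
  rw [h.tors_comm' hx hy, h.tors_self_right hx hy]

theorem tors_self_left (u v : V) : tors E x y y u v = 0 := by
  rw [h.tors_comm hx hy, h.tors_self_mid hx hy]

theorem cartan_comm (v w : V) : C x y v w = C x y w v := by
  refine h.eq_of_fund hx hy fun z => ?_
  have h1 := h.cartan_eq x hx y hy v w z
  have h2 := h.cartan_eq x hx y hy w v z
  rw [h.tors_comm hx hy] at h2
  linarith

theorem cartan_self_left (v : V) : C x y y v = 0 := by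
  refine h.eq_of_fund hx hy fun z => ?_
  have h1 := h.cartan_eq x hx y hy y v z
  rw [h.tors_self_left hx hy] at h1
  simpa using h1

theorem cartan_self_right (v : V) : C x y v y = 0 := by
  rw [h.cartan_comm hx hy, h.cartan_self_left hx hy]

/-- `∂_x` of the Euler relation for `E`. -/
theorem pX_pY_self (v : V) : pX (pY E) x y v y = 2 * pX E x y v := by
  rw [← pX_apply h.smooth_pY h.isOpen hx hy,
    pX_eq_of_hasFDerivAt (S := fun x b => pY E x b y) h.isOpen hx
      ((h.smooth.hasFDerivAt_left h.isOpen hx hy).const_smul (2 : ℝ))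
      fun z hz => h.pY_self hz hy]
  simp

theorem pX_fund_comm (u v w : V) : pX (fund E) x y u v w = pX (fund E) x y u w v := by
  have h1 := pX_apply (h.smooth_fund.clm_apply (smoothOver_const v)) h.isOpen hx hy u w
  have h2 := pX_apply (h.smooth_fund.clm_apply (smoothOver_const w)) h.isOpen hx hy u v
  rw [pX_apply h.smooth_fund h.isOpen hx hy] at h1 h2
  rw [← h1, ← h2]
  congr 1
  exact pX_congr h.isOpen hx fun z hz => h.fund_comm hz hy v w

theorem pX_fund_self (v w : V) : pX (fund E) x y v w y = pX (pY E) x y v w := by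
  have h1 := pX_apply (h.smooth_fund.clm_apply (smoothOver_const w)) h.isOpen hx hy v y
  rw [pX_apply h.smooth_fund h.isOpen hx hy] at h1
  rw [← h1, ← pX_apply h.smooth_pY h.isOpen hx hy]
  congr 1
  exact pX_congr h.isOpen hx fun z hz => h.fund_self_right hz hy w

theorem pY_pX_pY (u v w : V) : pY (pX (pY E)) x y u v w = pX (fund E) x y v u w := by
  rw [h.smooth_pY.pY_pX_comm h.isOpen hx hy]

/-- The derivative of the equation of the spray in the direction. -/
theorem conn_eq (v w : V) :
    2 * fund E x y (pY G x y w) v + 2 * tors E x y w (G x y) v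
      = pX (fund E) x y y w v + pX (pY E) x y w v - pX (pY E) x y v w := by
  have hd := h.smooth_pY.pX h.isOpen
  have h1 := pY_apply (h.smooth_fund.clm_apply h.smooth_spray) h.isOpen hx hy w v
  rw [pY_clm_apply h.smooth_fund h.smooth_spray h.isOpen hx hy] at h1
  have h2 := pY_apply (hd.clm_apply smoothOver_snd) h.isOpen hx hy w v
  rw [pY_apply_self hd h.isOpen hx hy] at h2
  have h3 := pY_apply h.smooth_pX h.isOpen hx hy w v
  have d1 := (((h.smooth_fund.clm_apply h.smooth_spray).clm_apply
    (smoothOver_const v)).hasFDerivAt_right h.isOpen hx hy).const_smul (2 : ℝ)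
  have d2 := ((hd.clm_apply smoothOver_snd).clm_apply
    (smoothOver_const v)).hasFDerivAt_right h.isOpen hx hy
  have d3 := (h.smooth_pX.clm_apply (smoothOver_const v)).hasFDerivAt_right h.isOpen hx hy
  have e := d1.unique ((d2.sub d3).congr_of_eventuallyEq (Filter.eventually_of_mem
    (isOpen_compl_singleton.mem_nhds hy) fun z hz => by
      simpa using h.spray_eq x hx z hz v))
  have e' := congrArg (fun f => f w) e
  simp only [smul_apply, sub_apply, smul_eq_mul, h1, h2,
    h3, add_apply, h.pY_pX_pY hx hy] at e'
  rw [h.smooth.pY_pX_comm h.isOpen hx hy] at e'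
  linarith

/-- The energy is constant in horizontal directions. -/
theorem pX_energy (v : V) : pX E x y v = pY E x y (pY G x y v) := by
  -- With one slot equal to y the torsion drops out, and Euler's relation reduces the derivatives of
  -- g to derivatives of dE.
  have h1 := h.conn_eq hx hy y v
  rw [h.fund_self_right hx hy, h.tors_self_right hx hy, h.pX_fund_self hx hy,
    h.pX_pY_self hx hy] at h1
  linarith

theorem conn_self : pY G x y y = (2 : ℝ) • G x y := by
  refine h.eq_of_fund hx hy fun z => ?_
  have h1 := h.conn_eq hx hy z y
  have h2 := h.spray_eq x hx y hy z
  rw [h.tors_self_left hx hy, h.pX_fund_comm hx hy, h.pX_fund_self hx hy,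
    h.pX_pY_self hx hy] at h1
  simp
  linarith

theorem pX_pY_eq (v : V) :
    pX (pY E) x y y v = 2 * fund E x y (G x y) v + pY E x y (pY G x y v) := by
  rw [h.spray_eq x hx y hy, ← h.pX_energy hx hy]
  ring

/-- The fundamental tensor is parallel along the spray. -/
theorem fund_parallel (v w : V) :
    fund E x y (pY G x y v) w + fund E x y v (pY G x y w) + 2 * tors E x y v w (G x y)
      = pX (fund E) x y y v w := by
  -- Adding the two instances with v and w exchanged cancels the antisymmetric part ∂ₓ∂ᵧE(w, v) −
  -- ∂ₓ∂ᵧE(v, w).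
  have h1 := h.conn_eq hx hy w v
  have h2 := h.conn_eq hx hy v w
  rw [h.pX_fund_comm hx hy y w v, h.fund_comm hx hy (pY G x y w)] at h2
  have h3 := h.tors_comm hx hy v w (G x y)
  have h4 := h.tors_comm hx hy (G x y) v w
  have h5 := h.tors_comm hx hy (G x y) w v
  have h6 := h.tors_comm' hx hy v (G x y) w
  have h7 := h.tors_comm' hx hy w (G x y) v
  linarith

theorem conn_conn_comm (v w : V) : pY (pY G) x y v w = pY (pY G) x y w v :=
  h.smooth_spray.pY_pY_comm h.isOpen hx hy v w

theorem conn_conn_self (v : V) : pY (pY G) x y v y = pY G x y v := by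
  have h1 := pY_apply_self h.smooth_conn h.isOpen hx hy v
  have h2 : pY (fun x y => pY G x y y) x y = (2 : ℝ) • pY G x y :=
    pY_eq_of_hasFDerivAt hy ((h.smooth_spray.hasFDerivAt_right h.isOpen hx hy).const_smul (2 : ℝ))
      fun z hz => h.conn_self hx hz
  rw [h2] at h1
  simp only [two_smul] at h1
  exact (add_right_cancel h1).symm

/-! Behaviour under rescaling of the direction. -/

variable {a : ℝ} (ha : 0 < a)
include ha

theorem pY_smul : pY E x (a • y) = a • pY E x y := by
  have := pY_of_scaling h.smooth h.isOpen hx hy ha.ne' (r := a ^ 2)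
    fun z hz => by simpa using h.homog x hx z hz a ha
  rw [pow_two, mul_smul] at this
  exact smul_right_injective _ ha.ne' this

theorem fund_smul : fund E x (a • y) = fund E x y := by
  have := pY_of_scaling h.smooth_pY h.isOpen hx hy ha.ne' fun z hz => h.pY_smul hx hz ha
  exact smul_right_injective _ ha.ne' this

theorem tors_smul (u v w : V) : tors E x (a • y) u v w = a⁻¹ * tors E x y u v w := by
  have := pY_of_scaling ((h.smooth_fund.clm_apply (smoothOver_const v)).clm_apply
    (smoothOver_const w)) h.isOpen hx hy ha.ne' (r := 1)
    fun z hz => by simpa using congrArg (fun f => f v w) (h.fund_smul hx hz ha)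
  have h1 := congrArg (fun f => f u) this
  have hay : a • y ≠ 0 := smul_ne_zero ha.ne' hy
  simp only [smul_apply, smul_eq_mul, one_smul] at h1
  rw [pY_apply (h.smooth_fund.clm_apply (smoothOver_const v)) h.isOpen hx hy,
    pY_apply (h.smooth_fund.clm_apply (smoothOver_const v)) h.isOpen hx hay,
    pY_apply h.smooth_fund h.isOpen hx hy, pY_apply h.smooth_fund h.isOpen hx hay] at h1
  rw [← h1, inv_mul_cancel_left₀ ha.ne']

theorem cartan_smul : C x (a • y) = a⁻¹ • C x y := by
  ext v w
  have hay : a • y ≠ 0 := smul_ne_zero ha.ne' hy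
  refine h.eq_of_fund hx hy fun z => ?_
  have h1 := h.cartan_eq x hx _ hay v w z
  have h2 := h.cartan_eq x hx y hy v w z
  rw [h.fund_smul hx hy ha, h.tors_smul hx hy ha] at h1
  simp only [smul_apply, smul_eq_mul, map_smul] at h1 ⊢
  linear_combination h1 / 2 - a⁻¹ * h2 / 2

theorem spray_smul : G x (a • y) = a ^ 2 • G x y := by
  have hay : a • y ≠ 0 := smul_ne_zero ha.ne' hy
  refine h.eq_of_fund hx hy fun z => ?_
  have h1 := h.spray_eq x hx _ hay z
  have h2 := h.spray_eq x hx y hy z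
  rw [h.fund_smul hx hy ha,
    pX_of_scaling h.smooth_pY h.isOpen hx hy fun z hz => h.pY_smul hz hy ha,
    pX_of_scaling h.smooth h.isOpen hx hy (r := a ^ 2)
      fun z hz => by simpa using h.homog z hz y hy a ha] at h1
  simp only [smul_apply, smul_eq_mul, map_smul] at h1 ⊢
  linear_combination h1 / 2 - a ^ 2 * h2 / 2

theorem conn_smul : pY G x (a • y) = a • pY G x y := by
  have := pY_of_scaling h.smooth_spray h.isOpen hx hy ha.ne' fun z hz => h.spray_smul hx hz ha
  rw [pow_two, mul_smul] at this
  exact smul_right_injective _ ha.ne' this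

end IsLocalFinsler

end LocalGeometry

/-! ### Gradients and conformal changes -/

section Conformal

variable {V : Type*} [NormedAddCommGroup V] [NormedSpace ℝ V]
variable {U : Set V} {E : V → V → ℝ} {G : V → V → V} {C : V → V → V →L[ℝ] V →L[ℝ] V}
  {w : V → ℝ} {B : V → V → V} {x y : V}

/-- `B(x, y)` is the gradient of the positive function `w = w(x)` for the fundamental tensor
at `(x, y)`. -/
structure IsGradient (U : Set V) (E : V → V → ℝ) (w : V → ℝ) (B : V → V → V) : Prop where
  smooth_fun : ContDiffOn ℝ ∞ w U
  pos_fun : ∀ x ∈ U, 0 < w x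
  smooth : SmoothOver U B
  eq : ∀ x ∈ U, ∀ y ≠ 0, ∀ v, fund E x y (B x y) v = fderiv ℝ w x v

namespace IsGradient

variable (hB : IsGradient U E w B) (h : IsLocalFinsler U E G C)

include hB

theorem hasFDerivAt_fun (hU : IsOpen U) (hx : x ∈ U) : HasFDerivAt w (fderiv ℝ w x) x :=
  ((hB.smooth_fun.contDiffAt (hU.mem_nhds hx)).differentiableAt (by simp)).hasFDerivAt

theorem smooth_fderiv (hU : IsOpen U) : ContDiffOn ℝ ∞ (fderiv ℝ w) U :=
  hB.smooth_fun.fderiv_of_isOpen hU (by simp)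

theorem hasFDerivAt_fderiv (hU : IsOpen U) (hx : x ∈ U) :
    HasFDerivAt (fderiv ℝ w) (fderiv ℝ (fderiv ℝ w) x) x :=
  (((hB.smooth_fderiv hU).contDiffAt (hU.mem_nhds hx)).differentiableAt (by simp)).hasFDerivAt

theorem fderiv_fderiv_comm (hU : IsOpen U) (hx : x ∈ U) (u v : V) :
    fderiv ℝ (fderiv ℝ w) x u v = fderiv ℝ (fderiv ℝ w) x v u :=
  ((hB.smooth_fun.contDiffAt (hU.mem_nhds hx)).isSymmSndFDerivAt
    (by rw [minSmoothness_of_isRCLikeNormedField]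
        exact WithTop.coe_le_coe.2 (le_top : (2 : ℕ∞) ≤ ⊤))) u v

include h

variable (hx : x ∈ U) (hy : y ≠ 0)
include hx hy

theorem pY_energy_grad : pY E x y (B x y) = fderiv ℝ w x y := by
  rw [← h.fund_self_right hx hy, hB.eq x hx y hy]

/-- Differentiate g(B, ·) = dw in y: the right side is constant, and the derivative of g is twice C.
So B is independent of the direction exactly when C(·, B) = 0. -/
theorem pY_eq (v : V) : pY B x y v = (-2 : ℝ) • C x y v (B x y) := by
  refine h.eq_of_fund hx hy fun z => ?_
  have h1 := pY_apply (h.smooth_fund.clm_apply hB.smooth) h.isOpen hx hy v z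
  rw [pY_clm_apply h.smooth_fund hB.smooth h.isOpen hx hy,
    pY_congr (S := fun x y => fund E x y (B x y) z) (T := fun x _ => fderiv ℝ w x z) hy
      (fun b hb => hB.eq x hx b hb z)] at h1
  have h2 := h.cartan_eq x hx y hy v (B x y) z
  simp at h1 ⊢
  linarith

theorem pX_fund_grad (u v : V) :
    pX (fund E) x y u (B x y) v + fund E x y (pX B x y u) v = fderiv ℝ (fderiv ℝ w) x u v := by
  have h1 := pX_apply (h.smooth_fund.clm_apply hB.smooth) h.isOpen hx hy u v
  rw [pX_clm_apply h.smooth_fund hB.smooth h.isOpen hx hy,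
    pX_congr (S := fun x y => fund E x y (B x y) v) (T := fun x _ => fderiv ℝ w x v) h.isOpen hx
      (fun b hb => hB.eq b hb y hy v), pX_of_left] at h1
  have h2 := (hB.hasFDerivAt_fderiv h.isOpen hx).clm_apply (hasFDerivAt_const v x)
  rw [h2.fderiv] at h1
  simpa using h1.symm

/-- The covariant derivative of the gradient along the spray. -/
theorem fund_cov (v : V) :
    fund E x y (pX B x y y + pY G x y (B x y) + (4 : ℝ) • C x y (G x y) (B x y)) v
      = fderiv ℝ (fderiv ℝ w) x y v - fderiv ℝ w x (pY G x y v) := by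
  have h1 := hB.pX_fund_grad h hx hy y v
  have h2 := h.fund_parallel hx hy (B x y) v
  rw [hB.eq x hx y hy] at h2
  have h3 := h.cartan_eq x hx y hy (G x y) (B x y) v
  rw [h.tors_comm hx hy, h.tors_comm' hx hy] at h3
  simp only [map_add, map_smul, add_apply, smul_apply, smul_eq_mul]
  linarith

end IsGradient

/-- The local form of the concircularity equations: the gradient of `w` depends on the position
only, and its covariant derivative is proportional to the identity. -/
structure IsConcircularGradient (U : Set V) (G : V → V → V) (B : V → V → V) (lam : V → ℝ) :
    Prop where
  pY_eq_zero : ∀ x ∈ U, ∀ y ≠ 0, pY B x y = 0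
  cov_eq : ∀ x ∈ U, ∀ y ≠ 0, pX B x y y + pY G x y (B x y) = lam x • y

/-- The change of the spray under the conformal change `F ↦ F / w`. -/
noncomputable def sprayChange (E : V → V → ℝ) (w : V → ℝ) (B : V → V → V) (x y : V) : V :=
  (E x y * (w x)⁻¹) • B x y - (fderiv ℝ w x y * (w x)⁻¹) • y

section Change

variable {E' : V → V → ℝ} {G' : V → V → V} {C' : V → V → V →L[ℝ] V →L[ℝ] V}
variable (hB : IsGradient U E w B) (h : IsLocalFinsler U E G C) (h' : IsLocalFinsler U E' G' C')
  (conf : ∀ x ∈ U, ∀ y ≠ 0, E' x y = (w x ^ 2)⁻¹ * E x y)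

include hB h conf

variable (hx : x ∈ U) (hy : y ≠ 0)
include hx hy

omit hB in
theorem pY_conformal : pY E' x y = (w x ^ 2)⁻¹ • pY E x y :=
  pY_eq_of_hasFDerivAt hy ((h.smooth.hasFDerivAt_right h.isOpen hx hy).const_smul (w x ^ 2)⁻¹)
    fun z hz => conf x hx z hz

omit hB in
theorem fund_conformal : fund E' x y = (w x ^ 2)⁻¹ • fund E x y :=
  pY_eq_of_hasFDerivAt hy ((h.smooth_pY.hasFDerivAt_right h.isOpen hx hy).const_smul (w x ^ 2)⁻¹)
    fun _ hz => pY_conformal h conf hx hz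

omit conf hy in
theorem hasFDerivAt_inv_sq :
    HasFDerivAt (fun z => (w z ^ 2)⁻¹) ((-2 * (w x)⁻¹ ^ 3) • fderiv ℝ w x) x := by
  have hw := (hB.pos_fun x hx).ne'
  have h1 := (hB.hasFDerivAt_fun h.isOpen hx)
  have h2 : HasDerivAt (fun r : ℝ => (r ^ 2)⁻¹) (-2 * (w x)⁻¹ ^ 3) (w x) := by
    have := (hasDerivAt_pow 2 (w x)).inv (pow_ne_zero 2 hw)
    have e : -2 * (w x)⁻¹ ^ 3 = -(((2 : ℕ) : ℝ) * w x ^ (2 - 1)) / (w x ^ 2) ^ 2 := by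
      norm_num
      field_simp
    rw [e]
    exact this
  exact h2.comp_hasFDerivAt x h1

theorem pX_conformal (v : V) : pX E' x y v
    = (w x ^ 2)⁻¹ * pX E x y v - 2 * (w x)⁻¹ ^ 3 * fderiv ℝ w x v * E x y := by
  rw [pX_eq_of_hasFDerivAt h.isOpen hx ((hasFDerivAt_inv_sq hB h hx).mul
    (h.smooth.hasFDerivAt_left h.isOpen hx hy)) fun z hz => conf z hz y hy]
  simp
  ring

theorem pX_pY_conformal (u v : V) : pX (pY E') x y u v
    = (w x ^ 2)⁻¹ * pX (pY E) x y u v - 2 * (w x)⁻¹ ^ 3 * fderiv ℝ w x u * pY E x y v := by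
  rw [pX_eq_of_hasFDerivAt h.isOpen hx ((hasFDerivAt_inv_sq hB h hx).smul
    (h.smooth_pY.hasFDerivAt_left h.isOpen hx hy)) fun z hz => pY_conformal h conf hz hy]
  simp
  ring

include h'

/-- The factor w⁻² depends on x only, so g and its y-derivative acquire the same factor. -/
theorem cartan_conformal : C' x y = C x y := by
  ext u v
  have hw := (hB.pos_fun x hx).ne'
  refine h.eq_of_fund hx hy fun z => ?_
  have h1 := h'.cartan_eq x hx y hy u v z
  have h2 := h.cartan_eq x hx y hy u v z
  have h3 : tors E' x y u v z = (w x ^ 2)⁻¹ * tors E x y u v z := by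
    have := (h.smooth_fund.hasFDerivAt_right h.isOpen hx hy).const_smul (w x ^ 2)⁻¹
    rw [tors, pY_eq_of_hasFDerivAt hy this fun _ hz => fund_conformal h conf hx hz]
    rfl
  rw [h3, ← h2, fund_conformal h conf hx hy] at h1
  simp only [smul_apply, smul_eq_mul] at h1
  field_simp at h1
  linarith

/-- Only ∂ₓ sees the conformal factor. It contributes −2w⁻³ dw(y) dE + 2w⁻³ E dw; raising the index
with w⁻² g turns dE into y and dw into B. -/
theorem spray_conformal : G' x y = G x y + sprayChange E w B x y := by
  have hw := (hB.pos_fun x hx).ne'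
  refine h.eq_of_fund hx hy fun z => ?_
  have h1 := h'.spray_eq x hx y hy z
  have h2 := h.spray_eq x hx y hy z
  rw [pX_pY_conformal hB h conf hx hy, pX_conformal hB h conf hx hy,
    fund_conformal h conf hx hy] at h1
  simp only [sprayChange, smul_apply, smul_eq_mul, map_add, map_sub, map_smul, add_apply,
    sub_apply, hB.eq x hx y hy, h.fund_self_left hx hy] at h1 ⊢
  have h3 : pX (pY E) x y y z = pX E x y z + 2 * fund E x y (G x y) z := by linarith
  rw [h3] at h1
  field_simp at h1 ⊢
  linarith

omit h' conf in
theorem pY_sprayChange (v : V) : pY (sprayChange E w B) x y v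
    = (pY E x y v * (w x)⁻¹) • B x y + (E x y * (w x)⁻¹) • pY B x y v
      - (fderiv ℝ w x v * (w x)⁻¹) • y - (fderiv ℝ w x y * (w x)⁻¹) • v := by
  have h1 := ((h.smooth.hasFDerivAt_right h.isOpen hx hy).mul_const (w x)⁻¹).smul
    (hB.smooth.hasFDerivAt_right h.isOpen hx hy)
  have h2 := ((fderiv ℝ w x).hasFDerivAt (x := y)).mul_const (w x)⁻¹
  have h3 := h1.sub (h2.smul (hasFDerivAt_id y))
  rw [pY_eq_of_hasFDerivAt hy h3 fun z _ => rfl]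
  simp
  module

theorem conn_conformal (v : V) : pY G' x y v = pY G x y v
    + ((pY E x y v * (w x)⁻¹) • B x y + (E x y * (w x)⁻¹) • pY B x y v
      - (fderiv ℝ w x v * (w x)⁻¹) • y - (fderiv ℝ w x y * (w x)⁻¹) • v) := by
  have hP : SmoothOver U (sprayChange E w B) :=
    (h'.smooth_spray.sub h.smooth_spray).congr fun a ha b hb => by
      rw [spray_conformal hB h h' conf ha hb, add_sub_cancel_left]
  rw [← pY_sprayChange hB h hx hy, pY_eq_of_hasFDerivAt hy
    ((h.smooth_spray.hasFDerivAt_right h.isOpen hx hy).add (hP.hasFDerivAt_right h.isOpen hx hy))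
    fun z hz => spray_conformal hB h h' conf hx hz]
  simp

end Change

end Conformal

/-! ### Curves -/

section Curves

variable {V : Type*} [NormedAddCommGroup V] [NormedSpace ℝ V]

/-- The covariant acceleration of a curve. -/
noncomputable def accel (G : V → V → V) (c : ℝ → V) (t : ℝ) : V :=
  deriv (deriv c) t + (2 : ℝ) • G (c t) (deriv c t)

/-- The covariant derivative of `X` along a curve. -/
noncomputable def covAlong (G : V → V → V) (C : V → V → V →L[ℝ] V →L[ℝ] V) (c X : ℝ → V)
    (t : ℝ) : V :=
  deriv X t + pY G (c t) (deriv c t) (X t) + C (c t) (deriv c t) (X t) (accel G c t)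

/-- The left hand side of the equation of geodesic circles. -/
noncomputable def circleField (E : V → V → ℝ) (G : V → V → V) (C : V → V → V →L[ℝ] V →L[ℝ] V)
    (c : ℝ → V) (t : ℝ) : V :=
  covAlong G C c (accel G c) t
    + fund E (c t) (deriv c t) (accel G c t) (accel G c t) • deriv c t

/-- A smooth immersed curve in `U`, on an open set of parameters. -/
structure IsRegularCurve (U : Set V) (c : ℝ → V) (I : Set ℝ) : Prop where
  isOpen : IsOpen I
  smooth : ContDiffOn ℝ ∞ c I
  mem : ∀ s ∈ I, c s ∈ U
  deriv_ne : ∀ s ∈ I, deriv c s ≠ 0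

variable {U : Set V} {E : V → V → ℝ} {G : V → V → V} {C : V → V → V →L[ℝ] V →L[ℝ] V}
  {w : V → ℝ} {B : V → V → V} {c : ℝ → V} {I : Set ℝ} {s : ℝ}

theorem _root_.ContDiffOn.hasDerivAt_of_isOpen {X : ℝ → V} (hX : ContDiffOn ℝ ∞ X I)
    (hI : IsOpen I) (hs : s ∈ I) : HasDerivAt X (deriv X s) s :=
  ((hX.contDiffAt (hI.mem_nhds hs)).differentiableAt (by simp)).hasDerivAt

theorem IsRegularCurve.smooth_deriv (hc : IsRegularCurve U c I) : ContDiffOn ℝ ∞ (deriv c) I :=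
  hc.smooth.deriv_of_isOpen hc.isOpen (by simp)

theorem IsRegularCurve.comp_smooth {W : Type*} [NormedAddCommGroup W] [NormedSpace ℝ W]
    {T : V → V → W} (hc : IsRegularCurve U c I) (hT : SmoothOver U T) :
    ContDiffOn ℝ ∞ (fun s => T (c s) (deriv c s)) I :=
  ContDiffOn.comp (g := fun p : V × V => T p.1 p.2) hT (hc.smooth.prodMk hc.smooth_deriv)
    fun s hs => ⟨hc.mem s hs, hc.deriv_ne s hs⟩

theorem IsRegularCurve.smooth_accel (hc : IsRegularCurve U c I) (h : SmoothOver U G) :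
    ContDiffOn ℝ ∞ (accel G c) I :=
  (hc.smooth_deriv.deriv_of_isOpen hc.isOpen (by simp)).add
    (contDiffOn_const.smul (hc.comp_smooth h))

theorem IsRegularCurve.hasDerivAt_comp {W : Type*} [NormedAddCommGroup W] [NormedSpace ℝ W]
    {T : V → V → W} (hc : IsRegularCurve U c I) (hU : IsOpen U) (hT : SmoothOver U T)
    (hs : s ∈ I) : HasDerivAt (fun s => T (c s) (deriv c s))
      (pX T (c s) (deriv c s) (deriv c s) + pY T (c s) (deriv c s) (deriv (deriv c) s)) s :=
  hT.hasDerivAt hU (hc.mem s hs) (hc.deriv_ne s hs) (hc.smooth.hasDerivAt_of_isOpen hc.isOpen hs)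
    (hc.smooth_deriv.hasDerivAt_of_isOpen hc.isOpen hs)

variable (h : IsLocalFinsler U E G C) (hc : IsRegularCurve U c I) (hs : s ∈ I)
include h hc hs

/-- By homogeneity N(ċ) = 2G and C(ċ, ·) = 0, so the first covariant derivative of the velocity
involves the spray alone. -/
theorem covAlong_deriv : covAlong G C c (deriv c) s = accel G c s := by
  rw [covAlong, h.conn_self (hc.mem s hs) (hc.deriv_ne s hs),
    h.cartan_self_left (hc.mem s hs) (hc.deriv_ne s hs), add_zero, accel]

/-- The covariant derivative is compatible with the fundamental tensor. -/
theorem hasDerivAt_fund {X Y : ℝ → V} (hX : DifferentiableAt ℝ X s)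
    (hY : DifferentiableAt ℝ Y s) :
    HasDerivAt (fun s => fund E (c s) (deriv c s) (X s) (Y s))
      (fund E (c s) (deriv c s) (covAlong G C c X s) (Y s)
        + fund E (c s) (deriv c s) (X s) (covAlong G C c Y s)) s := by
  have hx := hc.mem s hs
  have hy := hc.deriv_ne s hs
  have h1 := ((hc.hasDerivAt_comp h.isOpen h.smooth_fund hs).clm_apply hX.hasDerivAt).clm_apply
    hY.hasDerivAt
  refine h1.congr_deriv ?_
  -- The horizontal part is the parallelism of g along the spray. In the vertical part the two
  -- Cartan terms add up to the y-derivative of g towards the covariant acceleration.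
  have h2 := h.fund_parallel hx hy (X s) (Y s)
  have h3 := h.cartan_eq _ hx _ hy (X s) (accel G c s) (Y s)
  have h4 := h.cartan_eq _ hx _ hy (Y s) (accel G c s) (X s)
  rw [h.fund_comm hx hy _ (X s)] at h4
  rw [h.tors_comm' hx hy, h.tors_comm hx hy] at h4
  have h5 := h.tors_comm hx hy (Y s) (X s) (accel G c s)
  have h6 := h.tors_comm' hx hy (X s) (accel G c s) (Y s)
  have h7 := h.tors_comm' hx hy (X s) (G (c s) (deriv c s)) (Y s)
  have h8 := h.tors_comm hx hy (X s) (G (c s) (deriv c s)) (Y s)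
  have h9 := h.tors_comm hx hy (X s) (accel G c s) (Y s)
  have h10 : deriv (deriv c) s = accel G c s - (2 : ℝ) • G (c s) (deriv c s) := by
    rw [accel]; abel
  rw [h10]
  simp only [covAlong, map_add, map_sub, map_smul, add_apply, sub_apply, smul_apply, smul_eq_mul]
  linarith

theorem hasDerivAt_energy : HasDerivAt (fun s => E (c s) (deriv c s))
    (fund E (c s) (deriv c s) (deriv c s) (accel G c s)) s := by
  have hx := hc.mem s hs
  have hy := hc.deriv_ne s hs
  refine (hc.hasDerivAt_comp h.isOpen h.smooth hs).congr_deriv ?_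
  rw [h.pX_energy hx hy, h.conn_self hx hy, h.fund_self_left hx hy, ← map_add, accel, add_comm]

theorem fund_deriv_accel_eq_zero (hunit : ∀ s ∈ I, 2 * E (c s) (deriv c s) = 1) :
    fund E (c s) (deriv c s) (deriv c s) (accel G c s) = 0 := by
  have h1 := hasDerivAt_energy h hc hs
  refine h1.unique ((hasDerivAt_const s (1 / 2 : ℝ)).congr_of_eventuallyEq ?_)
  filter_upwards [hc.isOpen.mem_nhds hs] with r hr
  linarith [hunit r hr]

/-- The covariant derivative of the gradient of `w` along a curve. -/
theorem covAlong_grad (hB : IsGradient U E w B) :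
    covAlong G C c (fun s => B (c s) (deriv c s)) s
      = (pX B (c s) (deriv c s) (deriv c s) + pY G (c s) (deriv c s) (B (c s) (deriv c s))
          + (4 : ℝ) • C (c s) (deriv c s) (G (c s) (deriv c s)) (B (c s) (deriv c s)))
        - C (c s) (deriv c s) (accel G c s) (B (c s) (deriv c s)) := by
  have hx := hc.mem s hs
  have hy := hc.deriv_ne s hs
  have h10 : deriv (deriv c) s = accel G c s - (2 : ℝ) • G (c s) (deriv c s) := by
    rw [accel]; abel
  rw [covAlong, (hc.hasDerivAt_comp h.isOpen hB.smooth hs).deriv, hB.pY_eq h hx hy, h10,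
    h.cartan_comm hx hy _ (accel G c s)]
  simp only [map_sub, map_smul, sub_apply, smul_apply]
  module

omit hs

/-- How the equation of geodesic circles changes under the conformal change `F ↦ F / w` and the
corresponding change of the arc length parameter. -/
theorem circleField_conformal {E' : V → V → ℝ} {G' : V → V → V}
    {C' : V → V → V →L[ℝ] V →L[ℝ] V} (hB : IsGradient U E w B) (h' : IsLocalFinsler U E' G' C')
    (conf : ∀ x ∈ U, ∀ y ≠ 0, E' x y = (w x ^ 2)⁻¹ * E x y)
    (hunit : ∀ s ∈ I, 2 * E (c s) (deriv c s) = 1) {c' : ℝ → V} {φ : ℝ → ℝ} {t : ℝ}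
    (ht : φ t ∈ I) (hc' : ∀ᶠ r in 𝓝 t, c' r = c (φ r))
    (hφ : ∀ᶠ r in 𝓝 t, HasDerivAt φ (w (c (φ r))) r) :
    circleField E' G' C' c' t = w (c (φ t)) ^ 3 • circleField E G C c (φ t)
      + w (c (φ t)) ^ 2 • (covAlong G C c (fun s => B (c s) (deriv c s)) (φ t)
        - fund E (c (φ t)) (deriv c (φ t)) (covAlong G C c (fun s => B (c s) (deriv c s)) (φ t))
          (deriv c (φ t)) • deriv c (φ t)) := by
  have hφI : ∀ᶠ r in 𝓝 t, φ r ∈ I :=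
    hφ.self_of_nhds.continuousAt.eventually_mem (hc.isOpen.mem_nhds ht)
  have hd1 : ∀ᶠ r in 𝓝 t, deriv c' r = w (c (φ r)) • deriv c (φ r) := by
    filter_upwards [hc'.eventually_nhds, hφ, hφI] with r h1 h2 h3
    rw [Filter.EventuallyEq.deriv_eq h1]
    exact ((hc.smooth.hasDerivAt_of_isOpen hc.isOpen h3).scomp r h2).deriv
  have hwc : ∀ r ∈ I, HasDerivAt (fun s => w (c s)) (fderiv ℝ w (c r) (deriv c r)) r :=
    fun r hr => (hB.hasFDerivAt_fun h.isOpen (hc.mem r hr)).comp_hasDerivAt r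
      (hc.smooth.hasDerivAt_of_isOpen hc.isOpen hr)
  have hd2 : ∀ᶠ r in 𝓝 t, deriv (deriv c') r = w (c (φ r)) ^ 2 • deriv (deriv c) (φ r)
      + (w (c (φ r)) * fderiv ℝ w (c (φ r)) (deriv c (φ r))) • deriv c (φ r) := by
    filter_upwards [hd1.eventually_nhds, hφ, hφI] with r h1 h2 h3
    rw [Filter.EventuallyEq.deriv_eq h1]
    have := ((hwc _ h3).smul (hc.smooth_deriv.hasDerivAt_of_isOpen hc.isOpen h3)).scomp r h2
    refine this.deriv.trans ?_
    module
  -- `Q` is the covariant acceleration of the reparametrized curve for F/w, written as a field along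
  -- the old curve in the old parameter; its derivative is then only multiplied by φ' = w.
  set Q : ℝ → V := fun s => w (c s) ^ 2 • accel G c s
    - (w (c s) * fund E (c s) (deriv c s) (B (c s) (deriv c s)) (deriv c s)) • deriv c s
    + w (c s) • B (c s) (deriv c s) with hQ
  have hA : ∀ᶠ r in 𝓝 t, accel G' c' r = Q (φ r) := by
    filter_upwards [hd1, hd2, hφI, hc'] with r h1 h2 h3 h4
    have hx := hc.mem _ h3
    have hy := hc.deriv_ne _ h3
    have hw := hB.pos_fun _ hx
    have hu : E (c (φ r)) (deriv c (φ r)) = 1 / 2 := by linarith [hunit _ h3]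
    rw [accel, h1, h2, h4, h'.spray_smul hx hy hw, spray_conformal hB h h' conf hx hy,
      sprayChange, hu, hQ]
    simp only [accel, hB.eq _ hx _ hy, smul_add, smul_sub, smul_smul]
    have e1 : 2 * (w (c (φ r)) ^ 2 * (1 / 2 * (w (c (φ r)))⁻¹)) = w (c (φ r)) := by
      field_simp
    have e2 : 2 * (w (c (φ r)) ^ 2 * (fderiv ℝ w (c (φ r)) (deriv c (φ r)) * (w (c (φ r)))⁻¹))
        = 2 * (w (c (φ r)) * fderiv ℝ w (c (φ r)) (deriv c (φ r))) := by
      field_simp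
    rw [e1, e2]
    module
  have hx := hc.mem _ ht
  have hy := hc.deriv_ne _ ht
  have hw := hB.pos_fun _ hx
  have hu : E (c (φ t)) (deriv c (φ t)) = 1 / 2 := by linarith [hunit _ ht]
  have hBs := hc.comp_smooth hB.smooth
  have dA := (hc.smooth_accel h.smooth_spray).hasDerivAt_of_isOpen hc.isOpen ht
  have dB := hBs.hasDerivAt_of_isOpen hc.isOpen ht
  have dc := hc.smooth_deriv.hasDerivAt_of_isOpen hc.isOpen ht
  have dw := hwc _ ht
  have dwd := hasDerivAt_fund h hc ht dB.differentiableAt dc.differentiableAt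
  rw [covAlong_deriv h hc ht] at dwd
  have dQ := (((dw.pow 2).smul dA).sub ((dw.mul dwd).smul dc)).add (dw.smul dB)
  have dQv : deriv Q (φ t) = _ := dQ.deriv
  simp only [Pi.pow_apply, Pi.mul_apply, Nat.cast_ofNat, Nat.add_one_sub_one, pow_one] at dQv
  have dQ' : deriv (accel G' c') t = w (c (φ t)) • deriv Q (φ t) := by
    rw [Filter.EventuallyEq.deriv_eq hA]
    exact (HasDerivAt.scomp t dQ.differentiableAt.hasDerivAt hφ.self_of_nhds).deriv
  have orth := fund_deriv_accel_eq_zero h hc ht hunit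
  have hdw : fderiv ℝ w (c (φ t)) (deriv c (φ t))
      = fund E (c (φ t)) (deriv c (φ t)) (B (c (φ t)) (deriv c (φ t))) (deriv c (φ t)) :=
    (hB.eq _ hx _ hy _).symm
  have hWy : w (c (φ t)) • deriv c (φ t) ≠ 0 := smul_ne_zero hw.ne' hy
  -- Ordinary derivatives are traded for covariant ones, so that N disappears from the final
  -- identity.
  have eA : deriv (accel G c) (φ t) = covAlong G C c (accel G c) (φ t)
      - pY G (c (φ t)) (deriv c (φ t)) (accel G c (φ t))
      - C (c (φ t)) (deriv c (φ t)) (accel G c (φ t)) (accel G c (φ t)) := by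
    rw [covAlong]; abel
  have eB : deriv (fun s => B (c s) (deriv c s)) (φ t)
      = covAlong G C c (fun s => B (c s) (deriv c s)) (φ t)
      - pY G (c (φ t)) (deriv c (φ t)) (B (c (φ t)) (deriv c (φ t)))
      - C (c (φ t)) (deriv c (φ t)) (B (c (φ t)) (deriv c (φ t))) (accel G c (φ t)) := by
    rw [covAlong]; abel
  have ec : deriv (deriv c) (φ t)
      = accel G c (φ t) - pY G (c (φ t)) (deriv c (φ t)) (deriv c (φ t)) := by
    rw [h.conn_self hx hy, accel]; abel
  have hQ0 : Q (φ t) = w (c (φ t)) ^ 2 • accel G c (φ t)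
    - (w (c (φ t)) * fund E (c (φ t)) (deriv c (φ t)) (B (c (φ t)) (deriv c (φ t)))
      (deriv c (φ t))) • deriv c (φ t) + w (c (φ t)) • B (c (φ t)) (deriv c (φ t)) := rfl
  rw [circleField, circleField, covAlong, dQ', dQv, hA.self_of_nhds, hd1.self_of_nhds,
    hc'.self_of_nhds, h'.conn_smul hx hy hw, cartan_conformal hB h h' conf hx hWy,
    h.cartan_smul hx hy hw, fund_conformal h conf hx hWy, h.fund_smul hx hy hw, smul_apply,
    conn_conformal hB h h' conf hx hy, eA, eB, ec, hu, hdw, hB.pY_eq h hx hy,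
    ← hB.eq _ hx _ hy (Q (φ t)), ← h.fund_self_right hx hy, hQ0]
  have c1 := h.cartan_self_left hx hy
  have c2 := h.cartan_self_right hx hy
  have c3 := h.cartan_comm hx hy (B (c (φ t)) (deriv c (φ t))) (accel G c (φ t))
  have g1 := h.fund_self hx hy
  have g2 := h.fund_comm hx hy (accel G c (φ t)) (deriv c (φ t))
  have g3 := h.fund_comm hx hy (deriv c (φ t)) (B (c (φ t)) (deriv c (φ t)))
  have g4 := h.fund_comm hx hy (accel G c (φ t)) (B (c (φ t)) (deriv c (φ t)))
  rw [hu] at g1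
  rw [orth] at g2
  clear hA hd1 hd2 hc' hφ hφI dQ dQ' dQv dA dB dc dw dwd eA eB ec hQ0 hQ hBs hwc hdw
  -- The rest is linear algebra at one point, for maps g, N and C subject only to the relations
  -- collected in `c1`–`c3`, `g1`–`g4` and `orth`.
  generalize covAlong G C c (fun s => B (c s) (deriv c s)) (φ t) = DB at *
  generalize covAlong G C c (accel G c) (φ t) = DA at *
  generalize accel G c (φ t) = A at *
  generalize B (c (φ t)) (deriv c (φ t)) = b at *
  generalize fund E (c (φ t)) (deriv c (φ t)) = g at *
  generalize pY G (c (φ t)) (deriv c (φ t)) = N at *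
  generalize C (c (φ t)) (deriv c (φ t)) = K at *
  generalize w (c (φ t)) = W at *
  generalize deriv c (φ t) = y at *
  have hW : W⁻¹ * W = 1 := inv_mul_cancel₀ hw.ne'
  simp only [map_add, map_sub, map_smul, add_apply, sub_apply, smul_apply, smul_eq_mul, c1, c2,
    c3, g1, g2, g3, g4, orth, smul_zero, sub_zero, add_zero, smul_add,
    smul_sub, smul_smul]
  match_scalars <;> field_simp <;> ring

end Curves

/-! ### Curvature and concircular changes -/

section Curvature

variable {V : Type*} [NormedAddCommGroup V] [NormedSpace ℝ V]

/-- The Riemann curvature of a spray, `v ↦ R(x, y) v`. -/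
noncomputable def curv (G : V → V → V) (x y v : V) : V :=
  (2 : ℝ) • pX G x y v - pX (pY G) x y y v + (2 : ℝ) • pY (pY G) x y v (G x y)
    - pY G x y (pY G x y v)

variable {U : Set V} {E : V → V → ℝ} {G : V → V → V} {C : V → V → V →L[ℝ] V →L[ℝ] V}
  {w lam : V → ℝ} {B : V → V → V} {x y : V}

variable (hB : IsGradient U E w B) (h : IsLocalFinsler U E G C)
  (hc : IsConcircularGradient U G B lam) (hx : x ∈ U) (hy : y ≠ 0)

section Concircular
include hB h hc hx hy

theorem cartan_grad_eq_zero (v : V) : C x y v (B x y) = 0 := by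
  have h1 := hB.pY_eq h hx hy v
  rw [hc.pY_eq_zero x hx y hy] at h1
  simpa using h1

/-- This is the covariant equation for B with its index lowered, i.e. Hess w(y, ·) = λ g(y, ·). -/
theorem fderiv_fderiv_self (v : V) : fderiv ℝ (fderiv ℝ w) x y v
    = lam x * pY E x y v + fderiv ℝ w x (pY G x y v) := by
  have h1 := hB.fund_cov h hx hy v
  rw [hc.cov_eq x hx y hy, cartan_grad_eq_zero hB h hc hx hy] at h1
  simp only [smul_zero, add_zero, map_smul, smul_apply, smul_eq_mul,
    h.fund_self_left hx hy] at h1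
  linarith

/-- The y-derivative of ∂ₓB(y) + N B = λy. As B does not depend on y, this polarizes the equation
and only the second y-derivative of the spray appears. -/
theorem pX_grad (v : V) : pX B x y v = lam x • v - pY (pY G) x y v (B x y) := by
  have hXB := hB.smooth.pX h.isOpen
  have h1 := (hXB.hasFDerivAt_right h.isOpen hx hy).clm_apply (hasFDerivAt_id y)
  have h2 := (h.smooth_conn.hasFDerivAt_right h.isOpen hx hy).clm_apply
    (hB.smooth.hasFDerivAt_right h.isOpen hx hy)
  have h3 := (h1.add h2).unique
    (((hasFDerivAt_id y).const_smul (lam x)).congr_of_eventuallyEq (Filter.eventually_of_mem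
      (isOpen_compl_singleton.mem_nhds hy) fun z hz => hc.cov_eq x hx z hz))
  have h4 := congrArg (fun f => f v) h3
  have h5 : pY (pX B) x y v y = 0 := by
    rw [hB.smooth.pY_pX_comm h.isOpen hx hy, pX_congr (T := fun _ _ => 0) h.isOpen hx
      fun z hz => hc.pY_eq_zero z hz y hy]
    simp [pX]
  simp [h5, hc.pY_eq_zero x hx y hy] at h4
  rw [← h4]
  abel

theorem fderiv_fderiv_eq (u v : V) : fderiv ℝ (fderiv ℝ w) x u v
    = lam x * fund E x y u v + fderiv ℝ w x (pY (pY G) x y u v) := by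
  have h1 := (((h.smooth_pY.clm_apply (smoothOver_const v)).hasFDerivAt_right h.isOpen hx
    hy).const_smul (lam x)).add ((fderiv ℝ w x).hasFDerivAt.comp y
      ((h.smooth_conn.clm_apply (smoothOver_const v)).hasFDerivAt_right h.isOpen hx hy))
  have h2 : HasFDerivAt (fun z => fderiv ℝ (fderiv ℝ w) x z v)
      ((fderiv ℝ (fderiv ℝ w) x).flip v) y :=
    ((fderiv ℝ (fderiv ℝ w) x).flip v).hasFDerivAt
  have h3 := h2.unique (h1.congr_of_eventuallyEq (Filter.eventually_of_mem
      (isOpen_compl_singleton.mem_nhds hy) fun z hz => by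
        simpa using fderiv_fderiv_self hB h hc hx hz v))
  have h4 := congrArg (fun f => f u) h3
  have h5 := pY_apply h.smooth_pY h.isOpen hx hy u v
  have h6 := pY_apply h.smooth_conn h.isOpen hx hy u v
  simpa [h5, h6] using h4

/-- The derivative of `|grad w|²`. -/
theorem hasFDerivAt_normSq : HasFDerivAt (fun z => fderiv ℝ w z (B z y))
    ((2 * lam x) • fderiv ℝ w x) x := by
  refine ((hB.hasFDerivAt_fderiv h.isOpen hx).clm_apply
    (hB.smooth.hasFDerivAt_left h.isOpen hx hy)).congr_fderiv ?_
  ext v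
  have h1 := fderiv_fderiv_eq hB h hc hx hy v (B x y)
  have h2 := pX_grad hB h hc hx hy v
  rw [h.fund_comm hx hy, hB.eq x hx y hy] at h1
  simp [h1, h2]
  ring

/-- No regularity of λ is assumed. Evaluating the Hessian at (y, y) for a single y expresses λ
through w, G and E, which yields its smoothness and its invariance under changes of chart. -/
theorem lam_eq : lam x = (fderiv ℝ (fderiv ℝ w) x y y - 2 * fderiv ℝ w x (G x y))
    * (2 * E x y)⁻¹ := by
  have h1 := fderiv_fderiv_self hB h hc hx hy y
  have h2 := h.pos x hx y hy
  rw [h.pY_self hx hy, h.conn_self hx hy] at h1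
  rw [h1]
  simp
  field_simp

theorem hasFDerivAt_lam : HasFDerivAt lam (fderiv ℝ lam x) x := by
  have h1 : ContDiffOn ℝ ∞ (fderiv ℝ (fderiv ℝ w)) U :=
    (hB.smooth_fderiv h.isOpen).fderiv_of_isOpen h.isOpen (by simp)
  have h2 : ContDiffOn ℝ ∞ (fun x => (fderiv ℝ (fderiv ℝ w) x y y
      - 2 * fderiv ℝ w x (G x y)) * (2 * E x y)⁻¹) U := by
    refine ContDiffOn.mul (((h1.clm_apply contDiffOn_const).clm_apply contDiffOn_const).sub
      (contDiffOn_const.mul ((hB.smooth_fderiv h.isOpen).clm_apply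
        (h.smooth_spray.contDiffOn_left hy)))) ?_
    refine (contDiffOn_const.mul (h.smooth.contDiffOn_left hy)).inv fun z hz => ?_
    have := h.pos z hz y hy
    positivity
  have h3 : ContDiffOn ℝ ∞ lam U := h2.congr fun z hz => lam_eq hB h hc hz hy
  exact ((h3.contDiffAt (h.isOpen.mem_nhds hx)).differentiableAt (by simp)).hasFDerivAt

/-- The Ricci identity for the gradient of `w`. -/
theorem fderiv_curv (v : V) : -fderiv ℝ w x (curv G x y v)
    = 2 * E x y * fderiv ℝ lam x v - fderiv ℝ lam x y * pY E x y v := by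
  have h1 : ContDiffOn ℝ ∞ (fderiv ℝ (fderiv ℝ w)) U :=
    (hB.smooth_fderiv h.isOpen).fderiv_of_isOpen h.isOpen (by simp)
  have d3 : HasFDerivAt (fderiv ℝ (fderiv ℝ w)) (fderiv ℝ (fderiv ℝ (fderiv ℝ w)) x) x :=
    ((h1.contDiffAt (h.isOpen.mem_nhds hx)).differentiableAt (by simp)).hasFDerivAt
  have d2 := hB.hasFDerivAt_fderiv h.isOpen hx
  have dl := hasFDerivAt_lam hB h hc hx hy
  have dE := h.smooth.hasFDerivAt_left h.isOpen hx hy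
  have s1 : ∀ a b c, fderiv ℝ (fderiv ℝ (fderiv ℝ w)) x a b c
      = fderiv ℝ (fderiv ℝ (fderiv ℝ w)) x b a c := fun a b c => by
    have := (((hB.smooth_fderiv h.isOpen).contDiffAt (h.isOpen.mem_nhds hx)).isSymmSndFDerivAt
      (by rw [minSmoothness_of_isRCLikeNormedField]
          exact WithTop.coe_le_coe.2 (le_top : (2 : ℕ∞) ≤ ⊤))) a b
    rw [this]
  -- First form: Hess w(y, y) = 2λE, differentiated in the position towards v.
  have e1 := ((d3.clm_apply (hasFDerivAt_const y x)).clm_apply (hasFDerivAt_const y x)).sub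
    ((d2.clm_apply (h.smooth_spray.hasFDerivAt_left h.isOpen hx hy)).const_smul (2 : ℝ))
  have e2 := e1.unique (((dl.mul dE).const_smul (2 : ℝ)).congr_of_eventuallyEq
    (Filter.eventually_of_mem (h.isOpen.mem_nhds hx) fun z hz => by
      have h1 := fderiv_fderiv_self hB h hc hz hy y
      rw [h.pY_self hz hy, h.conn_self hz hy] at h1
      simp at h1 ⊢
      linarith))
  -- Second form: Hess w(y, v) = λ dE(v), differentiated in the position towards y. The third
  -- derivatives of w agree by symmetry, and the difference of the two forms leaves the curvature.
  have e3 := ((d3.clm_apply (hasFDerivAt_const y x)).clm_apply (hasFDerivAt_const v x)).sub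
    (d2.clm_apply ((h.smooth_conn.hasFDerivAt_left h.isOpen hx hy).clm_apply
      (hasFDerivAt_const v x)))
  have e4 := e3.unique ((dl.mul ((h.smooth_pY.hasFDerivAt_left h.isOpen hx hy).clm_apply
      (hasFDerivAt_const v x))).congr_of_eventuallyEq
    (Filter.eventually_of_mem (h.isOpen.mem_nhds hx) fun z hz => by
      have h1 := fderiv_fderiv_self hB h hc hz hy v
      simp at h1 ⊢
      linarith))
  have e5 := congrArg (fun f => f v) e2
  have e6 := congrArg (fun f => f y) e4
  have s2 : fderiv ℝ (fderiv ℝ (fderiv ℝ w)) x y v y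
      = fderiv ℝ (fderiv ℝ (fderiv ℝ w)) x y y v := by
    have f1 := (d3.clm_apply (hasFDerivAt_const v x)).clm_apply (hasFDerivAt_const y x)
    have f2 := (d3.clm_apply (hasFDerivAt_const y x)).clm_apply (hasFDerivAt_const v x)
    have f3 := f1.unique (f2.congr_of_eventuallyEq (Filter.eventually_of_mem
      (h.isOpen.mem_nhds hx) fun z hz => hB.fderiv_fderiv_comm h.isOpen hz v y))
    simpa using congrArg (fun f => f y) f3
  have k1 := fderiv_fderiv_eq hB h hc hx hy v (G x y)
  have k2 := fderiv_fderiv_self hB h hc hx hy (pY G x y v)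
  have k3 := h.pX_energy hx hy v
  have k4 := h.pX_pY_eq hx hy v
  have k5 := h.fund_comm hx hy v (G x y)
  simp [s1 v y y, s2, k1, k2, k3, k4, k5] at e5 e6
  simp only [curv, map_add, map_sub, map_smul, smul_eq_mul]
  linarith

end Concircular

section Change

variable {E' : V → V → ℝ} {G' : V → V → V} {C' : V → V → V →L[ℝ] V →L[ℝ] V}
  (h' : IsLocalFinsler U E' G' C')
  (conf : ∀ x ∈ U, ∀ y ≠ 0, E' x y = (w x ^ 2)⁻¹ * E x y)

include hB h hc

section
include hx

omit hc in
theorem hasFDerivAt_inv_fun : HasFDerivAt (fun z => (w z)⁻¹) (-((w x)⁻¹ ^ 2) • fderiv ℝ w x) x := by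
  have hw := (hB.pos_fun x hx).ne'
  have h1 := (hasDerivAt_inv hw).comp_hasFDerivAt x (hB.hasFDerivAt_fun h.isOpen hx)
  rw [inv_pow]
  exact h1

include hy

omit hc in
theorem pX_sprayChange (v : V) : pX (sprayChange E w B) x y v
    = (pX E x y v * (w x)⁻¹ - E x y * (w x)⁻¹ ^ 2 * fderiv ℝ w x v) • B x y
      + (E x y * (w x)⁻¹) • pX B x y v
      - (fderiv ℝ (fderiv ℝ w) x v y * (w x)⁻¹
        - fderiv ℝ w x y * (w x)⁻¹ ^ 2 * fderiv ℝ w x v) • y := by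
  have hi := hasFDerivAt_inv_fun hB h hx
  have h1 := ((h.smooth.hasFDerivAt_left h.isOpen hx hy).mul hi).smul
    (hB.smooth.hasFDerivAt_left h.isOpen hx hy)
  have h2 := (((hB.hasFDerivAt_fderiv h.isOpen hx).clm_apply (hasFDerivAt_const y x)).mul
    hi).smul (hasFDerivAt_const y x)
  rw [pX_eq_of_hasFDerivAt h.isOpen hx (h1.sub h2) fun z _ => rfl]
  simp
  module

theorem pY_sprayChange_of_concircular (v : V) : pY (sprayChange E w B) x y v
    = (pY E x y v * (w x)⁻¹) • B x y - (fderiv ℝ w x v * (w x)⁻¹) • y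
      - (fderiv ℝ w x y * (w x)⁻¹) • v := by
  rw [pY_sprayChange hB h hx hy, hc.pY_eq_zero x hx y hy]
  simp

end

omit hc in
theorem smooth_sprayChange : SmoothOver U (sprayChange E w B) := by
  have hi : ContDiffOn ℝ ∞ (fun z => (w z)⁻¹) U :=
    hB.smooth_fun.inv fun z hz => (hB.pos_fun z hz).ne'
  have hi' : SmoothOver U (fun x _ => (w x)⁻¹) := smoothOver_of_left hi
  have hd : SmoothOver U (fun x y => fderiv ℝ w x y) :=
    (smoothOver_of_left (hB.smooth_fderiv h.isOpen)).clm_apply smoothOver_snd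
  exact ((ContDiffOn.mul h.smooth hi').smul hB.smooth).sub
    ((ContDiffOn.mul hd hi').smul smoothOver_snd)

include hx hy

theorem pX_pY_sprayChange (u v : V) : pX (pY (sprayChange E w B)) x y u v
    = (pX (pY E) x y u v * (w x)⁻¹ - pY E x y v * (w x)⁻¹ ^ 2 * fderiv ℝ w x u) • B x y
      + (pY E x y v * (w x)⁻¹) • pX B x y u
      - (fderiv ℝ (fderiv ℝ w) x u v * (w x)⁻¹
        - fderiv ℝ w x v * (w x)⁻¹ ^ 2 * fderiv ℝ w x u) • y
      - (fderiv ℝ (fderiv ℝ w) x u y * (w x)⁻¹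
        - fderiv ℝ w x y * (w x)⁻¹ ^ 2 * fderiv ℝ w x u) • v := by
  have hi := hasFDerivAt_inv_fun hB h hx
  have hd := hB.hasFDerivAt_fderiv h.isOpen hx
  have h1 := (((h.smooth_pY.hasFDerivAt_left h.isOpen hx hy).clm_apply
    (hasFDerivAt_const v x)).mul hi).smul (hB.smooth.hasFDerivAt_left h.isOpen hx hy)
  have h2 := ((hd.clm_apply (hasFDerivAt_const v x)).mul hi).smul (hasFDerivAt_const y x)
  have h3 := ((hd.clm_apply (hasFDerivAt_const y x)).mul hi).smul (hasFDerivAt_const v x)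
  rw [← pX_apply ((smooth_sprayChange hB h).pY h.isOpen) h.isOpen hx hy,
    pX_eq_of_hasFDerivAt (S := fun x y => pY (sprayChange E w B) x y v) h.isOpen hx
      ((h1.sub h2).sub h3)
      fun z hz => pY_sprayChange_of_concircular hB h hc hz hy v]
  simp
  module

theorem pY_pY_sprayChange (u v : V) : pY (pY (sprayChange E w B)) x y u v
    = (fund E x y u v * (w x)⁻¹) • B x y - (fderiv ℝ w x v * (w x)⁻¹) • u
      - (fderiv ℝ w x u * (w x)⁻¹) • v := by
  have h1 := (((h.smooth_pY.hasFDerivAt_right h.isOpen hx hy).clm_apply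
    (hasFDerivAt_const v y)).mul_const (w x)⁻¹).smul (hB.smooth.hasFDerivAt_right h.isOpen hx hy)
  have h2 := (hasFDerivAt_id (𝕜 := ℝ) y).const_smul (fderiv ℝ w x v * (w x)⁻¹)
  have h3 := ((fderiv ℝ w x).hasFDerivAt (x := y)).mul_const (w x)⁻¹ |>.smul
    (hasFDerivAt_const v y)
  rw [← pY_apply ((smooth_sprayChange hB h).pY h.isOpen) h.isOpen hx hy,
    pY_eq_of_hasFDerivAt (S := fun x y => pY (sprayChange E w B) x y v) hy ((h1.sub h2).sub h3)
      fun z hz => pY_sprayChange_of_concircular hB h hc hx hz v]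
  simp [hc.pY_eq_zero x hx y hy]
  module

include h' conf

/-- The change of the Riemann curvature under a concircular change. -/
theorem curv_concircular (v : V) : curv G' x y v = curv G x y v
    + ((2 * lam x * w x - fderiv ℝ w x (B x y)) * (w x)⁻¹ ^ 2)
      • ((2 * E x y) • v - pY E x y v • y) := by
  have hw := (hB.pos_fun x hx).ne'
  have hP := smooth_sprayChange hB h
  have hP' := hP.pY h.isOpen
  have eG : ∀ z ∈ U, ∀ b ≠ 0, G' z b = G z b + sprayChange E w B z b :=
    fun z hz b hb => spray_conformal hB h h' conf hz hb
  have eN : ∀ z ∈ U, ∀ b ≠ 0, pY G' z b = pY G z b + pY (sprayChange E w B) z b :=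
    fun z hz b hb => pY_eq_of_hasFDerivAt hb ((h.smooth_spray.hasFDerivAt_right h.isOpen hz hb).add
      (hP.hasFDerivAt_right h.isOpen hz hb)) fun b hb => eG z hz b hb
  have eX : pX G' x y = pX G x y + pX (sprayChange E w B) x y :=
    pX_eq_of_hasFDerivAt h.isOpen hx ((h.smooth_spray.hasFDerivAt_left h.isOpen hx hy).add
      (hP.hasFDerivAt_left h.isOpen hx hy)) fun z hz => eG z hz y hy
  have eXN : pX (pY G') x y = pX (pY G) x y + pX (pY (sprayChange E w B)) x y :=
    pX_eq_of_hasFDerivAt h.isOpen hx ((h.smooth_conn.hasFDerivAt_left h.isOpen hx hy).add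
      (hP'.hasFDerivAt_left h.isOpen hx hy)) fun z hz => eN z hz y hy
  have eNN : pY (pY G') x y = pY (pY G) x y + pY (pY (sprayChange E w B)) x y :=
    pY_eq_of_hasFDerivAt hy ((h.smooth_conn.hasFDerivAt_right h.isOpen hx hy).add
      (hP'.hasFDerivAt_right h.isOpen hx hy)) fun b hb => eN x hx b hb
  rw [curv, curv, eX, eXN, eNN, eN x hx y hy, eG x hx y hy]
  -- These relations eliminate the derivatives of B, the second derivatives of w and the position
  -- derivatives of E and dE; the derivatives of G outside the curvature of G then cancel, and the
  -- coefficients of v, y and B can be compared.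
  have k0 := pX_grad hB h hc hx hy y
  have k1 := pX_grad hB h hc hx hy v
  have k2 := h.conn_conn_self hx hy v
  have k2' : pY (pY G) x y y (B x y) = pY G x y (B x y) := by
    rw [h.conn_conn_comm hx hy, h.conn_conn_self hx hy]
  have k3 := fderiv_fderiv_self hB h hc hx hy v
  have k4 := fderiv_fderiv_self hB h hc hx hy y
  have k5 := hB.fderiv_fderiv_comm h.isOpen hx v y
  have k6 := hB.pY_energy_grad h hx hy
  have k7 := h.fund_comm hx hy v (B x y)
  have k8 := hB.eq x hx y hy v
  have k9 := h.pX_pY_eq hx hy v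
  have k10 := h.fund_comm hx hy v (G x y)
  have k11 := h.pX_energy hx hy v
  have k12 := h.pY_self hx hy
  have k13 := h.fund_self_right hx hy v
  have k14 := h.conn_self hx hy
  simp only [add_apply, pX_sprayChange hB h hx hy, pX_pY_sprayChange hB h hc hx hy,
    pY_sprayChange_of_concircular hB h hc hx hy, pY_pY_sprayChange hB h hc hx hy, sprayChange,
    map_add, map_sub, map_smul, smul_eq_mul, k0, k1, k2, k2', k5, k3, k4, k6, k7, k8, k9, k10, k11,
    k12, k13, k14]
  match_scalars <;> field_simp <;> ring

omit hc hy h' conf in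
theorem fderiv_inv_fun (v : V) :
    fderiv ℝ (fun z => (w z)⁻¹) x v = -((w x)⁻¹ ^ 2) * fderiv ℝ w x v := by
  rw [(hasFDerivAt_inv_fun hB h hx).fderiv]
  simp

end Change

end Curvature

/-! ### The concircularity equations -/

section Equations

variable {V : Type*} [NormedAddCommGroup V] [NormedSpace ℝ V]
variable {U : Set V} {E : V → V → ℝ} {G : V → V → V} {C : V → V → V →L[ℝ] V →L[ℝ] V}
  {w lam : V → ℝ} {B : V → V → V} {x y : V}

/-- The horizontal derivative `(δ_v g)(z, u)` of the fundamental tensor. -/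
noncomputable def horizFund (E : V → V → ℝ) (G : V → V → V) (x y v z u : V) : ℝ :=
  pX (fund E) x y v z u - tors E x y (pY G x y v) z u

/-- `Γ(v, z)` is the horizontal part of the Cartan connection at `(x, y)`. -/
def IsHorizConn (E : V → V → ℝ) (G : V → V → V) (x y : V) (Γ : V → V → V) : Prop :=
  ∀ v z u, 2 * fund E x y (Γ v z) u
    = horizFund E G x y v z u + horizFund E G x y z v u - horizFund E G x y u v z

section
variable (h : IsLocalFinsler U E G C) (hx : x ∈ U) (hy : y ≠ 0)
include h hx hy

/-- The torsion vanishes on y, so the defining formula collapses to the differentiated spray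
equation. This is why the circle equation and the Hessian contracted with y need only N and never Γ.
-/
theorem IsHorizConn.apply_self {Γ : V → V → V} (hΓ : IsHorizConn E G x y Γ) (v : V) :
    Γ v y = pY G x y v := by
  refine h.eq_of_fund hx hy fun u => ?_
  have h1 := hΓ v y u
  have h2 := h.conn_eq hx hy u v
  simp only [horizFund, h.tors_self_right hx hy, h.tors_self_mid hx hy, h.conn_self hx hy,
    h.pX_fund_self hx hy, map_smul, smul_apply, smul_eq_mul] at h1
  rw [h.pX_fund_comm hx hy, h.pX_fund_self hx hy] at h1
  have h2 := h.conn_eq hx hy u v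
  have h3 := h.tors_comm hx hy v (G x y) u
  linarith

variable (hB : IsGradient U E w B)
include hB

theorem hess_apply_self {Γ : V → V → V} (hΓ : IsHorizConn E G x y Γ) (v : V) :
    fderiv ℝ (fderiv ℝ w) x v y - fderiv ℝ w x (Γ v y)
      = fund E x y (pX B x y y + pY G x y (B x y) + (4 : ℝ) • C x y (G x y) (B x y)) v := by
  rw [hΓ.apply_self h hx hy, hB.fund_cov h hx hy, hB.fderiv_fderiv_comm h.isOpen hx]

variable (hc : IsConcircularGradient U G B lam)
include hc

omit h in
theorem pY_pX_grad (h : IsLocalFinsler U E G C) : pY (pX B) x y = 0 := by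
  ext u v
  rw [hB.smooth.pY_pX_comm h.isOpen hx hy, pX_congr (T := fun _ _ => 0) h.isOpen hx
    fun z hz => hc.pY_eq_zero z hz y hy]
  simp [pX]

/-- The gradient is a conformal field, polarized once. -/
theorem conformal_field (v : V) : pX (pY E) x y (B x y) v + fund E x y v (pX B x y y)
    + pY E x y (pX B x y v) = 2 * lam x * pY E x y v := by
  have d1 := (h.smooth_pX.hasFDerivAt_right h.isOpen hx hy).clm_apply
    (hB.smooth.hasFDerivAt_right h.isOpen hx hy)
  have d2 := (h.smooth_pY.hasFDerivAt_right h.isOpen hx hy).clm_apply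
    (((hB.smooth.pX h.isOpen).hasFDerivAt_right h.isOpen hx hy).clm_apply (hasFDerivAt_id y))
  have e := (d1.add d2).unique (((h.smooth.hasFDerivAt_right h.isOpen hx hy).const_smul
    (2 * lam x)).congr_of_eventuallyEq (Filter.eventually_of_mem
      (isOpen_compl_singleton.mem_nhds hy) fun z hz => by
        -- Paired with dE, and since E is constant in horizontal directions, the covariant equation
        -- becomes ∂ₓE(B) + dE(∂ₓB(y)) = 2λE. Its y-derivative is the claim.
        have h1 := hc.cov_eq x hx z hz
        have h2 := congrArg (pY E x z) h1
        rw [map_add, map_smul, h.pY_self hx hz, ← h.pX_energy hx hz] at h2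
        simp at h2 ⊢
        linarith))
  have e' := congrArg (fun f => f v) e
  simp [hc.pY_eq_zero x hx y hy, pY_pX_grad hx hy hB hc h] at e'
  rw [h.smooth.pY_pX_comm h.isOpen hx hy] at e'
  linarith

/-- The gradient is a conformal field. -/
theorem conformal_field' (v z : V) : pX (fund E) x y (B x y) z v
    + tors E x y z v (pX B x y y) + fund E x y v (pX B x y z) + fund E x y z (pX B x y v)
      = 2 * lam x * fund E x y z v := by
  have hX := hB.smooth.pX h.isOpen
  have d1 := ((h.smooth_pY.pX h.isOpen).hasFDerivAt_right h.isOpen hx hy).clm_apply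
    (hB.smooth.hasFDerivAt_right h.isOpen hx hy) |>.clm_apply (hasFDerivAt_const v y)
  have d2 := (((h.smooth_fund.hasFDerivAt_right h.isOpen hx hy).clm_apply
    (hasFDerivAt_const v y))).clm_apply
    ((hX.hasFDerivAt_right h.isOpen hx hy).clm_apply (hasFDerivAt_id y))
  have d3 := (h.smooth_pY.hasFDerivAt_right h.isOpen hx hy).clm_apply
    ((hX.hasFDerivAt_right h.isOpen hx hy).clm_apply (hasFDerivAt_const v y))
  have d4 := ((h.smooth_pY.hasFDerivAt_right h.isOpen hx hy).clm_apply
    (hasFDerivAt_const v y)).const_smul (2 * lam x)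
  have e := ((d1.add d2).add d3).unique (d4.congr_of_eventuallyEq (Filter.eventually_of_mem
      (isOpen_compl_singleton.mem_nhds hy) fun b hb => by
        simpa using conformal_field h hx hb hB hc v))
  have e' := congrArg (fun f => f z) e
  simp [hc.pY_eq_zero x hx y hy, pY_pX_grad hx hy hB hc h] at e'
  rw [h.smooth_pY.pY_pX_comm h.isOpen hx hy] at e'
  linarith

/-- Only the contraction of the Hessian with y is given. `conformal_field'` says that the flow of B
scales g by 2λ. Since torsion terms containing B vanish, pairing Γ with B leaves x-derivatives of g
and one torsion term with N B, all of which that relation and the derivative of g(B, ·) = dw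
evaluate. -/
theorem hess_eq {Γ : V → V → V} (hΓ : IsHorizConn E G x y Γ) (v z : V) :
    fderiv ℝ (fderiv ℝ w) x v z - fderiv ℝ w x (Γ v z) = lam x * fund E x y v z := by
  have hT : ∀ a b, tors E x y a b (B x y) = 0 := fun a b => by
    rw [h.tors_comm' hx hy, ← h.cartan_eq x hx y hy, cartan_grad_eq_zero hB h hc hx hy]
    simp
  have h1 := hΓ v z (B x y)
  have h2 := conformal_field' h hx hy hB hc v z
  have h3 := hB.pX_fund_grad h hx hy v z
  have h4 := hB.pX_fund_grad h hx hy z v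
  have h5 := hc.cov_eq x hx y hy
  have h6 : pX B x y y = lam x • y - pY G x y (B x y) := by rw [← h5]; abel
  rw [h6] at h2
  simp only [horizFund, hT] at h1
  rw [h.pX_fund_comm hx hy v, h.pX_fund_comm hx hy z, h.pX_fund_comm hx hy (B x y),
    h.fund_comm hx hy (Γ v z), hB.eq x hx y hy] at h1
  rw [h.tors_comm' hx hy, h.tors_comm hx hy, map_sub, map_smul] at h2
  simp only [sub_apply, smul_apply, h.tors_self_left hx hy, smul_zero, zero_sub] at h2
  have h7 := h.tors_comm' hx hy (pY G x y (B x y)) v z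
  have h8 := h.fund_comm hx hy v z
  have h9 := h.fund_comm hx hy v (pX B x y z)
  have h10 := h.fund_comm hx hy z (pX B x y v)
  have h11 := hB.fderiv_fderiv_comm h.isOpen hx v z
  rw [h8]
  linarith

end

section Inverse

variable {E' : V → V → ℝ} {G' : V → V → V} {C' : V → V → V →L[ℝ] V →L[ℝ] V}
  (hB : IsGradient U E w B) (h : IsLocalFinsler U E G C) (h' : IsLocalFinsler U E' G' C')
  (hc : IsConcircularGradient U G B lam)
  (conf : ∀ x ∈ U, ∀ y ≠ 0, E' x y = (w x ^ 2)⁻¹ * E x y)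
include hB h h' conf

-- Here g is multiplied by w⁻² and d(1/w) = −w⁻² dw, so the factors cancel and the gradient only
-- changes sign.
omit h' in
theorem isGradient_inv : IsGradient U E' (fun z => (w z)⁻¹) (fun x y => -B x y) where
  smooth_fun := hB.smooth_fun.inv fun z hz => (hB.pos_fun z hz).ne'
  pos_fun := fun z hz => inv_pos.2 (hB.pos_fun z hz)
  smooth := ContDiffOn.neg hB.smooth
  eq := fun x hx y hy v => by
    rw [fund_conformal h conf hx hy, fderiv_inv_fun hB h hx]
    simp [hB.eq x hx y hy]

include hc

/-- In the change of N evaluated on B, the two multiples of B cancel because dE(B) = dw(y). What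
remains is a multiple of y, which accounts for the value of μ. -/
theorem isConcircularGradient_inv {μ : V → ℝ}
    (hμ : ∀ x ∈ U, ∀ y ≠ 0, μ x = -lam x + fderiv ℝ w x (B x y) * (w x)⁻¹) :
    IsConcircularGradient U G' (fun x y => -B x y) μ where
  pY_eq_zero := fun x hx y hy => by
    rw [pY_eq_of_hasFDerivAt hy (hB.smooth.hasFDerivAt_right h.isOpen hx hy).neg fun _ _ => rfl,
      hc.pY_eq_zero x hx y hy, neg_zero]
  cov_eq := fun x hx y hy => by
    have h1 := hc.cov_eq x hx y hy
    have h2 : pX B x y y = lam x • y - pY G x y (B x y) := by rw [← h1]; abel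
    rw [pX_eq_of_hasFDerivAt h.isOpen hx (hB.smooth.hasFDerivAt_left h.isOpen hx hy).neg
      fun _ _ => rfl, conn_conformal hB h h' conf hx hy, hc.pY_eq_zero x hx y hy,
      hμ x hx y hy]
    simp only [neg_apply, zero_apply, map_neg, h2, hB.pY_energy_grad h hx hy]
    module

end Inverse

section FromCircles

variable (hB : IsGradient U E w B) (h : IsLocalFinsler U E G C)
include hB h

theorem grad_smul (hx : x ∈ U) (hy : y ≠ 0) {a : ℝ} (ha : 0 < a) : B x (a • y) = B x y := by
  refine h.eq_of_fund hx hy fun z => ?_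
  rw [hB.eq x hx y hy, ← hB.eq x hx _ (smul_ne_zero ha.ne' hy), h.fund_smul hx hy ha]

/-- If the covariant derivative of the gradient of `w` along every geodesic circle is tangent to
the circle, then the gradient is concircular. -/
theorem exists_isConcircularGradient (hV : 1 < Module.rank ℝ V)
    (H : ∀ x ∈ U, ∀ y ≠ 0, 2 * E x y = 1 → ∀ A, fund E x y y A = 0 → ∃ μ : ℝ,
      pX B x y y + pY G x y (B x y) + (4 : ℝ) • C x y (G x y) (B x y) - C x y A (B x y)
        = μ • y) :
    ∃ lam : V → ℝ, IsConcircularGradient U G B lam := by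
  have unit : ∀ x ∈ U, ∀ y ≠ 0, ∃ a : ℝ, 0 < a ∧ ∃ z : V, z ≠ 0 ∧ 2 * E x z = 1 ∧ y = a • z := by
    intro x hx y hy
    have hE := h.pos x hx y hy
    have hr : 0 < √(2 * E x y) := Real.sqrt_pos.2 (by linarith)
    refine ⟨√(2 * E x y), hr, (√(2 * E x y))⁻¹ • y, smul_ne_zero (inv_pos.2 hr).ne' hy, ?_, ?_⟩
    · rw [h.homog x hx y hy _ (inv_pos.2 hr), inv_pow, Real.sq_sqrt (by linarith)]
      field_simp
    · rw [smul_inv_smul₀ hr.ne']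
  have hC1 : ∀ x ∈ U, ∀ y ≠ 0, 2 * E x y = 1 → ∀ A, C x y A (B x y) = 0 := by
    intro x hx y hy hu
    -- Subtracting the hypothesis for 0 from that for A shows that C(A, B) is a multiple of y. Its
    -- pairing with y is zero because the torsion annihilates y, while g(y, y) = 1.
    have hperp : ∀ A, fund E x y y A = 0 → C x y A (B x y) = 0 := by
      intro A hA
      obtain ⟨μ, hμ⟩ := H x hx y hy hu A hA
      obtain ⟨ν, hν⟩ := H x hx y hy hu 0 (map_zero _)
      rw [map_zero, zero_apply, sub_zero] at hν
      rw [hν] at hμ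
      have h1 : C x y A (B x y) = (ν - μ) • y := by rw [sub_smul, ← hμ]; abel
      have h2 := h.cartan_eq x hx y hy A (B x y) y
      rw [h.tors_self_right hx hy, h1, map_smul, smul_apply, h.fund_self hx hy, hu] at h2
      have h3 : ν - μ = 0 := by simpa using h2
      rw [h1, h3, zero_smul]
    intro A
    -- Removing the y-component of A costs nothing, since C(y, ·) = 0.
    have h1 := hperp (A - fund E x y y A • y) (by
      rw [map_sub, map_smul, h.fund_self hx hy, hu]; simp)
    rw [map_sub, map_smul, sub_apply, smul_apply, h.cartan_self_left hx hy, smul_zero,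
      sub_zero] at h1
    exact h1
  have hC : ∀ x ∈ U, ∀ y ≠ 0, ∀ A, C x y A (B x y) = 0 := by
    intro x hx y hy A
    obtain ⟨a, ha, z, hz, hu, rfl⟩ := unit x hx y hy
    rw [h.cartan_smul hx hz ha, grad_smul hB h hx hz ha, smul_apply, smul_apply,
      hC1 x hx z hz hu, smul_zero]
  have hB0 : ∀ x ∈ U, ∀ y ≠ 0, pY B x y = 0 := fun x hx y hy => by
    ext v
    rw [hB.pY_eq h hx hy, hC x hx y hy, smul_zero, zero_apply]
  have hZ : ∀ x ∈ U, ∀ y ≠ 0, ∃ μ : ℝ, pX B x y y + pY G x y (B x y) = μ • y := by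
    intro x hx y hy
    obtain ⟨a, ha, z, hz, hu, rfl⟩ := unit x hx y hy
    obtain ⟨μ, hμ⟩ := H x hx z hz hu 0 (map_zero _)
    rw [hC x hx z hz, hC x hx z hz, smul_zero, add_zero, sub_zero] at hμ
    refine ⟨μ, ?_⟩
    rw [h.conn_smul hx hz ha, grad_smul hB h hx hz ha,
      pX_of_scaling (r := 1) hB.smooth h.isOpen hx hz fun b hb => by
        rw [grad_smul hB h hb hz ha, one_smul], one_smul, smul_apply, map_smul, ← smul_add, hμ,
      smul_comm]
  have key : ∀ x ∈ U, ∃ l : ℝ, ∀ y ≠ 0, pX B x y y + pY G x y (B x y) = l • y := by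
    intro x hx
    -- This quotient is 2μ. By Hess w(y, ·) = μ dE its numerator has derivative 2μ dE and value 2μE,
    -- so the derivative of the quotient vanishes.
    have hH : ∀ y ≠ 0, HasFDerivAt (fun y => (fderiv ℝ (fderiv ℝ w) x y y
        - 2 * fderiv ℝ w x (G x y)) * (E x y)⁻¹) (0 : V →L[ℝ] ℝ) y := by
      intro y hy
      obtain ⟨μ, hμ⟩ := hZ x hx y hy
      have h0 : ∀ v, fderiv ℝ (fderiv ℝ w) x y v
          = μ * pY E x y v + fderiv ℝ w x (pY G x y v) := by
        intro v
        have := hB.fund_cov h hx hy v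
        rw [hC x hx y hy, smul_zero, add_zero, hμ, map_smul, smul_apply, smul_eq_mul,
          h.fund_self_left hx hy] at this
        linarith
      have hE := (h.pos x hx y hy).ne'
      have d1 := ((fderiv ℝ (fderiv ℝ w) x).hasFDerivAt (x := y)).clm_apply (hasFDerivAt_id y)
      have d2 := ((fderiv ℝ w x).hasFDerivAt.comp y
        (h.smooth_spray.hasFDerivAt_right h.isOpen hx hy)).const_smul (2 : ℝ)
      have d3 := (hasDerivAt_inv hE).comp_hasFDerivAt y
        (h.smooth.hasFDerivAt_right h.isOpen hx hy)
      refine ((d1.sub d2).mul d3).congr_fderiv ?_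
      ext v
      simp [hB.fderiv_fderiv_comm h.isOpen hx v y, h0, h.pY_self hx hy, h.conn_self hx hy]
      field_simp
      ring
    -- Dimension greater than one enters here: the nonzero directions must form a connected set.
    obtain ⟨k, hk⟩ := isOpen_compl_singleton.exists_is_const_of_fderiv_eq_zero
      (isConnected_compl_singleton_of_one_lt_rank hV 0).isPreconnected
      (fun y hy => (hH y hy).differentiableAt.differentiableWithinAt)
      (fun y hy => (hH y hy).fderiv)
    refine ⟨k / 2, fun y hy => ?_⟩
    obtain ⟨μ, hμ⟩ := hZ x hx y hy
    rw [hμ]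
    congr 1
    have h1 := hk y hy
    have h2 := hB.fund_cov h hx hy y
    have hE := (h.pos x hx y hy).ne'
    rw [hC x hx y hy, smul_zero, add_zero, hμ, map_smul, smul_apply, smul_eq_mul,
      h.fund_self hx hy, h.conn_self hx hy, map_smul, smul_eq_mul] at h2
    rw [← h2] at h1
    field_simp at h1
    linarith
  choose l hl using key
  classical
  exact ⟨fun x => if hx : x ∈ U then l x hx else 0,
    ⟨hB0, fun x hx y hy => by simpa [hx] using hl x hx y hy⟩⟩

end FromCircles

end Equations

/-! ### Existence of geodesic circles -/

section Existence

/-- Solutions of a smooth autonomous differential equation are smooth. -/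
theorem contDiffOn_of_hasDerivAt {Z : Type*} [NormedAddCommGroup Z] [NormedSpace ℝ Z] {f : Z → Z}
    {O : Set Z} {α : ℝ → Z} {I : Set ℝ} (hI : IsOpen I) (hf : ContDiffOn ℝ ∞ f O)
    (hα : ∀ t ∈ I, HasDerivAt α (f (α t)) t) (hO : ∀ t ∈ I, α t ∈ O) : ContDiffOn ℝ ∞ α I := by
  rw [contDiffOn_infty]
  intro m
  -- Bootstrapping: α' = f ∘ α is as smooth as α, so each pass gains one derivative.
  induction m with
  | zero =>
    rw [Nat.cast_zero, contDiffOn_zero]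
    exact fun t ht => (hα t ht).continuousAt.continuousWithinAt
  | succ m ih =>
    rw [Nat.cast_succ, contDiffOn_succ_iff_deriv_of_isOpen hI]
    refine ⟨fun t ht => (hα t ht).differentiableAt.differentiableWithinAt, by simp, ?_⟩
    exact ((hf.of_le (by exact_mod_cast le_top)).comp ih hO).congr fun t ht => (hα t ht).deriv

/-- Uniqueness of the zero solution of a linear system of a special form. -/
theorem eq_zero_of_linear_system {p q k : ℝ → ℝ} {M ε : ℝ} (hε : 0 < ε)
    (hp : ∀ t ∈ Set.Ioo (-ε) ε, HasDerivAt p (2 * q t) t)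
    (hq : ∀ t ∈ Set.Ioo (-ε) ε, HasDerivAt q (-(k t * p t)) t)
    (hk : ∀ t ∈ Set.Ioo (-ε) ε, |k t| ≤ M) (hp0 : p 0 = 0) (hq0 : q 0 = 0) :
    ∀ t ∈ Set.Ioo (-ε) ε, p t = 0 := by
  have h0 : (0 : ℝ) ∈ Set.Ioo (-ε) ε := by simp [hε]
  have hM : 0 ≤ M := (abs_nonneg _).trans (hk 0 h0)
  -- In the maximum norm the two components are bounded by factors 2 and M; `M + 2` dominates both.
  have hlip : ∀ t ∈ Set.Ioo (-ε) ε, LipschitzOnWith (Real.toNNReal (M + 2))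
      (fun z : ℝ × ℝ => (2 * z.2, -(k t * z.1))) Set.univ := by
    intro t ht
    refine LipschitzOnWith.of_dist_le_mul fun a _ b _ => ?_
    rw [Real.coe_toNNReal _ (by linarith), Prod.dist_eq, Prod.dist_eq]
    have h1 := le_max_left (dist a.1 b.1) (dist a.2 b.2)
    have h2 := le_max_right (dist a.1 b.1) (dist a.2 b.2)
    have h3 : 0 ≤ max (dist a.1 b.1) (dist a.2 b.2) := dist_nonneg.trans h1
    refine max_le ?_ ?_
    · rw [Real.dist_eq, ← mul_sub, abs_mul, ← Real.dist_eq, abs_of_pos (zero_lt_two' ℝ)]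
      nlinarith
    · rw [Real.dist_eq, neg_sub_neg, ← mul_sub, abs_mul, abs_sub_comm, ← Real.dist_eq]
      have h4 := hk t ht
      have h5 := mul_le_mul h4 h1 dist_nonneg hM
      nlinarith
  have key := ODE_solution_unique_of_mem_Ioo (f := fun t => (p t, q t)) (g := fun _ => (0, 0))
    (v := fun t z => (2 * z.2, -(k t * z.1))) (s := fun _ => Set.univ) hlip h0
    (fun t ht => ⟨(hp t ht).prodMk (hq t ht), trivial⟩)
    (fun t ht => ⟨(hasDerivAt_const t ((0, 0) : ℝ × ℝ)).congr_deriv (by simp; rfl), trivial⟩)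
    (by simp [hp0, hq0])
  exact fun t ht => congrArg Prod.fst (key ht)

variable {V : Type*} [NormedAddCommGroup V] [NormedSpace ℝ V] [CompleteSpace V]
variable {U : Set V} {E : V → V → ℝ} {G : V → V → V} {C : V → V → V →L[ℝ] V →L[ℝ] V} {x y A : V}

/-- There is a geodesic circle with given position, unit velocity and covariant acceleration
orthogonal to the velocity. -/
theorem exists_circle (h : IsLocalFinsler U E G C) (hx : x ∈ U) (hy : y ≠ 0)
    (hu : 2 * E x y = 1) (hA : fund E x y y A = 0) :
    ∃ ε > 0, ∃ c : ℝ → V, IsRegularCurve U c (Set.Ioo (-ε) ε) ∧ c 0 = x ∧ deriv c 0 = y ∧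
      accel G c 0 = A ∧ (∀ s ∈ Set.Ioo (-ε) ε, 2 * E (c s) (deriv c s) = 1) ∧
      ∀ s ∈ Set.Ioo (-ε) ε, circleField E G C c s = 0 := by
  set O : Set (V × V × V) := {p | (p.1, p.2.1) ∈ U ×ˢ ({0}ᶜ : Set V)} with hOdef
  have hO : IsOpen O := (isOpen_slit h.isOpen).preimage
    (continuous_fst.prodMk (continuous_fst.comp continuous_snd))
  have lift : ∀ {W : Type _} [NormedAddCommGroup W] [NormedSpace ℝ W] {T : V → V → W},
      SmoothOver U T → ContDiffOn ℝ ∞ (fun p : V × V × V => T p.1 p.2.1) O := by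
    intro W _ _ T hT
    exact ContDiffOn.comp (g := fun p : V × V => T p.1 p.2) hT
      (contDiff_fst.prodMk (contDiff_fst.comp contDiff_snd)).contDiffOn fun p hp => hp
  have s1 : ContDiffOn ℝ ∞ (fun p : V × V × V => p.2.1) O :=
    (contDiff_fst.comp contDiff_snd).contDiffOn
  have s2 : ContDiffOn ℝ ∞ (fun p : V × V × V => p.2.2) O :=
    (contDiff_snd.comp contDiff_snd).contDiffOn
  have sk : ContDiffOn ℝ ∞ (fun p : V × V × V => fund E p.1 p.2.1 p.2.2 p.2.2) O :=
    ((lift h.smooth_fund).clm_apply s2).clm_apply s2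
  -- The circle equation as a first-order system for position, velocity and covariant acceleration.
  set f : V × V × V → V × V × V := fun p => (p.2.1, p.2.2 - (2 : ℝ) • G p.1 p.2.1,
    -(pY G p.1 p.2.1 p.2.2) - C p.1 p.2.1 p.2.2 p.2.2
      - fund E p.1 p.2.1 p.2.2 p.2.2 • p.2.1) with hfdef
  have hf : ContDiffOn ℝ ∞ f O :=
    s1.prodMk ((s2.sub (contDiffOn_const.smul (lift h.smooth_spray))).prodMk
      (((((lift h.smooth_conn).clm_apply s2).neg).sub
        (((lift h.smooth_cartan).clm_apply s2).clm_apply s2)).sub (sk.smul s1)))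
  have hp0 : (x, y, A) ∈ O := ⟨hx, hy⟩
  obtain ⟨α, hα0, ε₁, hε₁, hα⟩ :=
    ((hf.contDiffAt (hO.mem_nhds hp0)).of_le
      (by exact_mod_cast le_top)).exists_forall_mem_closedBall_exists_eq_forall_mem_Ioo_hasDerivAt₀
      0
  have hcont : ContinuousAt α 0 := (hα 0 (by simp [hε₁])).continuousAt
  have hk0 : ContinuousAt (fun t => fund E (α t).1 (α t).2.1 (α t).2.2 (α t).2.2) 0 :=
    ContinuousAt.comp (g := fun p : V × V × V => fund E p.1 p.2.1 p.2.2 p.2.2)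
      (by rw [hα0]; exact (sk.contDiffAt (hO.mem_nhds hp0)).continuousAt) hcont
  set k : ℝ → ℝ := fun t => fund E (α t).1 (α t).2.1 (α t).2.2 (α t).2.2 with hk
  have ev1 : ∀ᶠ t in 𝓝 (0 : ℝ), α t ∈ O :=
    hcont.eventually_mem (hO.mem_nhds (by rw [hα0]; exact hp0))
  -- The bound on k = g(A, A) is needed for the uniqueness argument that yields unit speed.
  have ev2 : ∀ᶠ t in 𝓝 (0 : ℝ), |k t| < |k 0| + 1 :=
    hk0.abs.eventually_lt_const (by simp [hk])
  have ev3 : ∀ᶠ t in 𝓝 (0 : ℝ), t ∈ Set.Ioo (0 - ε₁) (0 + ε₁) :=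
    Ioo_mem_nhds (by linarith) (by linarith)
  obtain ⟨ε, hε, hev⟩ := Metric.eventually_nhds_iff_ball.1 (ev1.and (ev2.and ev3))
  rw [Real.ball_eq_Ioo, zero_sub, zero_add] at hev
  have hI0 : (0 : ℝ) ∈ Set.Ioo (-ε) ε := by simp [hε]
  have hα' : ∀ t ∈ Set.Ioo (-ε) ε, HasDerivAt α (f (α t)) t := fun t ht =>
    hα t (hev t ht).2.2
  have hsm : ContDiffOn ℝ ∞ α (Set.Ioo (-ε) ε) :=
    contDiffOn_of_hasDerivAt isOpen_Ioo hf hα' fun t ht => (hev t ht).1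
  have d1 : ∀ t ∈ Set.Ioo (-ε) ε, HasDerivAt (fun t => (α t).1) (α t).2.1 t := fun t ht =>
    (ContinuousLinearMap.fst ℝ V (V × V)).hasFDerivAt.comp_hasDerivAt t (hα' t ht)
  have d2 : ∀ t ∈ Set.Ioo (-ε) ε, HasDerivAt (fun t => (α t).2.1)
      ((α t).2.2 - (2 : ℝ) • G (α t).1 (α t).2.1) t := fun t ht =>
    ((ContinuousLinearMap.fst ℝ V V).comp
      (ContinuousLinearMap.snd ℝ V (V × V))).hasFDerivAt.comp_hasDerivAt t (hα' t ht)
  have d3 : ∀ t ∈ Set.Ioo (-ε) ε, HasDerivAt (fun t => (α t).2.2)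
      (-(pY G (α t).1 (α t).2.1 (α t).2.2) - C (α t).1 (α t).2.1 (α t).2.2 (α t).2.2
      - fund E (α t).1 (α t).2.1 (α t).2.2 (α t).2.2 • (α t).2.1) t := fun t ht =>
    ((ContinuousLinearMap.snd ℝ V V).comp
      (ContinuousLinearMap.snd ℝ V (V × V))).hasFDerivAt.comp_hasDerivAt t (hα' t ht)
  set c : ℝ → V := fun t => (α t).1 with hc
  have e1 : ∀ t ∈ Set.Ioo (-ε) ε, deriv c t = (α t).2.1 := fun t ht => (d1 t ht).deriv
  have e2 : ∀ t ∈ Set.Ioo (-ε) ε, accel G c t = (α t).2.2 := fun t ht => by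
    have : deriv c =ᶠ[𝓝 t] fun t => (α t).2.1 :=
      Filter.eventually_of_mem (isOpen_Ioo.mem_nhds ht) e1
    rw [accel, this.deriv_eq, (d2 t ht).deriv, e1 t ht, sub_add_cancel]
  have hreg : IsRegularCurve U c (Set.Ioo (-ε) ε) :=
    ⟨isOpen_Ioo, contDiff_fst.comp_contDiffOn hsm, fun t ht => (hev t ht).1.1,
      fun t ht => by rw [e1 t ht]; exact (hev t ht).1.2⟩
  have hcov : ∀ t ∈ Set.Ioo (-ε) ε, covAlong G C c (accel G c) t
      = -(k t • deriv c t) := fun t ht => by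
    have : accel G c =ᶠ[𝓝 t] fun t => (α t).2.2 :=
      Filter.eventually_of_mem (isOpen_Ioo.mem_nhds ht) e2
    rw [covAlong, this.deriv_eq, (d3 t ht).deriv, e1 t ht, e2 t ht]
    simp only [hk, hc]
    abel
  have c0 : c 0 = x := by simp [hc, hα0]
  have v0 : deriv c 0 = y := by rw [e1 0 hI0, hα0]
  have a0 : accel G c 0 = A := by rw [e2 0 hI0, hα0]
  -- Unit speed is not part of the system. However, p = g(ċ, ċ) − 1 and q = g(ċ, A) satisfy p' = 2q
  -- and q' = −kp with zero initial values, so p stays zero.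
  have hz := eq_zero_of_linear_system (p := fun t => 2 * E (c t) (deriv c t) - 1)
    (q := fun t => fund E (c t) (deriv c t) (deriv c t) (accel G c t)) (k := k)
    (M := |k 0| + 1) hε
    (fun t ht => ((hasDerivAt_energy h hreg ht).const_mul 2).sub_const 1)
    (fun t ht => by
      have hm := hreg.mem t ht
      have hn := hreg.deriv_ne t ht
      refine (hasDerivAt_fund h hreg ht
        (hreg.smooth_deriv.hasDerivAt_of_isOpen isOpen_Ioo ht).differentiableAt
        ((hreg.smooth_accel h.smooth_spray).hasDerivAt_of_isOpen isOpen_Ioo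
          ht).differentiableAt).congr_deriv ?_
      rw [covAlong_deriv h hreg ht, hcov t ht, map_neg, map_smul, h.fund_self hm hn]
      have : k t = fund E (c t) (deriv c t) (accel G c t) (accel G c t) := by
        rw [e1 t ht, e2 t ht]
      rw [← this, smul_eq_mul]
      ring)
    (fun t ht => (hev t ht).2.1.le)
    (by rw [v0, c0, hu, sub_self])
    (by rw [a0, v0, c0, hA])
  refine ⟨ε, hε, c, hreg, c0, v0, a0,
    fun s hs => by linarith [hz s hs], fun s hs => ?_⟩
  rw [circleField, hcov s hs, e1 s hs, e2 s hs]
  simp [hk, hc]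

end Existence

/-! ### Changes of coordinates -/

section Transition

variable {V : Type*} [NormedAddCommGroup V] [NormedSpace ℝ V]

/-- `ψ` is a smooth map from `U'` to `U` with invertible derivative. -/
structure IsTransition (U' U : Set V) (ψ : V → V) : Prop where
  isOpen : IsOpen U'
  smooth : ContDiffOn ℝ ∞ ψ U'
  mapsTo : ∀ x ∈ U', ψ x ∈ U
  bijective : ∀ x ∈ U', Function.Bijective (fderiv ℝ ψ x)

variable {U U' : Set V} {E E' : V → V → ℝ} {G G' : V → V → V}
  {C C' : V → V → V →L[ℝ] V →L[ℝ] V} {w : V → ℝ} {B B' : V → V → V} {x y : V} {ψ : V → V}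

section
variable (hψ : IsTransition U' U ψ) (hx : x ∈ U')
include hψ hx

theorem IsTransition.hasFDerivAt : HasFDerivAt ψ (fderiv ℝ ψ x) x :=
  ((hψ.smooth.contDiffAt (hψ.isOpen.mem_nhds hx)).differentiableAt (by simp)).hasFDerivAt

theorem IsTransition.hasFDerivAt_fderiv :
    HasFDerivAt (fderiv ℝ ψ) (fderiv ℝ (fderiv ℝ ψ) x) x :=
  (((hψ.smooth.fderiv_of_isOpen hψ.isOpen (m := ∞) (by simp)).contDiffAt
    (hψ.isOpen.mem_nhds hx)).differentiableAt (by simp)).hasFDerivAt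

theorem IsTransition.comm (u v : V) :
    fderiv ℝ (fderiv ℝ ψ) x u v = fderiv ℝ (fderiv ℝ ψ) x v u :=
  ((hψ.smooth.contDiffAt (hψ.isOpen.mem_nhds hx)).isSymmSndFDerivAt
    (by rw [minSmoothness_of_isRCLikeNormedField]
        exact WithTop.coe_le_coe.2 (le_top : (2 : ℕ∞) ≤ ⊤))) u v

theorem IsTransition.ne_zero (hy : y ≠ 0) : fderiv ℝ ψ x y ≠ 0 := fun h0 =>
  hy ((hψ.bijective x hx).1 (by rw [h0, map_zero]))

end

section Tensors

variable (hψ : IsTransition U' U ψ) (h : IsLocalFinsler U E G C) (h' : IsLocalFinsler U' E' G' C')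
  (hE : ∀ x ∈ U', ∀ y ≠ 0, E' x y = E (ψ x) (fderiv ℝ ψ x y))
  (hx : x ∈ U') (hy : y ≠ 0)
include hψ h hE hx hy

theorem pY_transition : pY E' x y = (pY E (ψ x) (fderiv ℝ ψ x y)).comp (fderiv ℝ ψ x) :=
  pY_eq_of_hasFDerivAt hy ((h.smooth.hasFDerivAt_right h.isOpen (hψ.mapsTo x hx)
    (hψ.ne_zero hx hy)).comp y (fderiv ℝ ψ x).hasFDerivAt) fun z hz => hE x hx z hz

theorem pX_transition (v : V) : pX E' x y v = pX E (ψ x) (fderiv ℝ ψ x y) (fderiv ℝ ψ x v)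
    + pY E (ψ x) (fderiv ℝ ψ x y) (fderiv ℝ (fderiv ℝ ψ) x v y) := by
  have h1 := (hψ.hasFDerivAt hx).prodMk
    ((hψ.hasFDerivAt_fderiv hx).clm_apply (hasFDerivAt_const y x))
  have h2 := HasFDerivAt.comp (f := fun z => (ψ z, fderiv ℝ ψ z y)) x
    (h.smooth.hasFDerivAt h.isOpen (hψ.mapsTo x hx) (hψ.ne_zero hx hy)) h1
  rw [pX_eq_of_hasFDerivAt hψ.isOpen hx h2 fun z hz => hE z hz y hy]
  simp

include h'

theorem fund_transition (u v : V) : fund E' x y u v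
    = fund E (ψ x) (fderiv ℝ ψ x y) (fderiv ℝ ψ x u) (fderiv ℝ ψ x v) := by
  have h1 := ((h.smooth_pY.hasFDerivAt_right h.isOpen (hψ.mapsTo x hx)
    (hψ.ne_zero hx hy)).comp y (fderiv ℝ ψ x).hasFDerivAt).clm_apply
      (hasFDerivAt_const (fderiv ℝ ψ x v) y)
  rw [← pY_apply h'.smooth_pY h'.isOpen hx hy,
    pY_eq_of_hasFDerivAt (S := fun x y => pY E' x y v) hy h1 fun z hz => by
      rw [pY_transition hψ h hE hx hz]; rfl]
  simp

theorem tors_transition (u v z : V) : tors E' x y u v z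
    = tors E (ψ x) (fderiv ℝ ψ x y) (fderiv ℝ ψ x u) (fderiv ℝ ψ x v) (fderiv ℝ ψ x z) := by
  have h1 := (((h.smooth_fund.hasFDerivAt_right h.isOpen (hψ.mapsTo x hx)
    (hψ.ne_zero hx hy)).comp y (fderiv ℝ ψ x).hasFDerivAt).clm_apply
      (hasFDerivAt_const (fderiv ℝ ψ x v) y)).clm_apply (hasFDerivAt_const (fderiv ℝ ψ x z) y)
  rw [← pY_apply h'.smooth_fund h'.isOpen hx hy,
    ← pY_apply (h'.smooth_fund.clm_apply (smoothOver_const v)) h'.isOpen hx hy,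
    pY_eq_of_hasFDerivAt (S := fun x y => fund E' x y v z) hy h1 fun b hb =>
      fund_transition hψ h h' hE hx hb v z]
  simp

theorem pX_pY_transition (u v : V) : pX (pY E') x y u v
    = pX (pY E) (ψ x) (fderiv ℝ ψ x y) (fderiv ℝ ψ x u) (fderiv ℝ ψ x v)
      + fund E (ψ x) (fderiv ℝ ψ x y) (fderiv ℝ (fderiv ℝ ψ) x u y) (fderiv ℝ ψ x v)
      + pY E (ψ x) (fderiv ℝ ψ x y) (fderiv ℝ (fderiv ℝ ψ) x u v) := by
  have h1 := (hψ.hasFDerivAt hx).prodMk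
    ((hψ.hasFDerivAt_fderiv hx).clm_apply (hasFDerivAt_const y x))
  have h2 := (HasFDerivAt.comp (f := fun z => (ψ z, fderiv ℝ ψ z y)) x
    (h.smooth_pY.hasFDerivAt h.isOpen (hψ.mapsTo x hx) (hψ.ne_zero hx hy)) h1).clm_apply
    ((hψ.hasFDerivAt_fderiv hx).clm_apply (hasFDerivAt_const v x))
  rw [← pX_apply h'.smooth_pY h'.isOpen hx hy,
    pX_eq_of_hasFDerivAt (S := fun x y => pY E' x y v) hψ.isOpen hx h2 fun z hz => by
      rw [pY_transition hψ h hE hz hy]; rfl]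
  simp
  ring

theorem cartan_transition (u v : V) : fderiv ℝ ψ x (C' x y u v)
    = C (ψ x) (fderiv ℝ ψ x y) (fderiv ℝ ψ x u) (fderiv ℝ ψ x v) := by
  refine h.eq_of_fund (hψ.mapsTo x hx) (hψ.ne_zero hx hy) fun z => ?_
  obtain ⟨z, rfl⟩ := (hψ.bijective x hx).2 z
  have h1 := h'.cartan_eq x hx y hy u v z
  have h2 := h.cartan_eq _ (hψ.mapsTo x hx) _ (hψ.ne_zero hx hy) (fderiv ℝ ψ x u)
    (fderiv ℝ ψ x v) (fderiv ℝ ψ x z)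
  rw [fund_transition hψ h h' hE hx hy, tors_transition hψ h h' hE hx hy] at h1
  linarith

/-- Derivatives of dψ contribute g(D²ψ(y, y), ·) and two terms of the form dE(D²ψ(y, z)), which
cancel by the symmetry of D²ψ. -/
theorem spray_transition : fderiv ℝ ψ x (G' x y)
    = G (ψ x) (fderiv ℝ ψ x y) + (1 / 2 : ℝ) • fderiv ℝ (fderiv ℝ ψ) x y y := by
  refine h.eq_of_fund (hψ.mapsTo x hx) (hψ.ne_zero hx hy) fun z => ?_
  obtain ⟨z, rfl⟩ := (hψ.bijective x hx).2 z
  have h1 := h'.spray_eq x hx y hy z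
  have h2 := h.spray_eq _ (hψ.mapsTo x hx) _ (hψ.ne_zero hx hy) (fderiv ℝ ψ x z)
  rw [fund_transition hψ h h' hE hx hy, pX_pY_transition hψ h h' hE hx hy,
    pX_transition hψ h hE hx hy, hψ.comm hx z y] at h1
  simp only [map_add, map_smul, add_apply, smul_apply, smul_eq_mul]
  linarith

theorem conn_transition (v : V) : fderiv ℝ ψ x (pY G' x y v)
    = pY G (ψ x) (fderiv ℝ ψ x y) (fderiv ℝ ψ x v) + fderiv ℝ (fderiv ℝ ψ) x y v := by
  have h1 := (fderiv ℝ ψ x).hasFDerivAt.comp y (h'.smooth_spray.hasFDerivAt_right h'.isOpen hx hy)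
  have h2 := (h.smooth_spray.hasFDerivAt_right h.isOpen (hψ.mapsTo x hx)
    (hψ.ne_zero hx hy)).comp y (fderiv ℝ ψ x).hasFDerivAt
  have h3 := (((fderiv ℝ (fderiv ℝ ψ) x).hasFDerivAt (x := y)).clm_apply
    (hasFDerivAt_id y)).const_smul (1 / 2 : ℝ)
  have e := h1.unique ((h2.add h3).congr_of_eventuallyEq (Filter.eventually_of_mem
    (isOpen_compl_singleton.mem_nhds hy) fun z hz => spray_transition hψ h h' hE hx hz))
  have e' := congrArg (fun f => f v) e
  simp [hψ.comm hx v y] at e'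
  rw [e']
  module

end Tensors

section Gradient

variable (hψ : IsTransition U' U ψ) (h : IsLocalFinsler U E G C) (h' : IsLocalFinsler U' E' G' C')
  (hE : ∀ x ∈ U', ∀ y ≠ 0, E' x y = E (ψ x) (fderiv ℝ ψ x y))
  {w' : V → ℝ} (hB : IsGradient U E w B) (hB' : IsGradient U' E' w' B')
  (hw : ∀ x ∈ U', w' x = w (ψ x)) (hx : x ∈ U')
include hψ h hB hw

include hx in
theorem fderiv_transition (v : V) : fderiv ℝ w' x v = fderiv ℝ w (ψ x) (fderiv ℝ ψ x v) := by
  have h1 := (hB.hasFDerivAt_fun h.isOpen (hψ.mapsTo x hx)).comp x (hψ.hasFDerivAt hx)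
  rw [(h1.congr_of_eventuallyEq (Filter.eventually_of_mem (hψ.isOpen.mem_nhds hx) hw)).fderiv]
  rfl

include hx in
theorem fderiv_fderiv_transition (hB' : IsGradient U' E' w' B') (u v : V) :
    fderiv ℝ (fderiv ℝ w') x u v
    = fderiv ℝ (fderiv ℝ w) (ψ x) (fderiv ℝ ψ x u) (fderiv ℝ ψ x v)
      + fderiv ℝ w (ψ x) (fderiv ℝ (fderiv ℝ ψ) x u v) := by
  have h1 := ((hB.hasFDerivAt_fderiv h.isOpen (hψ.mapsTo x hx)).comp x
    (hψ.hasFDerivAt hx)).clm_apply ((hψ.hasFDerivAt_fderiv hx).clm_apply (hasFDerivAt_const v x))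
  have h2 := (hB'.hasFDerivAt_fderiv hψ.isOpen hx).clm_apply (hasFDerivAt_const v x)
  have e := h2.unique (h1.congr_of_eventuallyEq (Filter.eventually_of_mem
    (hψ.isOpen.mem_nhds hx) fun z hz => fderiv_transition hψ h hB hw hz v))
  have e' := congrArg (fun f => f u) e
  simp at e'
  rw [e', add_comm]

include h' hE hB' hx
variable (hy : y ≠ 0)
include hy

theorem grad_transition : fderiv ℝ ψ x (B' x y) = B (ψ x) (fderiv ℝ ψ x y) := by
  refine h.eq_of_fund (hψ.mapsTo x hx) (hψ.ne_zero hx hy) fun z => ?_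
  obtain ⟨z, rfl⟩ := (hψ.bijective x hx).2 z
  rw [← fund_transition hψ h h' hE hx hy, hB'.eq x hx y hy, fderiv_transition hψ h hB hw hx,
    hB.eq _ (hψ.mapsTo x hx) _ (hψ.ne_zero hx hy)]

theorem normSq_transition : fderiv ℝ w' x (B' x y)
    = fderiv ℝ w (ψ x) (B (ψ x) (fderiv ℝ ψ x y)) := by
  rw [fderiv_transition hψ h hB hw hx, grad_transition hψ h h' hE hB hB' hw hx hy]

/-- In the formula `lam_eq` the term dw(D²ψ(y, y)) arises once from the Hessian of w and once from
the spray, and the two cancel. -/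
theorem lam_transition {lam lam' : V → ℝ} (hc : IsConcircularGradient U G B lam)
    (hc' : IsConcircularGradient U' G' B' lam') : lam' x = lam (ψ x) := by
  rw [lam_eq hB h hc (hψ.mapsTo x hx) (hψ.ne_zero hx hy), lam_eq hB' h' hc' hx hy,
    fderiv_fderiv_transition hψ h hB hw hx hB', fderiv_transition hψ h hB hw hx,
    spray_transition hψ h h' hE hx hy, hE x hx y hy]
  simp only [map_add, map_smul, smul_eq_mul]
  ring

end Gradient

section CurveTransition

variable {c c' : ℝ → V} {I : Set ℝ} {s : ℝ}
variable (hψ : IsTransition U' U ψ) (h : IsLocalFinsler U E G C) (h' : IsLocalFinsler U' E' G' C')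
  (hE : ∀ x ∈ U', ∀ y ≠ 0, E' x y = E (ψ x) (fderiv ℝ ψ x y))
  (hc' : IsRegularCurve U' c' I) (hcc : ∀ s ∈ I, c s = ψ (c' s)) (hs : s ∈ I)
include hψ hc' hcc hs

theorem deriv_transition : deriv c s = fderiv ℝ ψ (c' s) (deriv c' s) := by
  have h1 := (hψ.hasFDerivAt (hc'.mem s hs)).comp_hasDerivAt s
    (hc'.smooth.hasDerivAt_of_isOpen hc'.isOpen hs)
  exact (h1.congr_of_eventuallyEq (Filter.eventually_of_mem (hc'.isOpen.mem_nhds hs) hcc)).deriv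

omit hcc in
theorem deriv_pushforward {X X' : ℝ → V} (hX : ∀ s ∈ I, X s = fderiv ℝ ψ (c' s) (X' s))
    (hX' : DifferentiableAt ℝ X' s) : deriv X s
      = fderiv ℝ (fderiv ℝ ψ) (c' s) (deriv c' s) (X' s) + fderiv ℝ ψ (c' s) (deriv X' s) := by
  have h1 := ((hψ.hasFDerivAt_fderiv (hc'.mem s hs)).comp_hasDerivAt s
    (hc'.smooth.hasDerivAt_of_isOpen hc'.isOpen hs)).clm_apply hX'.hasDerivAt
  exact (h1.congr_of_eventuallyEq (Filter.eventually_of_mem (hc'.isOpen.mem_nhds hs) hX)).deriv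

include h h' hE

/-- The D²ψ from the second derivative of the curve is compensated by the inhomogeneous term in the
law for the spray. -/
theorem accel_transition : accel G c s = fderiv ℝ ψ (c' s) (accel G' c' s) := by
  have hx := hc'.mem s hs
  have hy := hc'.deriv_ne s hs
  rw [accel, deriv_pushforward hψ hc' hs (X := deriv c) (X' := deriv c')
    (fun r hr => deriv_transition hψ hc' hcc hr)
    (hc'.smooth_deriv.hasDerivAt_of_isOpen hc'.isOpen hs).differentiableAt,
    deriv_transition hψ hc' hcc hs, hcc s hs, accel, map_add, map_smul,
    spray_transition hψ h h' hE hx hy]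
  module

theorem covAlong_transition {X X' : ℝ → V} (hX : ∀ s ∈ I, X s = fderiv ℝ ψ (c' s) (X' s))
    (hX' : DifferentiableAt ℝ X' s) :
    covAlong G C c X s = fderiv ℝ ψ (c' s) (covAlong G' C' c' X' s) := by
  have hx := hc'.mem s hs
  have hy := hc'.deriv_ne s hs
  rw [covAlong, deriv_pushforward hψ hc' hs hX hX',
    accel_transition hψ h h' hE hc' hcc hs, deriv_transition hψ hc' hcc hs, hcc s hs, hX s hs,
    covAlong, map_add, map_add, conn_transition hψ h h' hE hx hy,
    cartan_transition hψ h h' hE hx hy]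
  module

theorem circleField_transition :
    circleField E G C c s = fderiv ℝ ψ (c' s) (circleField E' G' C' c' s) := by
  have hx := hc'.mem s hs
  have hy := hc'.deriv_ne s hs
  rw [circleField, covAlong_transition hψ h h' hE hc' hcc hs
    (fun r hr => accel_transition hψ h h' hE hc' hcc hr)
    ((hc'.smooth_accel h'.smooth_spray).hasDerivAt_of_isOpen hc'.isOpen hs).differentiableAt,
    accel_transition hψ h h' hE hc' hcc hs, deriv_transition hψ hc' hcc hs, hcc s hs,
    ← fund_transition hψ h h' hE hx hy, circleField, map_add, map_smul]

end CurveTransition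

end Transition

/-! ### Comparison with the expressions in coordinates -/

section Coordinates

variable {n : ℕ} {W : Type*} [NormedAddCommGroup W] [NormedSpace ℝ W]

theorem sum_smul_basisVec (v : Coord n) : ∑ i, v i • (basisVec i : Coord n) = v := by
  ext a
  simp [basisVec, Finset.sum_apply, Pi.single_apply]

theorem map_eq_sum (f : Coord n →L[ℝ] W) (v : Coord n) : f v = ∑ i, v i • f (basisVec i) := by
  conv_lhs => rw [← sum_smul_basisVec v]
  simp [map_sum]

theorem map_eq_sum₂ (f : Coord n →L[ℝ] Coord n →L[ℝ] W) (v z : Coord n) :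
    f v z = ∑ i, ∑ j, (v i * z j) • f (basisVec i) (basisVec j) := by
  rw [map_eq_sum f v, sum_apply]
  refine Finset.sum_congr rfl fun i _ => ?_
  rw [smul_apply, map_eq_sum (f (basisVec i)) z, Finset.smul_sum]
  simp [smul_smul]

theorem map_eq_sum₃ (f : Coord n →L[ℝ] Coord n →L[ℝ] Coord n →L[ℝ] ℝ) (a b c : Coord n) :
    f a b c = ∑ i, ∑ j, ∑ k, a i * b j * c k * f (basisVec i) (basisVec j) (basisVec k) := by
  rw [map_eq_sum₂ f, sum_apply]
  refine Finset.sum_congr rfl fun i _ => ?_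
  rw [sum_apply]
  refine Finset.sum_congr rfl fun j _ => ?_
  rw [smul_apply, map_eq_sum _ c, Finset.smul_sum]
  exact Finset.sum_congr rfl fun k _ => by rw [smul_eq_mul, smul_eq_mul]; ring

/-- The bilinear map with given values on pairs of basis vectors. -/
noncomputable def bilinOfBasis (T : Fin n → Fin n → W) : Coord n →L[ℝ] Coord n →L[ℝ] W :=
  ∑ i, ∑ j, (EuclideanSpace.proj i : Coord n →L[ℝ] ℝ).smulRight
    ((EuclideanSpace.proj j : Coord n →L[ℝ] ℝ).smulRight (T i j))

theorem bilinOfBasis_apply (T : Fin n → Fin n → W) (v z : Coord n) :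
    bilinOfBasis T v z = ∑ i, ∑ j, (v i * z j) • T i j := by
  simp [bilinOfBasis, smul_smul]

theorem bilinOfBasis_basisVec (T : Fin n → Fin n → W) (i j : Fin n) :
    bilinOfBasis T (basisVec i) (basisVec j) = T i j := by
  rw [bilinOfBasis_apply, Finset.sum_eq_single i, Finset.sum_eq_single j]
  · simp
  · intro b _ hb; simp [hb]
  · simp
  · intro b _ hb; simp [hb]
  · simp

variable {U : Set (Coord n)} {x y : Coord n}

theorem SmoothOver.of_components {T : Coord n → Coord n → Coord n}
    (h : ∀ i, SmoothOver U (fun x y => T x y i)) : SmoothOver U T :=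
  contDiffOn_euclidean.2 h

theorem SmoothOver.sum {ι : Type*} {s : Finset ι} {T : ι → Coord n → Coord n → W}
    (h : ∀ i ∈ s, SmoothOver U (T i)) : SmoothOver U (fun x y => ∑ i ∈ s, T i x y) :=
  ContDiffOn.sum h

theorem SmoothOver.mul {S T : Coord n → Coord n → ℝ} (hS : SmoothOver U S)
    (hT : SmoothOver U T) : SmoothOver U (fun x y => S x y * T x y) := ContDiffOn.mul hS hT

theorem pX_component {T : Coord n → Coord n → Coord n} (h : SmoothOver U T) (hU : IsOpen U)
    (hx : x ∈ U) (hy : y ≠ 0) (v : Coord n) (i : Fin n) :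
    pX (fun x y => T x y i) x y v = pX T x y v i := by
  have := (EuclideanSpace.proj i : Coord n →L[ℝ] ℝ).hasFDerivAt.comp x
    (h.hasFDerivAt_left hU hx hy)
  rw [pX_eq_of_hasFDerivAt (S := fun x y => T x y i) hU hx this fun _ _ => rfl]
  rfl

theorem pY_component {T : Coord n → Coord n → Coord n} (h : SmoothOver U T) (hU : IsOpen U)
    (hx : x ∈ U) (hy : y ≠ 0) (v : Coord n) (i : Fin n) :
    pY (fun x y => T x y i) x y v = pY T x y v i := by
  have := (EuclideanSpace.proj i : Coord n →L[ℝ] ℝ).hasFDerivAt.comp y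
    (h.hasFDerivAt_right hU hx hy)
  rw [pY_eq_of_hasFDerivAt (S := fun x y => T x y i) hy this fun _ _ => rfl]
  rfl

/-- The energy `F² / 2`. -/
noncomputable def energy (L : Coord n → Coord n → ℝ) (x y : Coord n) : ℝ := L x y ^ 2 / 2

/-- The spray with coefficients `spray L i`. -/
noncomputable def sprayVec (L : Coord n → Coord n → ℝ) (x y : Coord n) : Coord n :=
  WithLp.toLp 2 fun i => spray L i x y

/-- The Cartan torsion with coefficients `cartan L k i j`. -/
noncomputable def cartanMap (L : Coord n → Coord n → ℝ) (x y : Coord n) :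
    Coord n →L[ℝ] Coord n →L[ℝ] Coord n :=
  bilinOfBasis fun i j => WithLp.toLp 2 fun k => cartan L k i j x y

/-- The horizontal part of the connection with coefficients `horizCoeff L k i j`. -/
noncomputable def horizMap (L : Coord n → Coord n → ℝ) (x y : Coord n) :
    Coord n →L[ℝ] Coord n →L[ℝ] Coord n :=
  bilinOfBasis fun i j => WithLp.toLp 2 fun k => horizCoeff L k i j x y

/-- The gradient with coefficients `gradUp L w i`. -/
noncomputable def gradVec (L : Coord n → Coord n → ℝ) (w : Coord n → ℝ) (x y : Coord n) :
    Coord n :=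
  WithLp.toLp 2 fun i => gradUp L w i x y

variable {L : Coord n → Coord n → ℝ}

/-- The properties of the local expression of a Finsler metric. -/
structure IsLocalExpr (U : Set (Coord n)) (L : Coord n → Coord n → ℝ) : Prop where
  isOpen : IsOpen U
  smooth : SmoothOver U L
  homog : ∀ x ∈ U, ∀ y ≠ 0, ∀ a : ℝ, 0 < a → L x (a • y) = a * L x y
  pos : ∀ x ∈ U, ∀ y ≠ 0, 0 < L x y
  posDef : ∀ x ∈ U, ∀ y ≠ 0, ∀ v ≠ 0, 0 < fund (energy L) x y v v

namespace IsLocalExpr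

variable (hL : IsLocalExpr U L)
include hL

theorem smooth_energy : SmoothOver U (energy L) := by
  have := hL.smooth.mul (hL.smooth.mul (smoothOver_const (2⁻¹ : ℝ)))
  exact this.congr fun a _ b _ => by rw [energy]; ring

section
variable (hx : x ∈ U) (hy : y ≠ 0)
include hx hy

theorem metric_eq (i j : Fin n) :
    metric L i j x y = fund (energy L) x y (basisVec i) (basisVec j) :=
  pY_apply (hL.smooth_energy.pY hL.isOpen) hL.isOpen hx hy (basisVec i) (basisVec j)

theorem fund_eq_sum (v z : Coord n) : fund (energy L) x y v z
    = ∑ i, ∑ j, metric L i j x y * v i * z j := by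
  rw [map_eq_sum₂]
  refine Finset.sum_congr rfl fun i _ => Finset.sum_congr rfl fun j _ => ?_
  rw [hL.metric_eq hx hy, smul_eq_mul]
  ring

theorem det_ne_zero : (Matrix.of fun a b => metric L a b x y).det ≠ 0 := by
  intro h0
  obtain ⟨v, hv, hv0⟩ := Matrix.exists_mulVec_eq_zero_iff.2 h0
  have hv' : (WithLp.toLp 2 v : Coord n) ≠ 0 := by simpa using hv
  have h1 := hL.posDef x hx y hy _ hv'
  rw [hL.fund_eq_sum hx hy] at h1
  have h2 : ∀ i, ∑ j, metric L i j x y * v j = 0 := fun i => by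
    have := congrFun hv0 i
    simpa [Matrix.mulVec, dotProduct] using this
  have h3 : ∑ i, ∑ j, metric L i j x y * v i * v j = 0 := by
    refine Finset.sum_eq_zero fun i _ => ?_
    rw [← mul_zero (v i), ← h2 i, Finset.mul_sum]
    exact Finset.sum_congr rfl fun j _ => by ring
  exact h1.ne' h3

/-- Raising the index of a covector. -/
theorem fund_raise (α : Fin n → ℝ) (m : Fin n) :
    fund (energy L) x y (WithLp.toLp 2 fun k => ∑ l, metricInv L k l x y * α l) (basisVec m)
      = α m := by
  have h1 : (Matrix.of fun a b => metric L a b x y)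
      * (Matrix.of fun a b => metric L a b x y)⁻¹ = 1 :=
    Matrix.mul_nonsing_inv _ (isUnit_iff_ne_zero.2 (hL.det_ne_zero hx hy))
  have h2 : ∀ l, ∑ k, metric L m k x y * metricInv L k l x y = if m = l then 1 else 0 := by
    intro l
    have := congrFun (congrFun h1 m) l
    simpa [Matrix.mul_apply, Matrix.one_apply, metricInv] using this
  rw [hL.smooth_energy.fund_comm hL.isOpen hx hy, map_eq_sum]
  calc ∑ k, (∑ l, metricInv L k l x y * α l) • fund (energy L) x y (basisVec m) (basisVec k)
      = ∑ k, ∑ l, metric L m k x y * metricInv L k l x y * α l := by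
        refine Finset.sum_congr rfl fun k _ => ?_
        rw [← hL.metric_eq hx hy, smul_eq_mul, Finset.sum_mul]
        exact Finset.sum_congr rfl fun l _ => by ring
    _ = ∑ l, (∑ k, metric L m k x y * metricInv L k l x y) * α l := by
        rw [Finset.sum_comm]
        exact Finset.sum_congr rfl fun l _ => by rw [Finset.sum_mul]
    _ = α m := by simp [h2]

end

theorem smooth_metric (i j : Fin n) : SmoothOver U (metric L i j) :=
  (((hL.smooth_energy.pY hL.isOpen).pY hL.isOpen).clm_apply (smoothOver_const (basisVec i))
    |>.clm_apply (smoothOver_const (basisVec j))).congr fun _ hx _ hy => hL.metric_eq hx hy i j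

omit hL in
theorem smooth_det {A : Fin n → Fin n → Coord n → Coord n → ℝ}
    (hA : ∀ i j, SmoothOver U (A i j)) :
    SmoothOver U (fun x y => (Matrix.of fun a b => A a b x y).det) := by
  have : SmoothOver U (fun x y => ∑ σ : Equiv.Perm (Fin n), (σ.sign : ℤ) •
      ∏ i, A (σ i) i x y) :=
    SmoothOver.sum fun σ _ => ContDiffOn.const_smul _ (contDiffOn_prod fun i _ => hA (σ i) i)
  refine this.congr fun a _ b _ => ?_
  rw [Matrix.det_apply]
  rfl

/-- Cramer's rule: the entries are quotients of determinants in the entries of g, and the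
denominator is nonzero by positive definiteness. -/
theorem smooth_metricInv (i j : Fin n) : SmoothOver U (metricInv L i j) := by
  have hd : SmoothOver U (fun x y => (Matrix.of fun a b => metric L a b x y).det⁻¹) :=
    ContDiffOn.inv (smooth_det hL.smooth_metric) fun p hp => hL.det_ne_zero hp.1 hp.2
  have ha : SmoothOver U (fun x y => (Matrix.of fun a b => metric L a b x y).adjugate i j) := by
    have h1 : ∀ a b, SmoothOver U (fun x y =>
        if a = j then (Pi.single i (1 : ℝ) : Fin n → ℝ) b else metric L a b x y) := by
      intro a b
      by_cases hab : a = j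
      · simpa [hab] using smoothOver_const _
      · simpa [hab] using hL.smooth_metric a b
    refine (smooth_det h1).congr fun a _ b _ => ?_
    rw [Matrix.adjugate_apply]
    congr 1
    ext p q
    simp [Matrix.updateRow_apply]
  refine (hd.mul ha).congr fun a _ b _ => ?_
  rw [metricInv, Matrix.inv_def, Ring.inverse_eq_inv']
  rfl

theorem dX_sq (hx : x ∈ U) (hy : y ≠ 0) (k : Fin n) :
    dX k (fun a b => L a b ^ 2) x y = 2 * pX (energy L) x y (basisVec k) := by
  have h1 := (hL.smooth_energy.hasFDerivAt_left hL.isOpen hx hy).const_smul (2 : ℝ)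
  have h2 : pX (fun a b => L a b ^ 2) x y = (2 : ℝ) • pX (energy L) x y :=
    pX_eq_of_hasFDerivAt hL.isOpen hx h1 fun z _ => by simp [energy]; ring
  change pX (fun a b => L a b ^ 2) x y _ = _
  rw [h2]
  simp

theorem dY_dX_sq (hx : x ∈ U) (hy : y ≠ 0) (l k : Fin n) :
    dY l (dX k fun a b => L a b ^ 2) x y
      = 2 * pX (pY (energy L)) x y (basisVec k) (basisVec l) := by
  have hp := hL.smooth_energy.pX hL.isOpen
  have h1 := ((hp.clm_apply (smoothOver_const (basisVec k))).hasFDerivAt_right hL.isOpen hx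
    hy).const_smul (2 : ℝ)
  change pY (dX k fun a b => L a b ^ 2) x y _ = _
  rw [pY_eq_of_hasFDerivAt hy h1 fun z hz => by simpa using hL.dX_sq hx hz k, smul_apply,
    pY_apply hp hL.isOpen hx hy, hL.smooth_energy.pY_pX_comm hL.isOpen hx hy, smul_eq_mul]

theorem spray_eq_sum (hx : x ∈ U) (hy : y ≠ 0) (i : Fin n) : spray L i x y
    = ∑ l, metricInv L i l x y * ((pX (pY (energy L)) x y y (basisVec l)
      - pX (energy L) x y (basisVec l)) / 2) := by
  rw [spray, Finset.sum_div]
  refine Finset.sum_congr rfl fun l _ => ?_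
  have h1 : ∑ k, dY l (dX k fun a b => L a b ^ 2) x y * y k
      = 2 * pX (pY (energy L)) x y y (basisVec l) := by
    rw [map_eq_sum (pX (pY (energy L)) x y) y, sum_apply, Finset.mul_sum]
    refine Finset.sum_congr rfl fun k _ => ?_
    rw [hL.dY_dX_sq hx hy, smul_apply, smul_eq_mul]
    ring
  rw [h1, hL.dX_sq hx hy]
  ring

theorem smooth_sprayVec : SmoothOver U (sprayVec L) := by
  refine SmoothOver.of_components fun i => ?_
  have hE := hL.smooth_energy
  refine (SmoothOver.sum (s := Finset.univ) fun l _ => (hL.smooth_metricInv i l).mul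
    ((((((hE.pY hL.isOpen).pX hL.isOpen).clm_apply smoothOver_snd).clm_apply
      (smoothOver_const (basisVec l))).sub ((hE.pX hL.isOpen).clm_apply
        (smoothOver_const (basisVec l)))).mul (smoothOver_const (2⁻¹ : ℝ)))).congr
          fun x hx y hy => ?_
  exact hL.spray_eq_sum hx hy i

theorem cartanLower_eq (hx : x ∈ U) (hy : y ≠ 0) (i j k : Fin n) : cartanLower L i j k x y
    = tors (energy L) x y (basisVec k) (basisVec i) (basisVec j) / 2 := by
  have hf : SmoothOver U (fund (energy L)) := (hL.smooth_energy.pY hL.isOpen).pY hL.isOpen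
  rw [cartanLower]
  change pY (metric L i j) x y _ / 2 = _
  rw [pY_congr (T := fun x y => fund (energy L) x y (basisVec i) (basisVec j)) hy
    fun z hz => hL.metric_eq hx hz i j,
    pY_apply (hf.clm_apply (smoothOver_const (basisVec i))) hL.isOpen hx hy,
    pY_apply hf hL.isOpen hx hy]

omit hL in
theorem smooth_bilinOfBasis {T : Fin n → Fin n → Coord n → Coord n → W}
    (hT : ∀ i j, SmoothOver U (T i j)) :
    SmoothOver U (fun x y => bilinOfBasis fun i j => T i j x y) := by
  refine SmoothOver.sum fun i _ => SmoothOver.sum fun j _ => ?_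
  exact ContDiffOn.smulRight contDiffOn_const (ContDiffOn.smulRight contDiffOn_const (hT i j))

theorem smooth_cartanMap : SmoothOver U (cartanMap L) := by
  refine smooth_bilinOfBasis fun i j => SmoothOver.of_components fun k => ?_
  have hf : SmoothOver U (tors (energy L)) :=
    ((hL.smooth_energy.pY hL.isOpen).pY hL.isOpen).pY hL.isOpen
  refine (SmoothOver.sum (s := Finset.univ) fun l _ => (hL.smooth_metricInv k l).mul
    ((((hf.clm_apply (smoothOver_const (basisVec j))).clm_apply
      (smoothOver_const (basisVec l))).clm_apply (smoothOver_const (basisVec i))).mul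
        (smoothOver_const (2⁻¹ : ℝ)))).congr fun x hx y hy => ?_
  change cartan L k i j x y = _
  exact Finset.sum_congr rfl fun l _ => by rw [hL.cartanLower_eq hx hy]; ring

omit hL in
theorem clm_ext_basis {f g : Coord n →L[ℝ] W} (h : ∀ i, f (basisVec i) = g (basisVec i)) :
    f = g := by
  ext v
  rw [map_eq_sum f, map_eq_sum g]
  simp [h]

/-- The local theory applies to the local expression of a Finsler metric. -/
theorem isLocalFinsler : IsLocalFinsler U (energy L) (sprayVec L) (cartanMap L) where
  isOpen := hL.isOpen
  smooth := hL.smooth_energy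
  smooth_spray := hL.smooth_sprayVec
  smooth_cartan := hL.smooth_cartanMap
  homog := fun x hx y hy a ha => by
    rw [energy, energy, hL.homog x hx y hy a ha]; ring
  pos := fun x hx y hy => by
    have := hL.pos x hx y hy
    rw [energy]
    positivity
  posDef := hL.posDef
  spray_eq := fun x hx y hy => by
    have : (2 : ℝ) • fund (energy L) x y (sprayVec L x y)
        = pX (pY (energy L)) x y y - pX (energy L) x y := by
      refine clm_ext_basis fun m => ?_
      have h1 : sprayVec L x y = WithLp.toLp 2 fun k => ∑ l, metricInv L k l x y
          * ((pX (pY (energy L)) x y y (basisVec l) - pX (energy L) x y (basisVec l)) / 2) := by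
        ext k
        exact hL.spray_eq_sum hx hy k
      rw [smul_apply, h1, hL.fund_raise hx hy, sub_apply, smul_eq_mul]
      ring
    intro v
    have h2 := congrArg (fun f => f v) this
    simpa using h2
  cartan_eq := fun x hx y hy u v z => by
    have h1 : ∀ i j k, 2 * fund (energy L) x y (cartanMap L x y (basisVec i) (basisVec j))
        (basisVec k) = tors (energy L) x y (basisVec i) (basisVec j) (basisVec k) := by
      intro i j k
      rw [cartanMap, bilinOfBasis_basisVec]
      have h2 := hL.fund_raise hx hy (fun l => cartanLower L l i j x y) k
      simp only [cartan]
      rw [h2, hL.cartanLower_eq hx hy, hL.smooth_energy.tors_comm' hL.isOpen hx hy,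
        hL.smooth_energy.tors_comm hL.isOpen hx hy]
      ring
    have h2 : ∀ i j, (2 : ℝ) • fund (energy L) x y (cartanMap L x y (basisVec i) (basisVec j))
        = tors (energy L) x y (basisVec i) (basisVec j) := fun i j =>
      clm_ext_basis fun k => by simpa using h1 i j k
    have h3 := map_eq_sum₂ (cartanMap L x y) u v
    have h4 := map_eq_sum₂ (tors (energy L) x y) u v
    rw [h3, h4]
    simp only [map_sum, map_smul, sum_apply, smul_apply, ← h2,
      Finset.mul_sum, smul_eq_mul]
    exact Finset.sum_congr rfl fun i _ => Finset.sum_congr rfl fun j _ => by ring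

section
variable (hx : x ∈ U) (hy : y ≠ 0)
include hx hy

theorem nonlinearConn_eq (i j : Fin n) :
    nonlinearConn L i j x y = pY (sprayVec L) x y (basisVec j) i :=
  pY_component hL.smooth_sprayVec hL.isOpen hx hy (basisVec j) i

theorem sum_nonlinearConn (v : Coord n) (i : Fin n) :
    ∑ r, nonlinearConn L i r x y * v r = pY (sprayVec L) x y v i := by
  rw [map_eq_sum (pY (sprayVec L) x y) v, WithLp.ofLp_sum, Finset.sum_apply]
  exact Finset.sum_congr rfl fun r _ => by
    rw [hL.nonlinearConn_eq hx hy, WithLp.ofLp_smul, Pi.smul_apply, smul_eq_mul, mul_comm]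

theorem deltaX_metric (i j l : Fin n) : deltaX L i (metric L j l) x y
    = horizFund (energy L) (sprayVec L) x y (basisVec i) (basisVec j) (basisVec l) := by
  have hf : SmoothOver U (fund (energy L)) := (hL.smooth_energy.pY hL.isOpen).pY hL.isOpen
  have hfj := hf.clm_apply (smoothOver_const (basisVec j))
  have h1 : dX i (metric L j l) x y
      = pX (fund (energy L)) x y (basisVec i) (basisVec j) (basisVec l) := by
    change pX (metric L j l) x y _ = _
    rw [pX_congr (T := fun x y => fund (energy L) x y (basisVec j) (basisVec l)) hL.isOpen hx
      fun z hz => hL.metric_eq hz hy j l, pX_apply hfj hL.isOpen hx hy,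
      pX_apply hf hL.isOpen hx hy]
  have h2 : ∀ r, dY r (metric L j l) x y
      = tors (energy L) x y (basisVec r) (basisVec j) (basisVec l) := fun r => by
    change pY (metric L j l) x y _ = _
    rw [pY_congr (T := fun x y => fund (energy L) x y (basisVec j) (basisVec l)) hy
      fun z hz => hL.metric_eq hx hz j l, pY_apply hfj hL.isOpen hx hy,
      pY_apply hf hL.isOpen hx hy]
  rw [deltaX, horizFund, h1, map_eq_sum (tors (energy L) x y), sum_apply,
    sum_apply]
  congr 1
  refine Finset.sum_congr rfl fun r _ => ?_
  rw [h2, hL.nonlinearConn_eq hx hy]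
  rfl

/-- The index formula gives the relation on basis vectors, and it extends because every term is
trilinear; two of the sums only need their indices permuted. -/
theorem isHorizConn :
    IsHorizConn (energy L) (sprayVec L) x y (fun v z => horizMap L x y v z) := by
  have h1 : ∀ i j k, 2 * fund (energy L) x y (horizMap L x y (basisVec i) (basisVec j))
      (basisVec k) = horizFund (energy L) (sprayVec L) x y (basisVec i) (basisVec j) (basisVec k)
        + horizFund (energy L) (sprayVec L) x y (basisVec j) (basisVec i) (basisVec k)
        - horizFund (energy L) (sprayVec L) x y (basisVec k) (basisVec i) (basisVec j) := by
    intro i j k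
    rw [horizMap, bilinOfBasis_basisVec]
    have h2 := hL.fund_raise hx hy (fun l => (deltaX L i (metric L j l) x y
      + deltaX L j (metric L i l) x y - deltaX L l (metric L i j) x y) / 2) k
    have h3 : ∀ k, horizCoeff L k i j x y = ∑ l, metricInv L k l x y
        * ((deltaX L i (metric L j l) x y
      + deltaX L j (metric L i l) x y - deltaX L l (metric L i j) x y) / 2) := fun k => by
      rw [horizCoeff, Finset.sum_div]
      exact Finset.sum_congr rfl fun l _ => by ring
    simp only [h3]
    rw [h2]
    simp only [hL.deltaX_metric hx hy]
    ring
  intro v z u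
  have T : ∀ a b c, horizFund (energy L) (sprayVec L) x y a b c
      = ∑ i, ∑ j, ∑ k, a i * b j * c k
        * horizFund (energy L) (sprayVec L) x y (basisVec i) (basisVec j) (basisVec k) := by
    intro a b c
    have e : ∀ a b c, horizFund (energy L) (sprayVec L) x y a b c
        = (pX (fund (energy L)) x y - (tors (energy L) x y).comp (pY (sprayVec L) x y)) a b c :=
      fun a b c => rfl
    simp only [e]
    exact map_eq_sum₃ _ a b c
  have hl : 2 * fund (energy L) x y (horizMap L x y v z) u = ∑ i, ∑ j, ∑ k, v i * z j * u k
      * (2 * fund (energy L) x y (horizMap L x y (basisVec i) (basisVec j)) (basisVec k)) := by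
    rw [map_eq_sum₂ (horizMap L x y), map_sum, sum_apply, Finset.mul_sum]
    refine Finset.sum_congr rfl fun i _ => ?_
    rw [map_sum, sum_apply, Finset.mul_sum]
    refine Finset.sum_congr rfl fun j _ => ?_
    rw [map_smul, smul_apply, map_eq_sum _ u, smul_eq_mul, Finset.mul_sum, Finset.mul_sum]
    exact Finset.sum_congr rfl fun k _ => by rw [smul_eq_mul]; ring
  rw [hl, T v z u, T z v u, T u v z]
  have r2 : ∑ i, ∑ j, ∑ k, z i * v j * u k
        * horizFund (energy L) (sprayVec L) x y (basisVec i) (basisVec j) (basisVec k)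
      = ∑ i, ∑ j, ∑ k, v i * z j * u k
        * horizFund (energy L) (sprayVec L) x y (basisVec j) (basisVec i) (basisVec k) := by
    rw [Finset.sum_comm]
    exact Finset.sum_congr rfl fun i _ => Finset.sum_congr rfl fun j _ =>
      Finset.sum_congr rfl fun k _ => by ring
  have r3 : ∑ i, ∑ j, ∑ k, u i * v j * z k
        * horizFund (energy L) (sprayVec L) x y (basisVec i) (basisVec j) (basisVec k)
      = ∑ i, ∑ j, ∑ k, v i * z j * u k
        * horizFund (energy L) (sprayVec L) x y (basisVec k) (basisVec i) (basisVec j) := by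
    rw [Finset.sum_comm]
    refine Finset.sum_congr rfl fun i _ => ?_
    rw [Finset.sum_comm]
    exact Finset.sum_congr rfl fun j _ => Finset.sum_congr rfl fun k _ => by ring
  rw [r2, r3, ← Finset.sum_add_distrib, ← Finset.sum_sub_distrib]
  refine Finset.sum_congr rfl fun i _ => ?_
  rw [← Finset.sum_add_distrib, ← Finset.sum_sub_distrib]
  refine Finset.sum_congr rfl fun j _ => ?_
  rw [← Finset.sum_add_distrib, ← Finset.sum_sub_distrib]
  exact Finset.sum_congr rfl fun k _ => by rw [h1]; ring

end

end IsLocalExpr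

end Coordinates

/-! ### Index formulas for the curvature, the circle equation and the Hessian. -/

section Coordinates

variable {n : ℕ} {U : Set (Coord n)} {x y : Coord n} {L : Coord n → Coord n → ℝ}
  {w lam : Coord n → ℝ}

theorem bilinOfBasis_toLp_apply (T : Fin n → Fin n → Fin n → ℝ) (v z : Coord n) (k : Fin n) :
    bilinOfBasis (fun i j => (WithLp.toLp 2 fun k => T k i j : Coord n)) v z k
      = ∑ i, ∑ j, v i * z j * T k i j := by
  rw [bilinOfBasis_apply]
  simp [WithLp.ofLp_sum, Finset.sum_apply]

theorem sum_grad (f : Coord n → ℝ) (x v : Coord n) : ∑ r, v r * grad f r x = fderiv ℝ f x v := by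
  rw [map_eq_sum]
  rfl

/-- Two bilinear forms that agree on basis vectors are equal. -/
theorem bilin_ext_basis {f g : Coord n →L[ℝ] Coord n →L[ℝ] ℝ}
    (h : ∀ i j, f (basisVec i) (basisVec j) = g (basisVec i) (basisVec j)) : f = g := by
  ext v z
  rw [map_eq_sum₂ f, map_eq_sum₂ g]
  simp only [h]

namespace IsLocalExpr

section
variable (hL : IsLocalExpr U L) (hx : x ∈ U) (hy : y ≠ 0)
include hL hx hy

theorem lowerY_eq (k : Fin n) : lowerY L k x y = pY (energy L) x y (basisVec k) := by
  rw [← hL.isLocalFinsler.fund_self_right hx hy, map_eq_sum _ y, lowerY]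
  exact Finset.sum_congr rfl fun r _ => by rw [hL.metric_eq hx hy, smul_eq_mul, mul_comm]

theorem horizMap_self (v : Coord n) : horizMap L x y v y = pY (sprayVec L) x y v :=
  (hL.isHorizConn hx hy).apply_self hL.isLocalFinsler hx hy v

/-- The component formula for the curvature. -/
theorem riemann_eq (i k : Fin n) : riemann L i k x y = curv (sprayVec L) x y (basisVec k) i := by
  have hG := hL.smooth_sprayVec
  have hN := hG.pY hL.isOpen
  have h1 : dX k (spray L i) x y = pX (sprayVec L) x y (basisVec k) i :=
    pX_component hG hL.isOpen hx hy _ i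
  have hNk : ∀ j, SmoothOver U (fun x y => pY (sprayVec L) x y (basisVec j)) := fun j =>
    hN.clm_apply (smoothOver_const (basisVec j))
  have h2 : ∀ j, dX j (nonlinearConn L i k) x y
      = pX (pY (sprayVec L)) x y (basisVec j) (basisVec k) i := fun j => by
    change pX (nonlinearConn L i k) x y _ = _
    rw [pX_congr (T := fun x y => pY (sprayVec L) x y (basisVec k) i) hL.isOpen hx
      fun z hz => hL.nonlinearConn_eq hz hy i k, pX_component (hNk k) hL.isOpen hx hy,
      pX_apply hN hL.isOpen hx hy]
  have h3 : ∀ j, dY k (nonlinearConn L i j) x y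
      = pY (pY (sprayVec L)) x y (basisVec k) (basisVec j) i := fun j => by
    change pY (nonlinearConn L i j) x y _ = _
    rw [pY_congr (T := fun x y => pY (sprayVec L) x y (basisVec j) i) hy
      fun z hz => hL.nonlinearConn_eq hx hz i j, pY_component (hNk j) hL.isOpen hx hy,
      pY_apply hN hL.isOpen hx hy]
  have h4 : ∑ j, y j * dX j (nonlinearConn L i k) x y
      = pX (pY (sprayVec L)) x y y (basisVec k) i := by
    rw [map_eq_sum (pX (pY (sprayVec L)) x y) y, sum_apply, WithLp.ofLp_sum, Finset.sum_apply]
    exact Finset.sum_congr rfl fun j _ => by rw [h2]; rfl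
  have h5 : ∑ j, spray L j x y * dY k (nonlinearConn L i j) x y
      = pY (pY (sprayVec L)) x y (basisVec k) (sprayVec L x y) i := by
    rw [map_eq_sum _ (sprayVec L x y), WithLp.ofLp_sum, Finset.sum_apply]
    exact Finset.sum_congr rfl fun j _ => by rw [h3]; rfl
  have h6 : ∑ j, nonlinearConn L i j x y * nonlinearConn L j k x y
      = pY (sprayVec L) x y (pY (sprayVec L) x y (basisVec k)) i := by
    rw [← hL.sum_nonlinearConn hx hy]
    exact Finset.sum_congr rfl fun j _ => by rw [hL.nonlinearConn_eq hx hy j k]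
  rw [riemann, h1, h4, h5, h6]
  simp [curv]

theorem sum_sum_metric (v : Coord n) :
    ∑ i, ∑ j, metric L i j x y * v i * v j = fund (energy L) x y v v :=
  (hL.fund_eq_sum hx hy v v).symm

end

/-- The component formula for the covariant derivative along a curve. -/
theorem covDerivAlong_eq (hL : IsLocalExpr U L) {c X : ℝ → Coord n} {t : ℝ} (hx : c t ∈ U)
    (hy : deriv c t ≠ 0) :
    covDerivAlong L c X t = covAlong (sprayVec L) (cartanMap L) c X t := by
  -- By Euler's relation N(ċ) = 2G, so the vertical part of the lifted curve is the covariant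
  -- acceleration.
  have hv : ∀ r, verticalPart L c t r = accel (sprayVec L) c t r := fun r => by
    rw [verticalPart, hL.sum_nonlinearConn hx hy, hL.isLocalFinsler.conn_self hx hy]
    rfl
  ext k
  have h1 : horizMap L (c t) (deriv c t) (X t) (deriv c t) k
      = ∑ i, ∑ j, X t i * deriv c t j * horizCoeff L k i j (c t) (deriv c t) :=
    bilinOfBasis_toLp_apply _ _ _ _
  have h2 : cartanMap L (c t) (deriv c t) (X t) (accel (sprayVec L) c t) k
      = ∑ i, ∑ j, X t i * accel (sprayVec L) c t j * cartan L k i j (c t) (deriv c t) :=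
    bilinOfBasis_toLp_apply _ _ _ _
  rw [hL.horizMap_self hx hy] at h1
  simp only [covDerivAlong, covAlong, WithLp.ofLp_add, Pi.add_apply, h1, h2, hv, add_assoc,
    ← Finset.sum_add_distrib]
  congr 1
  refine Finset.sum_congr rfl fun i _ => ?_
  rw [Finset.mul_sum]
  exact Finset.sum_congr rfl fun j _ => by ring

/-- The component formula for the equation of geodesic circles. -/
theorem circleField_eq (hL : IsLocalExpr U L) {c : ℝ → Coord n} {I : Set ℝ} {s : ℝ}
    (hc : IsRegularCurve U c I) (hs : s ∈ I) :
    covDerivAlong L c (covDerivAlong L c (deriv c)) s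
      + (∑ i, ∑ j, metric L i j (c s) (deriv c s) * covDerivAlong L c (deriv c) s i
        * covDerivAlong L c (deriv c) s j) • deriv c s
      = circleField (energy L) (sprayVec L) (cartanMap L) c s := by
  have h1 : ∀ r ∈ I, covDerivAlong L c (deriv c) r = accel (sprayVec L) c r := fun r hr => by
    rw [hL.covDerivAlong_eq (hc.mem r hr) (hc.deriv_ne r hr),
      covAlong_deriv hL.isLocalFinsler hc hr]
  have h2 : covDerivAlong L c (deriv c) =ᶠ[𝓝 s] accel (sprayVec L) c :=
    Filter.eventually_of_mem (hc.isOpen.mem_nhds hs) h1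
  rw [hL.sum_sum_metric (hc.mem s hs) (hc.deriv_ne s hs),
    hL.covDerivAlong_eq (hc.mem s hs) (hc.deriv_ne s hs), covAlong, h2.deriv_eq, h1 s hs]
  rfl

section
variable (hL : IsLocalExpr U L) (hw : ContDiffOn ℝ ∞ w U) (hw0 : ∀ x ∈ U, 0 < w x)
include hL hw hw0

theorem isGradient : IsGradient U (energy L) w (gradVec L w) where
  smooth_fun := hw
  pos_fun := hw0
  smooth := SmoothOver.of_components fun i => SmoothOver.sum (s := Finset.univ) fun r _ =>
    (hL.smooth_metricInv i r).mul (smoothOver_of_left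
      ((hw.fderiv_of_isOpen hL.isOpen (by simp)).clm_apply contDiffOn_const))
  eq := fun x hx y hy v => by
    have h1 : fund (energy L) x y (gradVec L w x y) = fderiv ℝ w x :=
      clm_ext_basis fun m => hL.fund_raise hx hy (fun r => grad w r x) m
    rw [h1]

theorem hessian_eq (hx : x ∈ U) (i j : Fin n) : hessian L w i j x y
    = fderiv ℝ (fderiv ℝ w) x (basisVec i) (basisVec j)
      - fderiv ℝ w x (horizMap L x y (basisVec i) (basisVec j)) := by
  have hB := hL.isGradient hw hw0
  have h1 : grad (grad w i) j x = fderiv ℝ (fderiv ℝ w) x (basisVec j) (basisVec i) := by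
    have := (hB.hasFDerivAt_fderiv hL.isOpen hx).clm_apply
      (hasFDerivAt_const (basisVec i : Coord n) x)
    rw [grad, show grad w i = fun z => fderiv ℝ w z (basisVec i) from rfl, this.fderiv]
    simp
  rw [hessian, h1, hB.fderiv_fderiv_comm hL.isOpen hx, horizMap, bilinOfBasis_basisVec,
    ← sum_grad]

/-- From left to right the Hessian is merely contracted with y, and C(·, B) = 0 becomes independence
of the direction. The converse needs `hess_eq` to recover the uncontracted equation. -/
theorem concircular_iff :
    (∀ x ∈ U, ∀ y ≠ 0, (∀ i j, hessian L w i j x y = lam x * metric L i j x y) ∧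
      ∀ i k, ∑ r, gradUp L w r x y * cartan L k r i x y = 0) ↔
    IsConcircularGradient U (sprayVec L) (gradVec L w) lam := by
  have hB := hL.isGradient hw hw0
  have h := hL.isLocalFinsler
  have hC : ∀ x y i k, cartanMap L x y (gradVec L w x y) (basisVec i) k
      = ∑ r, gradUp L w r x y * cartan L k r i x y := fun x y i k => by
    refine (bilinOfBasis_toLp_apply (fun k i j => cartan L k i j x y) _ _ k).trans ?_
    refine Finset.sum_congr rfl fun r _ => ?_
    rw [Finset.sum_eq_single i]
    · simp [gradVec]
    · intro b _ hb; simp [hb]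
    · simp
  constructor
  · intro H
    have hC0 : ∀ x ∈ U, ∀ y ≠ 0, ∀ v, cartanMap L x y v (gradVec L w x y) = 0 := by
      intro x hx y hy v
      rw [h.cartan_comm hx hy]
      have : cartanMap L x y (gradVec L w x y) = 0 := clm_ext_basis fun i => by
        ext k
        rw [hC, (H x hx y hy).2 i k]
        simp
      rw [this, zero_apply]
    refine ⟨fun x hx y hy => ?_, fun x hx y hy => ?_⟩
    · ext1 v
      rw [hB.pY_eq h hx hy, hC0 x hx y hy, smul_zero, zero_apply]
    · have h1 : fderiv ℝ (fderiv ℝ w) x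
          - (ContinuousLinearMap.compL ℝ (Coord n) (Coord n) ℝ (fderiv ℝ w x)).comp (horizMap L x y)
          = lam x • fund (energy L) x y := bilin_ext_basis fun i j => by
        have := (H x hx y hy).1 i j
        rw [hL.hessian_eq hw hw0 hx, hL.metric_eq hx hy] at this
        simpa using this
      refine h.eq_of_fund hx hy fun v => ?_
      have h2 := congrArg (fun f => f v y) h1
      simp only [sub_apply, smul_apply, ContinuousLinearMap.comp_apply,
        ContinuousLinearMap.compL_apply, smul_eq_mul] at h2
      rw [hess_apply_self h hx hy hB (hL.isHorizConn hx hy), hC0 x hx y hy, smul_zero,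
        add_zero] at h2
      rw [h2, map_smul, smul_apply, h.fund_comm hx hy, smul_eq_mul]
  · intro hc x hx y hy
    refine ⟨fun i j => ?_, fun i k => ?_⟩
    · rw [hL.hessian_eq hw hw0 hx, hL.metric_eq hx hy]
      exact hess_eq h hx hy hB hc (hL.isHorizConn hx hy) _ _
    · rw [← hC, h.cartan_comm hx hy, cartan_grad_eq_zero hB h hc hx hy]
      simp

omit hL hw hw0 in
/-- The component formula for `u_m u^m`. -/
theorem sum_grad_gradUp (x y : Coord n) :
    ∑ m, grad w m x * gradUp L w m x y = fderiv ℝ w x (gradVec L w x y) := by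
  rw [← sum_grad]
  exact Finset.sum_congr rfl fun m _ => mul_comm _ _

/-- The change of the Riemann curvature under a concircular change, in components. -/
theorem riemann_concircular {L' : Coord n → Coord n → ℝ} (hL' : IsLocalExpr U L')
    (conf : ∀ x ∈ U, ∀ y ≠ 0, L' x y = (w x)⁻¹ * L x y)
    (hc : IsConcircularGradient U (sprayVec L) (gradVec L w) lam) (hx : x ∈ U) (hy : y ≠ 0)
    (i k : Fin n) : riemann L' i k x y = riemann L i k x y
      + ((2 * lam x * w x - fderiv ℝ w x (gradVec L w x y)) * (w x)⁻¹ ^ 2)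
        * (L x y ^ 2 * (if i = k then 1 else 0) - y i * lowerY L k x y) := by
  have hconf : ∀ x ∈ U, ∀ y ≠ 0, energy L' x y = (w x ^ 2)⁻¹ * energy L x y :=
    fun x hx y hy => by rw [energy, energy, conf x hx y hy]; ring
  rw [hL'.riemann_eq hx hy, hL.riemann_eq hx hy, curv_concircular (hL.isGradient hw hw0)
    hL.isLocalFinsler hc hx hy hL'.isLocalFinsler hconf, hL.lowerY_eq hx hy]
  simp only [energy, WithLp.ofLp_add, WithLp.ofLp_sub, WithLp.ofLp_smul, Pi.add_apply,
    Pi.sub_apply, Pi.smul_apply, smul_eq_mul, basisVec, PiLp.single_apply]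
  split_ifs <;> ring

end

/-- The scale factor of the flag curvature tensor. -/
theorem trace_flag (hL : IsLocalExpr U L) (hx : x ∈ U) (hy : y ≠ 0) :
    ∑ m, (L x y ^ 2 * (if m = m then 1 else 0) - y m * lowerY L m x y)
      = ((n : ℝ) - 1) * L x y ^ 2 := by
  have h1 : ∑ m, y m * lowerY L m x y = L x y ^ 2 := by
    have h2 := hL.isLocalFinsler.pY_self hx hy
    rw [map_eq_sum _ y] at h2
    rw [show L x y ^ 2 = 2 * energy L x y by rw [energy]; ring, ← h2]
    exact Finset.sum_congr rfl fun m _ => by rw [hL.lowerY_eq hx hy, smul_eq_mul]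
  rw [Finset.sum_sub_distrib, h1]
  simp
  ring

end IsLocalExpr

end Coordinates

/-! ### Charts -/

section Charts

variable {n : ℕ} {M : Type*} [TopologicalSpace M] [ChartedSpace (EuclideanSpace ℝ (Fin n)) M]

/-- All fibres are copies of the coordinate space, so vectors over different names of the same point
can be compared without transport. -/
theorem mk_tangent_congr {p q : M} {v v' : Coord n} (h : p = q) (h' : v = v') :
    (⟨p, v⟩ : TangentBundle (𝓡 n) M) = ⟨q, v'⟩ := by
  subst h h'
  rfl

variable {e e' : OpenPartialHomeomorph M (Coord n)} {F : TangentBundle (𝓡 n) M → ℝ}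
  {x y : Coord n} {γ : ℝ → M} {s : ℝ}

section
variable (he : e ∈ charts n M)
include he

theorem mdifferentiable_chart : e.MDifferentiable (𝓡 n) (𝓡 n) :=
  ⟨(contMDiffOn_of_mem_maximalAtlas he).mdifferentiableOn (by simp),
    (contMDiffOn_symm_of_mem_maximalAtlas he).mdifferentiableOn (by simp)⟩

theorem bijective_mfderiv_symm (hx : x ∈ e.target) :
    Function.Bijective (mfderiv (𝓡 n) (𝓡 n) e.symm x) :=
  (mdifferentiable_chart he).symm.mfderiv_bijective hx

/-- The velocity of a curve is given by the derivative of its coordinates. -/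
theorem tangentVec_velocity (hγ : MDifferentiableAt 𝓘(ℝ, ℝ) (𝓡 n) γ s) (hs : γ s ∈ e.source) :
    tangentVec e (e (γ s)) (deriv (fun t => e (γ t)) s) = velocity (n := n) γ s := by
  have hc : MDifferentiableAt 𝓘(ℝ, ℝ) (𝓡 n) (fun t => e (γ t)) s :=
    ((mdifferentiable_chart he).mdifferentiableAt hs).comp s hγ
  have h1 : γ =ᶠ[𝓝 s] fun t => e.symm (e (γ t)) :=
    (hγ.continuousAt.eventually_mem (e.open_source.mem_nhds hs)).mono
      fun t ht => (e.left_inv ht).symm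
  have h2 : mfderiv 𝓘(ℝ, ℝ) (𝓡 n) (fun t => e.symm (e (γ t))) s
      = (mfderiv (𝓡 n) (𝓡 n) e.symm (e (γ s))).comp
        (mfderiv 𝓘(ℝ, ℝ) (𝓡 n) (fun t => e (γ t)) s) :=
    mfderiv_comp s ((mdifferentiable_chart he).mdifferentiableAt_symm (e.map_source hs)) hc
  refine mk_tangent_congr (e.left_inv hs) ?_
  rw [h1.mfderiv_eq, h2, mfderiv_eq_fderiv]
  rfl

/-- The transition map between two charts. -/
theorem isTransition [IsManifold (𝓡 n) ∞ M] (he' : e' ∈ charts n M) :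
    IsTransition (e'.target ∩ e'.symm ⁻¹' e.source) e.target (fun x => e (e'.symm x)) where
  isOpen := e'.isOpen_inter_preimage_symm e.open_source
  smooth := by
    have h1 := (contMDiffOn_of_mem_maximalAtlas he).comp
      ((contMDiffOn_symm_of_mem_maximalAtlas he').mono (Set.inter_subset_left
        (t := e'.symm ⁻¹' e.source))) fun x hx => hx.2
    exact contMDiffOn_iff_contDiffOn.1 h1
  mapsTo := fun x hx => e.map_source hx.2
  bijective := fun x hx => by
    have h1 : mfderiv (𝓡 n) (𝓡 n) (fun x => e (e'.symm x)) x
        = (mfderiv (𝓡 n) (𝓡 n) e (e'.symm x)).comp (mfderiv (𝓡 n) (𝓡 n) e'.symm x) :=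
      mfderiv_comp x ((mdifferentiable_chart he).mdifferentiableAt hx.2)
        ((mdifferentiable_chart he').mdifferentiableAt_symm hx.1)
    rw [mfderiv_eq_fderiv] at h1
    rw [h1]
    exact ((mdifferentiable_chart he).mfderiv_bijective hx.2).comp
      (bijective_mfderiv_symm he' hx.1)

/-- The change of coordinates of tangent vectors. -/
theorem tangentVec_transition (he' : e' ∈ charts n M)
    (hx : x ∈ e'.target ∩ e'.symm ⁻¹' e.source) (y : Coord n) :
    tangentVec e' x y
      = tangentVec e (e (e'.symm x)) (fderiv ℝ (fun x => e (e'.symm x)) x y) := by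
  have hd := (mdifferentiable_chart he').mdifferentiableAt_symm hx.1
  have hc : MDifferentiableAt (𝓡 n) (𝓡 n) (fun t => e (e'.symm t)) x :=
    ((mdifferentiable_chart he).mdifferentiableAt hx.2).comp x hd
  have h1 : e'.symm =ᶠ[𝓝 x] fun t => e.symm (e (e'.symm t)) :=
    (hd.continuousAt.eventually_mem (e.open_source.mem_nhds hx.2)).mono
      fun t ht => (e.left_inv ht).symm
  have h2 : mfderiv (𝓡 n) (𝓡 n) (fun t => e.symm (e (e'.symm t))) x
      = (mfderiv (𝓡 n) (𝓡 n) e.symm (e (e'.symm x))).comp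
        (mfderiv (𝓡 n) (𝓡 n) (fun t => e (e'.symm t)) x) :=
    mfderiv_comp x ((mdifferentiable_chart he).mdifferentiableAt_symm (e.map_source hx.2)) hc
  refine mk_tangent_congr (e.left_inv hx.2).symm ?_
  rw [h1.mfderiv_eq, h2, mfderiv_eq_fderiv]
  rfl

end

end Charts

/-! ### Metrics and functions on the manifold read in a chart. -/

section LocalExpr

variable {n : ℕ} {M : Type*} [TopologicalSpace M] [ChartedSpace (EuclideanSpace ℝ (Fin n)) M]
  [IsManifold (𝓡 n) ∞ M]
  {e e' : OpenPartialHomeomorph M (Coord n)} {F F₁ : TangentBundle (𝓡 n) M → ℝ} {u : M → ℝ}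
  {x y : Coord n}

omit [IsManifold (𝓡 n) ∞ M] in
theorem localExpr_transition (he : e ∈ charts n M) (he' : e' ∈ charts n M)
    (hx : x ∈ e'.target ∩ e'.symm ⁻¹' e.source) (y : Coord n) :
    localExpr e' F x y
      = localExpr e F (e (e'.symm x)) (fderiv ℝ (fun x => e (e'.symm x)) x y) := by
  rw [localExpr, tangentVec_transition he he' hx y]
  rfl

/-- The tangent bundle of the model space is trivial in its own coordinates, so smoothness is read
off from the pair. -/
theorem contMDiff_mk_tangent : ContMDiff 𝓘(ℝ, Coord n × Coord n) (𝓡 n).tangent ∞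
    (fun p : Coord n × Coord n => (⟨p.1, p.2⟩ : TangentBundle (𝓡 n) (Coord n))) := by
  intro p
  rw [Bundle.contMDiffAt_totalSpace]
  refine ⟨contDiff_fst.contMDiff p, ?_⟩
  refine (contDiff_snd.contMDiff p).congr_of_eventuallyEq (.of_forall fun q => ?_)
  exact congrArg Prod.snd (trivializationAt_model_space_apply
    (I := 𝓡 n) (⟨q.1, q.2⟩ : TangentBundle (𝓡 n) (Coord n)) p.1)

theorem contMDiffOn_tangentVec (he : e ∈ charts n M) :
    ContMDiffOn 𝓘(ℝ, Coord n × Coord n) (𝓡 n).tangent ∞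
      (fun p : Coord n × Coord n => tangentVec e p.1 p.2) (e.target ×ˢ Set.univ) := by
  have h1 := (contMDiffOn_symm_of_mem_maximalAtlas he).contMDiffOn_tangentMapWithin (m := ∞)
    (by simp) e.open_target.uniqueMDiffOn
  refine (h1.comp contMDiff_mk_tangent.contMDiffOn (s := e.target ×ˢ Set.univ)
    fun p hp => hp.1).congr fun p hp => mk_tangent_congr rfl ?_
  simp only
  rw [mfderivWithin_of_isOpen e.open_target hp.1]

omit [IsManifold (𝓡 n) ∞ M] in
theorem energy_eq_along (x y v : Coord n) (t : ℝ) :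
    energy (localExpr e F) x (y + t • v) = F ⟨e.symm x, mfderiv (𝓡 n) (𝓡 n) e.symm x y
      + t • mfderiv (𝓡 n) (𝓡 n) e.symm x v⟩ ^ 2 / 2 := by
  have h1 : mfderiv (𝓡 n) (𝓡 n) e.symm x (y + t • v : Coord n)
      = mfderiv (𝓡 n) (𝓡 n) e.symm x y + t • mfderiv (𝓡 n) (𝓡 n) e.symm x v :=
    ((mfderiv (𝓡 n) (𝓡 n) e.symm x).map_add _ _).trans
      (congrArg _ ((mfderiv (𝓡 n) (𝓡 n) e.symm x).map_smul t v))
  rw [energy, localExpr, tangentVec, h1]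

/-- This links the chart-free convexity condition to g. Only small t matters, where y + tv stays
nonzero. -/
theorem fund_eq_iteratedDeriv {U : Set (Coord n)} {E : Coord n → Coord n → ℝ} (hU : IsOpen U)
    (hE : SmoothOver U E) (hx : x ∈ U) (hy : y ≠ 0) (v : Coord n) :
    iteratedDeriv 2 (fun t : ℝ => E x (y + t • v)) 0 = fund E x y v v := by
  rw [iteratedDeriv_succ, iteratedDeriv_one]
  have hl : ∀ t : ℝ, HasDerivAt (fun t : ℝ => y + t • v) v t := fun t => by
    simpa using ((hasDerivAt_id t).smul_const v).const_add y
  have hne : ∀ᶠ t : ℝ in 𝓝 0, y + t • v ≠ 0 :=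
    (hl 0).continuousAt.eventually_ne (by simpa using hy)
  have h3 : deriv (fun t : ℝ => E x (y + t • v)) =ᶠ[𝓝 0] fun t => pY E x (y + t • v) v :=
    hne.mono fun t ht => ((hE.hasFDerivAt_right hU hx ht).comp_hasDerivAt t (hl t)).deriv
  rw [h3.deriv_eq]
  have h4 := ((hE.pY hU).hasFDerivAt_right hU hx hy).comp_hasDerivAt_of_eq (0 : ℝ) (hl 0)
    (by simp)
  exact ((h4.clm_apply (hasDerivAt_const (0 : ℝ) v)).congr_deriv (by simp [fund])).deriv

theorem isLocalExpr (hF : IsFinslerMetric F) (he : e ∈ charts n M) :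
    IsLocalExpr e.target (localExpr e F) := by
  have h0 : ∀ x ∈ e.target, ∀ y : Coord n, y ≠ 0 → mfderiv (𝓡 n) (𝓡 n) e.symm x y ≠ 0 :=
    fun x hx y hy h => hy ((bijective_mfderiv_symm he hx).1
      (h.trans (mfderiv (𝓡 n) (𝓡 n) e.symm x).map_zero.symm))
  have hs : SmoothOver e.target (localExpr e F) :=
    contMDiffOn_iff_contDiffOn.1 (hF.smooth.comp
      ((contMDiffOn_tangentVec he).mono (Set.prod_mono_right (Set.subset_univ _)))
        fun p hp => h0 p.1 hp.1 p.2 hp.2)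
  have hE : SmoothOver e.target (energy (localExpr e F)) :=
    (hs.mul (hs.mul (smoothOver_const (2⁻¹ : ℝ)))).congr fun a _ b _ => by rw [energy]; ring
  refine ⟨e.open_target, hs, fun x hx y hy a ha => ?_, fun x hx y hy => hF.pos _ _ (h0 x hx y hy),
    fun x hx y hy v hv => ?_⟩
  · have h1 : mfderiv (𝓡 n) (𝓡 n) e.symm x (a • y : Coord n)
        = a • mfderiv (𝓡 n) (𝓡 n) e.symm x y := (mfderiv (𝓡 n) (𝓡 n) e.symm x).map_smul a y
    rw [localExpr, tangentVec, h1]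
    exact hF.homogeneous _ _ a ha
  · rw [← fund_eq_iteratedDeriv e.open_target hE hx hy]
    simp only [energy_eq_along]
    exact hF.strongly_convex (e.symm x) _ _ (h0 x hx y hy) (h0 x hx v hv)

omit [IsManifold (𝓡 n) ∞ M] in
theorem contDiffOn_localFun (hu : ContMDiff (𝓡 n) 𝓘(ℝ, ℝ) ∞ u) (he : e ∈ charts n M) :
    ContDiffOn ℝ ∞ (fun z => u (e.symm z)) e.target :=
  contMDiffOn_iff_contDiffOn.1
    (hu.comp_contMDiffOn (contMDiffOn_symm_of_mem_maximalAtlas he))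

theorem IsLocalExpr.mono {U U' : Set (Coord n)} {L : Coord n → Coord n → ℝ}
    (hL : IsLocalExpr U L) (hU' : IsOpen U') (h : U' ⊆ U) : IsLocalExpr U' L where
  isOpen := hU'
  smooth := ContDiffOn.mono hL.smooth (Set.prod_mono_left h)
  homog := fun x hx => hL.homog x (h hx)
  pos := fun x hx => hL.pos x (h hx)
  posDef := fun x hx => hL.posDef x (h hx)

end LocalExpr

/-! ### Curves on the manifold -/

section ManifoldCurves

variable {n : ℕ} {M : Type*} [TopologicalSpace M] [ChartedSpace (EuclideanSpace ℝ (Fin n)) M]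
  [IsManifold (𝓡 n) ∞ M]
  {e e' : OpenPartialHomeomorph M (Coord n)} {F F₁ : TangentBundle (𝓡 n) M → ℝ} {u lam : M → ℝ}
  {γ : ℝ → M} {I J : Set ℝ} {s t : ℝ} {φ : ℝ → ℝ}

/-- A smooth curve parametrized by arc length. -/
structure IsUnitSpeed (F : TangentBundle (𝓡 n) M → ℝ) (γ : ℝ → M) (I : Set ℝ) : Prop where
  isOpen : IsOpen I
  smooth : ContMDiffOn 𝓘(ℝ, ℝ) (𝓡 n) ∞ γ I
  unit_speed : ∀ s ∈ I, F (velocity (n := n) γ s) = 1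

/-- The left hand side of the equation of geodesic circles in the chart `e`. -/
noncomputable def chartField (F : TangentBundle (𝓡 n) M → ℝ)
    (e : OpenPartialHomeomorph M (Coord n)) (γ : ℝ → M) (s : ℝ) : Coord n :=
  circleField (energy (localExpr e F)) (sprayVec (localExpr e F)) (cartanMap (localExpr e F))
    (fun t => e (γ t)) s

omit [IsManifold (𝓡 n) ∞ M] in
theorem IsGeodesicCircle.isUnitSpeed (h : IsGeodesicCircle F γ I) : IsUnitSpeed F γ I :=
  ⟨h.isOpen, h.smooth, h.unit_speed⟩

omit [IsManifold (𝓡 n) ∞ M] in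
theorem velocity_comp (hγ : MDifferentiableAt 𝓘(ℝ, ℝ) (𝓡 n) γ (φ t)) {a : ℝ}
    (hφ : HasDerivAt φ a t) : velocity (n := n) (fun t => γ (φ t)) t
      = ⟨γ (φ t), a • mfderiv 𝓘(ℝ, ℝ) (𝓡 n) γ (φ t) (1 : ℝ)⟩ := by
  have h1 : mfderiv 𝓘(ℝ, ℝ) (𝓡 n) (fun t => γ (φ t)) t
      = (mfderiv 𝓘(ℝ, ℝ) (𝓡 n) γ (φ t)).comp (mfderiv 𝓘(ℝ, ℝ) 𝓘(ℝ, ℝ) φ t) :=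
    mfderiv_comp t hγ hφ.hasFDerivAt.hasMFDerivAt.mdifferentiableAt
  refine mk_tangent_congr rfl ?_
  rw [h1, mfderiv_eq_fderiv, hφ.hasFDerivAt.fderiv]
  refine Eq.trans (b := mfderiv 𝓘(ℝ, ℝ) (𝓡 n) γ (φ t) (a • (1 : ℝ))) ?_
    ((mfderiv 𝓘(ℝ, ℝ) (𝓡 n) γ (φ t)).map_smul a (1 : ℝ))
  exact congrArg (mfderiv 𝓘(ℝ, ℝ) (𝓡 n) γ (φ t)) (mul_comm (1 : ℝ) a)

namespace IsUnitSpeed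

variable (h : IsUnitSpeed F γ I)
include h

omit [IsManifold (𝓡 n) ∞ M] in
theorem mdifferentiableAt (hs : s ∈ I) : MDifferentiableAt 𝓘(ℝ, ℝ) (𝓡 n) γ s :=
  (h.smooth.contMDiffAt (h.isOpen.mem_nhds hs)).mdifferentiableAt (by simp)

variable (hF : IsFinslerMetric F) (he : e ∈ charts n M)

include he in
omit [IsManifold (𝓡 n) ∞ M] in
theorem localExpr_eq_one (hs : s ∈ I ∩ γ ⁻¹' e.source) :
    localExpr e F (e (γ s)) (deriv (fun t => e (γ t)) s) = 1 := by
  rw [localExpr, tangentVec_velocity he (h.mdifferentiableAt hs.1) hs.2, h.unit_speed s hs.1]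

include he in
omit [IsManifold (𝓡 n) ∞ M] in
theorem two_mul_energy (hs : s ∈ I ∩ γ ⁻¹' e.source) :
    2 * energy (localExpr e F) (e (γ s)) (deriv (fun t => e (γ t)) s) = 1 := by
  rw [energy, h.localExpr_eq_one he hs]
  norm_num

include hF he in
theorem isRegularCurve :
    IsRegularCurve e.target (fun t => e (γ t)) (I ∩ γ ⁻¹' e.source) where
  isOpen := h.smooth.continuousOn.isOpen_inter_preimage h.isOpen e.open_source
  smooth := contMDiffOn_iff_contDiffOn.1 ((contMDiffOn_of_mem_maximalAtlas he).comp
    (h.smooth.mono Set.inter_subset_left) fun s hs => hs.2)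
  mem := fun s hs => e.map_source hs.2
  -- F vanishes on zero vectors, which is incompatible with unit speed.
  deriv_ne := fun s hs h0 => by
    have h1 := h.localExpr_eq_one he hs
    have h2 : mfderiv (𝓡 n) (𝓡 n) e.symm (e (γ s)) (0 : Coord n) = 0 :=
      (mfderiv (𝓡 n) (𝓡 n) e.symm (e (γ s))).map_zero
    rw [h0, localExpr, tangentVec, h2, hF.map_zero] at h1
    exact zero_ne_one h1

include hF in
/-- The equation of geodesic circles in one chart implies the equation in any other chart. -/
theorem chartField_eq_zero (he : e ∈ charts n M) (he' : e' ∈ charts n M) (hs : s ∈ I)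
    (hse : γ s ∈ e.source) (hse' : γ s ∈ e'.source) (h0 : chartField F e' γ s = 0) :
    chartField F e γ s = 0 := by
  have hψ := isTransition (e' := e') he he'
  have hr := h.isRegularCurve hF he'
  have hr' : IsRegularCurve (e'.target ∩ e'.symm ⁻¹' e.source) (fun t => e' (γ t))
      ((I ∩ γ ⁻¹' e'.source) ∩ (I ∩ γ ⁻¹' e.source)) :=
    ⟨hr.isOpen.inter (h.isRegularCurve hF he).isOpen, hr.smooth.mono Set.inter_subset_left,
      fun r hr => ⟨e'.map_source hr.1.2, by
        rw [Set.mem_preimage, e'.left_inv hr.1.2]; exact hr.2.2⟩,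
      fun r hs => hr.deriv_ne r hs.1⟩
  have h1 := circleField_transition hψ (isLocalExpr hF he).isLocalFinsler
    ((isLocalExpr hF he').mono hψ.isOpen Set.inter_subset_left).isLocalFinsler
    (fun x hx y hy => by rw [energy, energy, localExpr_transition he he' hx])
    hr' (c := fun t => e (γ t)) (fun r hr => by
      rw [e'.left_inv hr.1.2]) (s := s) ⟨⟨hs, hse'⟩, hs, hse⟩
  rw [chartField, h1]
  rw [chartField] at h0
  rw [h0, map_zero]

include hF in
theorem isGeodesicCircle (hI : IsConnected I)
    (H : ∀ s ∈ I, ∃ e ∈ charts n M, γ s ∈ e.source ∧ chartField F e γ s = 0) :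
    IsGeodesicCircle F γ I where
  isOpen := h.isOpen
  isConnected := hI
  smooth := h.smooth
  unit_speed := h.unit_speed
  equation := fun e he s hs hse => by
    obtain ⟨e', he', hse', h0⟩ := H s hs
    have h1 := h.chartField_eq_zero hF he he' hs hse hse' h0
    rw [chartField, ← (isLocalExpr hF he).circleField_eq (h.isRegularCurve hF he) ⟨hs, hse⟩] at h1
    exact h1

end IsUnitSpeed

theorem IsGeodesicCircle.chartField_eq_zero (h : IsGeodesicCircle F γ I) (hF : IsFinslerMetric F)
    (he : e ∈ charts n M) (hs : s ∈ I) (hse : γ s ∈ e.source) : chartField F e γ s = 0 := by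
  rw [chartField, ← (isLocalExpr hF he).circleField_eq (h.isUnitSpeed.isRegularCurve hF he)
    ⟨hs, hse⟩]
  exact h.equation e he s hs hse

section Conformal

variable (hF : IsFinslerMetric F) (hF₁ : IsFinslerMetric F₁)
  (hu : ContMDiff (𝓡 n) 𝓘(ℝ, ℝ) ∞ u) (hu_pos : ∀ p, 0 < u p)
  (hconf : ∀ v : TangentBundle (𝓡 n) M, F₁ v = (u v.proj)⁻¹ * F v)
include hconf

omit [IsManifold (𝓡 n) ∞ M] in
theorem localExpr_conformal (x y : Coord n) :
    localExpr e F₁ x y = (u (e.symm x))⁻¹ * localExpr e F x y :=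
  hconf _

omit [IsManifold (𝓡 n) ∞ M] in
theorem energy_conformal (x y : Coord n) :
    energy (localExpr e F₁) x y = (u (e.symm x) ^ 2)⁻¹ * energy (localExpr e F) x y := by
  rw [energy, energy, localExpr_conformal hconf]
  ring

-- By homogeneity the F₁-length of the new velocity is a / u. Hence the F₁-arc length parameter is
-- forced to satisfy φ' = u(γ∘φ).
include hu_pos in
theorem unit_speed_comp_iff (h : IsUnitSpeed F γ I) (hF : IsFinslerMetric F)
    (ht : φ t ∈ I) {a : ℝ} (ha : 0 < a) (hφ : HasDerivAt φ a t) :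
    F₁ (velocity (n := n) (fun t => γ (φ t)) t) = 1 ↔ a = u (γ (φ t)) := by
  have h1 := h.unit_speed _ ht
  rw [velocity_comp (h.mdifferentiableAt ht) hφ, hconf, hF.homogeneous _ _ _ ha]
  change (u (γ (φ t)))⁻¹ * (a * F (velocity (n := n) γ (φ t))) = 1 ↔ _
  rw [h1, mul_one, inv_mul_eq_one₀ (hu_pos _).ne', eq_comm]

include hF hF₁ hu hu_pos in
theorem chartField_conformal (h : IsUnitSpeed F γ I) (he : e ∈ charts n M) (ht : φ t ∈ I)
    (hte : γ (φ t) ∈ e.source) (hφ : ∀ᶠ r in 𝓝 t, HasDerivAt φ (u (γ (φ r))) r) :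
    chartField F₁ e (fun t => γ (φ t)) t = u (γ (φ t)) ^ 3 • chartField F e γ (φ t)
      + u (γ (φ t)) ^ 2 • (covAlong (sprayVec (localExpr e F)) (cartanMap (localExpr e F))
          (fun s => e (γ s)) (fun s => gradVec (localExpr e F) (fun z => u (e.symm z)) (e (γ s))
            (deriv (fun s => e (γ s)) s)) (φ t)
        - fund (energy (localExpr e F)) (e (γ (φ t))) (deriv (fun s => e (γ s)) (φ t))
          (covAlong (sprayVec (localExpr e F)) (cartanMap (localExpr e F))
            (fun s => e (γ s)) (fun s => gradVec (localExpr e F) (fun z => u (e.symm z)) (e (γ s))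
              (deriv (fun s => e (γ s)) s)) (φ t))
          (deriv (fun s => e (γ s)) (φ t)) • deriv (fun s => e (γ s)) (φ t)) := by
  have hL := isLocalExpr hF he
  have hc := h.isRegularCurve hF he
  have h1 := circleField_conformal hL.isLocalFinsler hc
    (hL.isGradient (contDiffOn_localFun hu he) fun x _ => hu_pos _)
    (isLocalExpr hF₁ he).isLocalFinsler (fun x _ y _ => energy_conformal hconf x y)
    (fun s hs => h.two_mul_energy he hs) (c' := fun t => e (γ (φ t))) (φ := φ) (t := t) ⟨ht, hte⟩
    (.of_forall fun r => rfl) (by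
      have h2 := hφ.self_of_nhds.continuousAt.eventually_mem (hc.isOpen.mem_nhds ⟨ht, hte⟩)
      filter_upwards [hφ, h2] with r h3 h4
      rwa [e.left_inv h4.2])
  rw [e.left_inv hte] at h1
  exact h1

end Conformal

end ManifoldCurves

/-! ### The change of the parameter -/

/-- The differential equation `φ' = v(φ)` has a solution with range `I`, for `v` smooth and positive
on the open interval `I`. -/
theorem exists_reparametrization {I : Set ℝ} (hI : IsOpen I) (hc : IsConnected I) {v : ℝ → ℝ}
    (hv : ContDiffOn ℝ ∞ v I) (hv0 : ∀ s ∈ I, 0 < v s) :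
    ∃ (φ : ℝ → ℝ) (J : Set ℝ), IsOpen J ∧ IsConnected J ∧ ContDiffOn ℝ ∞ φ J ∧
      (∀ t ∈ J, HasDerivAt φ (v (φ t)) t) ∧ φ '' J = I := by
  obtain ⟨s₀, hs₀⟩ := hc.nonempty
  have hoc : I.OrdConnected := hc.isPreconnected.ordConnected
  have hvi : ContDiffOn ℝ ∞ (fun s => (v s)⁻¹) I := hv.inv fun s hs => (hv0 s hs).ne'
  -- Separation of variables: φ is the inverse of τ, whose derivative is 1/v.
  set τ : ℝ → ℝ := fun s => ∫ r in s₀..s, (v r)⁻¹ with hτ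
  have hd : ∀ s ∈ I, HasDerivAt τ (v s)⁻¹ s := fun s hs => by
    refine intervalIntegral.integral_hasDerivAt_right
      (ContinuousOn.intervalIntegrable (hvi.continuousOn.mono (hoc.uIcc_subset hs₀ hs)))
      (hvi.continuousOn.stronglyMeasurableAtFilter hI s hs)
      (hvi.continuousOn.continuousAt (hI.mem_nhds hs))
  have hτs : ContDiffOn ℝ ∞ τ I := by
    refine (contDiffOn_infty_iff_deriv_of_isOpen hI).2
      ⟨fun s hs => (hd s hs).differentiableAt.differentiableWithinAt, ?_⟩
    exact hvi.congr fun s hs => (hd s hs).deriv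
  have hmono : StrictMonoOn τ I := by
    refine strictMonoOn_of_deriv_pos (hoc.convex) hτs.continuousOn fun s hs => ?_
    have hs := interior_subset hs
    rw [(hd s hs).deriv]
    exact inv_pos.2 (hv0 s hs)
  -- The inverse function theorem at each point; with injectivity it makes τ a homeomorphism from I
  -- onto the open set τ(I).
  have hopen : IsOpenMap (I.domRestrict τ) := by
    refine isOpenMap_iff_nhds_le.2 fun s => ?_
    have h1 : HasStrictDerivAt τ (v s)⁻¹ s := by
      have := (hτs.contDiffAt (hI.mem_nhds s.2)).hasStrictDerivAt (by simp)
      rwa [(hd s s.2).deriv] at this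
    have h2 := h1.map_nhds_eq (inv_pos.2 (hv0 s s.2)).ne'
    rw [Set.domRestrict_eq, ← Filter.map_map, map_nhds_subtype_val, hI.nhdsWithin_eq s.2, h2]
    rfl
  let P : OpenPartialHomeomorph ℝ ℝ := OpenPartialHomeomorph.ofContinuousOpenRestrict
    (hmono.injOn.toPartialEquiv τ I) hτs.continuousOn hopen hI
  have hP : ∀ t ∈ τ '' I, P.symm t ∈ I := fun t ht => P.map_target ht
  have hPd : ∀ t ∈ τ '' I, HasDerivAt P.symm (v (P.symm t)) t := fun t ht => by
    have := P.hasDerivAt_symm (a := t) ht (inv_pos.2 (hv0 _ (hP t ht))).ne' (hd _ (hP t ht))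
    rwa [inv_inv] at this
  refine ⟨P.symm, τ '' I, P.open_target, hc.image τ hτs.continuousOn, fun t ht => ?_, hPd,
    P.symm_image_target_eq_source⟩
  exact (P.contDiffAt_symm_deriv (inv_pos.2 (hv0 _ (hP t ht))).ne' ht (hd _ (hP t ht))
    (hτs.contDiffAt (hI.mem_nhds (hP t ht)))).contDiffWithinAt

/-! ### The circle expression depends only on the germ of the curve. -/

section Congr

variable {V : Type*} [NormedAddCommGroup V] [NormedSpace ℝ V] {E : V → V → ℝ} {G : V → V → V}
  {C : V → V → V →L[ℝ] V →L[ℝ] V} {c c' X X' : ℝ → V} {s : ℝ}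

theorem accel_congr (h : c =ᶠ[𝓝 s] c') : accel G c =ᶠ[𝓝 s] accel G c' := by
  filter_upwards [h, h.deriv, h.deriv.deriv] with r h1 h2 h3
  rw [accel, accel, h1, h2, h3]

theorem covAlong_congr (h : c =ᶠ[𝓝 s] c') (hX : X =ᶠ[𝓝 s] X') :
    covAlong G C c X s = covAlong G C c' X' s := by
  rw [covAlong, covAlong, h.eq_of_nhds, h.deriv.eq_of_nhds, hX.eq_of_nhds, hX.deriv.eq_of_nhds,
    (accel_congr h).eq_of_nhds]

theorem circleField_congr (h : c =ᶠ[𝓝 s] c') :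
    circleField E G C c s = circleField E G C c' s := by
  rw [circleField, circleField, covAlong_congr h (accel_congr h), h.eq_of_nhds, h.deriv.eq_of_nhds,
    (accel_congr h).eq_of_nhds]

end Congr

theorem IsConcircularGradient.mono {V : Type*} [NormedAddCommGroup V] [NormedSpace ℝ V]
    {U U' : Set V} {G B : V → V → V} {lam : V → ℝ} (hc : IsConcircularGradient U G B lam)
    (h : U' ⊆ U) : IsConcircularGradient U' G B lam :=
  ⟨fun x hx => hc.pY_eq_zero x (h hx), fun x hx => hc.cov_eq x (h hx)⟩

theorem covAlong_grad_concircular {V : Type*} [NormedAddCommGroup V] [NormedSpace ℝ V] {U : Set V}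
    {E : V → V → ℝ} {G : V → V → V} {C : V → V → V →L[ℝ] V →L[ℝ] V} {c : ℝ → V} {I : Set ℝ}
    {s : ℝ} {w lam : V → ℝ} {B : V → V → V} (h : IsLocalFinsler U E G C)
    (hc : IsRegularCurve U c I) (hs : s ∈ I) (hB : IsGradient U E w B)
    (hlam : IsConcircularGradient U G B lam) :
    covAlong G C c (fun s => B (c s) (deriv c s)) s = lam (c s) • deriv c s := by
  have hx := hc.mem s hs
  have hy := hc.deriv_ne s hs
  rw [covAlong_grad h hc hs hB, hlam.cov_eq _ hx _ hy, cartan_grad_eq_zero hB h hlam hx hy,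
    cartan_grad_eq_zero hB h hlam hx hy, smul_zero, add_zero, sub_zero]

/-! ### Geodesic circles versus the concircularity equations. -/

section Concircular

variable {n : ℕ} {M : Type*} [TopologicalSpace M] [ChartedSpace (EuclideanSpace ℝ (Fin n)) M]
  [IsManifold (𝓡 n) ∞ M]
  {e e' : OpenPartialHomeomorph M (Coord n)} {F F₁ : TangentBundle (𝓡 n) M → ℝ} {u lam : M → ℝ}
  {γ : ℝ → M} {I J : Set ℝ} {s t : ℝ} {φ : ℝ → ℝ}
  (hF : IsFinslerMetric F) (hu : ContMDiff (𝓡 n) 𝓘(ℝ, ℝ) ∞ u) (hu_pos : ∀ p, 0 < u p)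
include hF hu hu_pos

theorem isGradient_localExpr (he : e ∈ charts n M) :
    IsGradient e.target (energy (localExpr e F)) (fun z => u (e.symm z))
      (gradVec (localExpr e F) fun z => u (e.symm z)) :=
  (isLocalExpr hF he).isGradient (contDiffOn_localFun hu he) fun _ _ => hu_pos _

theorem concircularEquations_iff : ConcircularEquations F u lam ↔
    ∀ e ∈ charts n M, IsConcircularGradient e.target (sprayVec (localExpr e F))
      (gradVec (localExpr e F) fun z => u (e.symm z)) fun z => lam (e.symm z) :=
  forall₂_congr fun _ he => (isLocalExpr hF he).concircular_iff (contDiffOn_localFun hu he)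
    fun _ _ => hu_pos _

theorem ConcircularEquations.circlesAreCircles (hc : ConcircularEquations F u lam)
    (hF₁ : IsFinslerMetric F₁)
    (hconf : ∀ v : TangentBundle (𝓡 n) M, F₁ v = (u v.proj)⁻¹ * F v) :
    CirclesAreCircles F F₁ := by
  intro γ I hγ
  rw [concircularEquations_iff hF hu hu_pos] at hc
  have h := hγ.isUnitSpeed
  have hv : ContDiffOn ℝ ∞ (fun s => u (γ s)) I :=
    contMDiffOn_iff_contDiffOn.1 (hu.comp_contMDiffOn hγ.smooth)
  obtain ⟨φ, J, hJ, hJc, hφ, hφd, hφJ⟩ :=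
    exists_reparametrization hγ.isOpen hγ.isConnected hv fun s _ => hu_pos _
  have hmaps : ∀ t ∈ J, φ t ∈ I := fun t ht => hφJ ▸ Set.mem_image_of_mem φ ht
  have hus : IsUnitSpeed F₁ (fun t => γ (φ t)) J := by
    refine ⟨hJ, hγ.smooth.comp (contMDiffOn_iff_contDiffOn.2 hφ) hmaps, fun t ht => ?_⟩
    rw [unit_speed_comp_iff hu_pos hconf h hF (hmaps t ht) (hu_pos _) (hφd t ht)]
  refine ⟨φ, J, hφ, fun t ht => (hφd t ht).deriv ▸ hu_pos _, hφJ,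
    hus.isGeodesicCircle hF₁ hJc fun t ht => ?_⟩
  have he : chartAt _ (γ (φ t)) ∈ charts n M := IsManifold.chart_mem_maximalAtlas _
  have hte := mem_chart_source (EuclideanSpace ℝ (Fin n)) (γ (φ t))
  refine ⟨_, he, hte, ?_⟩
  have hL := (isLocalExpr hF he).isLocalFinsler
  have hr := h.isRegularCurve hF he
  have hs : φ t ∈ I ∩ γ ⁻¹' (chartAt (EuclideanSpace ℝ (Fin n)) (γ (φ t))).source :=
    ⟨hmaps t ht, hte⟩
  -- Both contributions vanish: the circle expression of F, and the part of D*B = λċ orthogonal to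
  -- ċ.
  rw [chartField_conformal hF hF₁ hu hu_pos hconf h he (hmaps t ht) hte
    (Filter.eventually_of_mem (hJ.mem_nhds ht) hφd), hγ.chartField_eq_zero hF he (hmaps t ht) hte,
    covAlong_grad_concircular hL hr hs (isGradient_localExpr hF hu hu_pos he) (hc _ he),
    map_smul, smul_apply, hL.fund_self (hr.mem _ hs) (hr.deriv_ne _ hs), h.two_mul_energy he hs]
  simp

theorem CirclesAreCircles.exists_local (hn : 2 ≤ n) (H : CirclesAreCircles F F₁)
    (hF₁ : IsFinslerMetric F₁)
    (hconf : ∀ v : TangentBundle (𝓡 n) M, F₁ v = (u v.proj)⁻¹ * F v) (he : e ∈ charts n M) :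
    ∃ lam : Coord n → ℝ, IsConcircularGradient e.target (sprayVec (localExpr e F))
      (gradVec (localExpr e F) fun z => u (e.symm z)) lam := by
  have hL := (isLocalExpr hF he).isLocalFinsler
  have hB := isGradient_localExpr hF hu hu_pos he
  refine exists_isConcircularGradient hB hL ?_ fun x hx y hy hxy A hA => ?_
  · rw [rank_eq_card_basis (EuclideanSpace.basisFun (Fin n) ℝ).toBasis, Fintype.card_fin]
    exact_mod_cast hn
  -- A test circle with the prescribed initial data, carried to M by the inverse chart.
  obtain ⟨ε, hε, c, hc, hc0, hc1, hc2, hcu, hcc⟩ := exists_circle hL hx hy hxy hA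
  have h0 : (0 : ℝ) ∈ Set.Ioo (-ε) ε := ⟨neg_lt_zero.2 hε, hε⟩
  set γ : ℝ → M := fun s => e.symm (c s) with hγ
  have heq : ∀ s ∈ Set.Ioo (-ε) ε, (fun s => e (γ s)) =ᶠ[𝓝 s] c := fun s hs =>
    Filter.eventually_of_mem (isOpen_Ioo.mem_nhds hs) fun r hr => e.right_inv (hc.mem r hr)
  have hγs : ContMDiffOn 𝓘(ℝ, ℝ) (𝓡 n) ∞ γ (Set.Ioo (-ε) ε) :=
    (contMDiffOn_symm_of_mem_maximalAtlas he).comp (contMDiffOn_iff_contDiffOn.2 hc.smooth) hc.mem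
  have hsrc : ∀ s ∈ Set.Ioo (-ε) ε, γ s ∈ e.source := fun s hs => e.map_target (hc.mem s hs)
  have hγu : IsUnitSpeed F γ (Set.Ioo (-ε) ε) := by
    refine ⟨isOpen_Ioo, hγs, fun s hs => ?_⟩
    rw [← tangentVec_velocity he ((hγs.contMDiffAt (isOpen_Ioo.mem_nhds hs)).mdifferentiableAt
      (by simp)) (hsrc s hs), (heq s hs).deriv_eq, (heq s hs).eq_of_nhds]
    have h1 := hcu s hs
    have h2 := (isLocalExpr hF he).pos _ (hc.mem s hs) _ (hc.deriv_ne s hs)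
    rw [energy] at h1
    change localExpr e F _ _ = 1
    nlinarith
  have hcirc : IsGeodesicCircle F γ (Set.Ioo (-ε) ε) :=
    hγu.isGeodesicCircle hF (isConnected_Ioo (by linarith)) fun s hs =>
      ⟨e, he, hsrc s hs, (circleField_congr (heq s hs)).trans (hcc s hs)⟩
  obtain ⟨φ, J, hφ, hφ0, hφJ, hcirc₁⟩ := H γ _ hcirc
  obtain ⟨t, ht, ht0⟩ : (0 : ℝ) ∈ φ '' J := hφJ ▸ h0
  have hmaps : ∀ t ∈ J, φ t ∈ Set.Ioo (-ε) ε := fun t ht => hφJ ▸ Set.mem_image_of_mem φ ht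
  -- The hypothesis only provides some change of parameter; unit speed for F₁ determines its
  -- derivative.
  have hφd : ∀ r ∈ J, HasDerivAt φ (u (γ (φ r))) r := fun r hr => by
    have h1 := hφ.hasDerivAt_of_isOpen hcirc₁.isOpen hr
    rwa [← (unit_speed_comp_iff hu_pos hconf hγu hF (hmaps r hr) (hφ0 r hr) h1).1
      (hcirc₁.unit_speed r hr)]
  have key := chartField_conformal hF hF₁ hu hu_pos hconf hγu he (hmaps t ht)
    (hsrc _ (hmaps t ht)) (Filter.eventually_of_mem (hcirc₁.isOpen.mem_nhds ht) hφd)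
  have h0' : (0 : ℝ) ∈ Set.Ioo (-ε) ε ∩ γ ⁻¹' e.source := ⟨h0, hsrc 0 h0⟩
  -- Both circle expressions are zero, so D*B is tangent to the circle at parameter 0, where it is
  -- evaluated in terms of x, y and A.
  rw [hcirc₁.chartField_eq_zero hF₁ he ht (hsrc _ (hmaps t ht)), ht0,
    hcirc.chartField_eq_zero hF he h0 (hsrc 0 h0), smul_zero, zero_add, eq_comm,
    smul_eq_zero_iff_right (pow_ne_zero 2 (hu_pos _).ne'), sub_eq_zero,
    covAlong_grad hL (hγu.isRegularCurve hF he) h0' hB, (accel_congr (heq 0 h0)).eq_of_nhds,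
    (heq 0 h0).deriv_eq, hc2, hc1] at key
  have hx0 : e (γ 0) = x := (heq 0 h0).eq_of_nhds.trans hc0
  rw [hx0] at key
  exact ⟨_, key⟩

theorem CirclesAreCircles.exists_concircularEquations (hn : 2 ≤ n) (H : CirclesAreCircles F F₁)
    (hF₁ : IsFinslerMetric F₁)
    (hconf : ∀ v : TangentBundle (𝓡 n) M, F₁ v = (u v.proj)⁻¹ * F v) :
    ∃ lam : M → ℝ, ConcircularEquations F u lam := by
  choose! L hL using fun (e : OpenPartialHomeomorph M (Coord n)) (he : e ∈ charts n M) =>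
    H.exists_local hF hu hu_pos hn hF₁ hconf he
  -- λ is read in the preferred chart at each point; `lam_transition` then shows that every other
  -- chart gives the same value.
  refine ⟨fun p => L (chartAt _ p) (chartAt (EuclideanSpace ℝ (Fin n)) p p), ?_⟩
  rw [concircularEquations_iff hF hu hu_pos]
  intro e he
  refine ⟨(hL e he).pY_eq_zero, fun x hx y hy => ?_⟩
  rw [(hL e he).cov_eq x hx y hy]
  congr 1
  have he' : chartAt _ (e.symm x) ∈ charts n M := IsManifold.chart_mem_maximalAtlas _
  have hψ := isTransition (e' := e) he' he
  have hx' : x ∈ e.target ∩ e.symm ⁻¹' (chartAt (EuclideanSpace ℝ (Fin n)) (e.symm x)).source :=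
    ⟨hx, mem_chart_source _ _⟩
  have hU := Set.inter_subset_left (s := e.target)
    (t := e.symm ⁻¹' (chartAt (EuclideanSpace ℝ (Fin n)) (e.symm x)).source)
  have hloc := (isLocalExpr hF he).mono hψ.isOpen hU
  exact lam_transition hψ (isLocalExpr hF he').isLocalFinsler hloc.isLocalFinsler
    (fun x hx y hy => by rw [energy, energy, localExpr_transition he' he hx])
    (isGradient_localExpr hF hu hu_pos he')
    (hloc.isGradient ((contDiffOn_localFun hu he).mono hU) fun _ _ => hu_pos _)
    (fun z hz => by rw [OpenPartialHomeomorph.left_inv _ hz.2]) hx' hy (hL _ he')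
    ((hL e he).mono hU)

end Concircular

/-! ### Independence of the direction, and the case of constant curvature. -/

section LocalConsequences

variable {V : Type*} [NormedAddCommGroup V] [NormedSpace ℝ V] {U : Set V} {E : V → V → ℝ}
  {G : V → V → V} {C : V → V → V →L[ℝ] V →L[ℝ] V} {w lam : V → ℝ} {B B' : V → V → V} {x y y' : V}

theorem IsConcircularGradient.congr_grad (hc : IsConcircularGradient U G B lam) (hU : IsOpen U)
    (hBB' : ∀ x ∈ U, ∀ y ≠ 0, B' x y = B x y) : IsConcircularGradient U G B' lam where
  pY_eq_zero := fun x hx y hy => by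
    rw [pY_congr (T := B) hy fun z hz => hBB' x hx z hz, hc.pY_eq_zero x hx y hy]
  cov_eq := fun x hx y hy => by
    rw [pX_congr (T := B) hU hx fun z hz => hBB' z hz y hy, hBB' x hx y hy, hc.cov_eq x hx y hy]

/-- A concircular gradient does not depend on the direction. -/
theorem IsConcircularGradient.grad_eq (hc : IsConcircularGradient U G B lam)
    (hV : 1 < Module.rank ℝ V) (hU : IsOpen U) (hB : SmoothOver U B) (hx : x ∈ U) (hy : y ≠ 0)
    (hy' : y' ≠ 0) : B x y = B x y' :=
  isOpen_compl_singleton.is_const_of_fderiv_eq_zero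
    (isConnected_compl_singleton_of_one_lt_rank hV 0).isPreconnected
    (fun _ hz => (hB.hasFDerivAt_right hU hx hz).differentiableAt.differentiableWithinAt)
    (hc.pY_eq_zero x hx) hy hy'

/-- For a metric of constant flag curvature `K`, the function `K w² + 2 lam w - |∇w|²` is
constant. -/
theorem hasFDerivAt_curvature_const (hV : 1 < Module.rank ℝ V) (hB : IsGradient U E w B)
    (h : IsLocalFinsler U E G C) (hc : IsConcircularGradient U G B lam) {K : ℝ}
    (hK : ∀ x ∈ U, ∀ y ≠ 0, ∀ v, curv G x y v = K • ((2 * E x y) • v - pY E x y v • y))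
    {N : V → ℝ} (hN : ∀ x ∈ U, ∀ y ≠ 0, fderiv ℝ w x (B x y) = N x) (hx : x ∈ U) :
    HasFDerivAt (fun z => K * w z ^ 2 + 2 * lam z * w z - N z) (0 : V →L[ℝ] ℝ) x := by
  have hne : Nontrivial V := rank_pos_iff_nontrivial.1 (zero_lt_one.trans hV)
  obtain ⟨y₀, hy₀⟩ := exists_ne (0 : V)
  -- Put α = dλ + K dw. The Ricci identity gives 2E α(v) = α(y) dE(v) for every y ≠ 0. In dimension
  -- at least two the kernel of α contains some y ≠ 0, and this y gives α = 0.
  have hα : ∀ v, fderiv ℝ lam x v + K * fderiv ℝ w x v = 0 := by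
    intro v
    obtain ⟨y, hy, hy0⟩ : ∃ y ≠ 0, fderiv ℝ lam x y + K * fderiv ℝ w x y = 0 := by
      by_contra! hcon
      have hinj : Function.Injective (fderiv ℝ lam x + K • fderiv ℝ w x : V →L[ℝ] ℝ) := by
        refine (injective_iff_map_eq_zero _).2 fun z hz => ?_
        by_contra hz0
        exact hcon z hz0 (by simpa using hz)
      have := LinearMap.lift_rank_le_of_injective
        ((fderiv ℝ lam x + K • fderiv ℝ w x : V →L[ℝ] ℝ) : V →ₗ[ℝ] ℝ) hinj
      rw [Module.rank_self, Cardinal.lift_one, Cardinal.lift_le_one_iff] at this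
      exact absurd hV this.not_gt
    have h1 := fderiv_curv hB h hc hx hy v
    rw [hK x hx y hy, map_smul, map_sub, map_smul, map_smul] at h1
    simp only [smul_eq_mul] at h1
    have h2 := h.pos x hx y hy
    have h3 : 2 * E x y * (fderiv ℝ lam x v + K * fderiv ℝ w x v) = 0 := by
      linear_combination -h1 + pY E x y v * hy0
    exact (mul_eq_zero.1 h3).resolve_left (by positivity)
  have hw := hB.hasFDerivAt_fun h.isOpen hx
  have hl := hasFDerivAt_lam hB h hc hx hy₀
  have hN' : HasFDerivAt N ((2 * lam x) • fderiv ℝ w x) x :=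
    (hasFDerivAt_normSq hB h hc hx hy₀).congr_of_eventuallyEq
      (Filter.eventually_of_mem (h.isOpen.mem_nhds hx) fun z hz => (hN z hz y₀ hy₀).symm)
  -- Since d|∇w|² = 2λ dw, the λ dw terms cancel and the differential is 2wα.
  refine ((((hw.pow 2).const_mul K).add ((hl.const_mul 2).mul hw)).sub hN').congr_fderiv ?_
  ext v
  simp only [sub_apply, add_apply, smul_apply, smul_eq_mul, zero_apply]
  simp
  linear_combination 2 * w x * hα v

end LocalConsequences

/-! ### Curvature properties under a concircular change. -/

section Curvature

variable {n : ℕ} {M : Type*} [TopologicalSpace M] [ChartedSpace (EuclideanSpace ℝ (Fin n)) M]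
  [IsManifold (𝓡 n) ∞ M]
  {e e' : OpenPartialHomeomorph M (Coord n)} {F F₁ : TangentBundle (𝓡 n) M → ℝ} {u lam N : M → ℝ}
  {K K₁ : TangentBundle (𝓡 n) M → ℝ} {x y : Coord n}

theorem one_lt_rank_coord (hn : 2 ≤ n) : 1 < Module.rank ℝ (Coord n) := by
  rw [rank_eq_card_basis (EuclideanSpace.basisFun (Fin n) ℝ).toBasis, Fintype.card_fin]
  exact_mod_cast hn

theorem exists_coord_ne_zero (hn : 2 ≤ n) : ∃ y : Coord n, y ≠ 0 :=
  have := rank_pos_iff_nontrivial.1 (zero_lt_one.trans (one_lt_rank_coord hn))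
  exists_ne 0

/-- `N` is the function `u_m u^m`. -/
def IsNormSqGrad (F : TangentBundle (𝓡 n) M → ℝ) (u N : M → ℝ) : Prop :=
  ∀ e ∈ charts n M, ∀ x ∈ e.target, ∀ y : Coord n, y ≠ 0 →
    fderiv ℝ (fun z => u (e.symm z)) x (gradVec (localExpr e F) (fun z => u (e.symm z)) x y)
      = N (e.symm x)

theorem HasFlagCurvature.hasRicciScalar (hF : IsFinslerMetric F) (h : HasFlagCurvature F K) :
    HasRicciScalar F K := by
  intro e he x hx y hy
  rw [ricci, mul_right_comm, ← (isLocalExpr hF he).trace_flag hx hy, mul_comm, Finset.mul_sum]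
  exact Finset.sum_congr rfl fun m _ => h e he x hx y hy m m

/-- Both n − 1 and F are nonzero, so the Ricci scalar is unique on nonzero vectors; a relation
between Ricci scalars need only be checked for one transformed scalar. -/
theorem HasRicciScalar.eq (hn : 2 ≤ n) (hF : IsFinslerMetric F) (h : HasRicciScalar F K)
    (h₁ : HasRicciScalar F K₁) (he : e ∈ charts n M) (hx : x ∈ e.target) (hy : y ≠ 0) :
    K (tangentVec e x y) = K₁ (tangentVec e x y) := by
  have h1 := (h e he x hx y hy).symm.trans (h₁ e he x hx y hy)
  have h2 := (isLocalExpr hF he).pos x hx y hy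
  have h3 : (n : ℝ) - 1 ≠ 0 := by
    have : (2 : ℝ) ≤ n := by exact_mod_cast hn
    linarith
  exact mul_left_cancel₀ h3 (mul_right_cancel₀ (pow_ne_zero 2 h2.ne') h1)

variable (hF : IsFinslerMetric F) (hu : ContMDiff (𝓡 n) 𝓘(ℝ, ℝ) ∞ u) (hu_pos : ∀ p, 0 < u p)
  (hc : ConcircularEquations F u lam)
include hF hu hu_pos hc

/-- B does not depend on the direction, so |∇u|² can be computed with any fixed y₀, and it is
invariant under changes of chart. This keeps a curvature K(x) a function of x. -/
theorem ConcircularEquations.exists_isNormSqGrad (hn : 2 ≤ n) : ∃ N, IsNormSqGrad F u N := by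
  rw [concircularEquations_iff hF hu hu_pos] at hc
  obtain ⟨y₀, hy₀⟩ := exists_coord_ne_zero hn
  refine ⟨fun p => fderiv ℝ (fun z => u ((chartAt (EuclideanSpace ℝ (Fin n)) p).symm z))
    (chartAt (EuclideanSpace ℝ (Fin n)) p p) (gradVec (localExpr (chartAt _ p) F)
      (fun z => u ((chartAt (EuclideanSpace ℝ (Fin n)) p).symm z))
      (chartAt (EuclideanSpace ℝ (Fin n)) p p) y₀), fun e he x hx y hy => ?_⟩
  have he' : chartAt _ (e.symm x) ∈ charts n M := IsManifold.chart_mem_maximalAtlas _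
  have hψ := isTransition (e' := e) he' he
  have hx' : x ∈ e.target ∩ e.symm ⁻¹' (chartAt (EuclideanSpace ℝ (Fin n)) (e.symm x)).source :=
    ⟨hx, mem_chart_source _ _⟩
  have hU := Set.inter_subset_left (s := e.target)
    (t := e.symm ⁻¹' (chartAt (EuclideanSpace ℝ (Fin n)) (e.symm x)).source)
  have hloc := (isLocalExpr hF he).mono hψ.isOpen hU
  have hB := isGradient_localExpr hF hu hu_pos he'
  rw [normSq_transition hψ (isLocalExpr hF he').isLocalFinsler hloc.isLocalFinsler
    (fun x hx y hy => by rw [energy, energy, localExpr_transition he' he hx]) hB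
    (hloc.isGradient ((contDiffOn_localFun hu he).mono hU) fun _ _ => hu_pos _)
    (fun z hz => by rw [OpenPartialHomeomorph.left_inv _ hz.2]) hx' hy,
    (hc _ he').grad_eq (one_lt_rank_coord hn) (OpenPartialHomeomorph.open_target _) hB.smooth
      (hψ.mapsTo x hx') (hψ.ne_zero hx' hy) hy₀]

variable (hN : IsNormSqGrad F u N) (hF₁ : IsFinslerMetric F₁)
  (hconf : ∀ v : TangentBundle (𝓡 n) M, F₁ v = (u v.proj)⁻¹ * F v)
include hN hF₁ hconf

/-- The equations for `F₁ = u⁻¹ F` with the function `u⁻¹`. -/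
theorem ConcircularEquations.inv : ConcircularEquations F₁ (fun p => (u p)⁻¹)
    (fun p => -lam p + N p * (u p)⁻¹) := by
  have hui : ContMDiff (𝓡 n) 𝓘(ℝ, ℝ) ∞ fun p => (u p)⁻¹ := fun p =>
    (contDiffAt_inv ℝ (hu_pos p).ne').contMDiffAt.comp p (hu p)
  rw [concircularEquations_iff hF hu hu_pos] at hc
  rw [concircularEquations_iff hF₁ hui fun p => inv_pos.2 (hu_pos p)]
  intro e he
  have h := (isLocalExpr hF he).isLocalFinsler
  have h₁ := (isLocalExpr hF₁ he).isLocalFinsler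
  have hB := isGradient_localExpr hF hu hu_pos he
  have hE : ∀ x ∈ e.target, ∀ y ≠ 0, energy (localExpr e F₁) x y
      = (u (e.symm x) ^ 2)⁻¹ * energy (localExpr e F) x y :=
    fun x _ y _ => energy_conformal hconf x y
  refine (isConcircularGradient_inv hB h h₁ (hc e he) hE fun x hx y hy => by
    rw [hN e he x hx y hy]).congr_grad e.open_target fun x hx y hy => ?_
  -- The gradient of 1/u formed with the coordinates of F₁ is −B, as both represent the same
  -- covector.
  refine h₁.eq_of_fund hx hy fun z => ?_
  rw [(isGradient_localExpr hF₁ hui (fun p => inv_pos.2 (hu_pos p)) he).eq x hx y hy,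
    (isGradient_inv hB h hE).eq x hx y hy]

theorem riemann_change (he : e ∈ charts n M) (hx : x ∈ e.target) (hy : y ≠ 0) (i k : Fin n) :
    riemann (localExpr e F₁) i k x y = riemann (localExpr e F) i k x y
      + ((2 * lam (e.symm x) * u (e.symm x) - N (e.symm x)) * (u (e.symm x))⁻¹ ^ 2)
        * (localExpr e F x y ^ 2 * (if i = k then 1 else 0) - y i * lowerY (localExpr e F) k x y) := by
  rw [concircularEquations_iff hF hu hu_pos] at hc
  rw [(isLocalExpr hF he).riemann_concircular (contDiffOn_localFun hu he) (fun _ _ => hu_pos _)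
    (isLocalExpr hF₁ he) (fun x _ y _ => localExpr_conformal hconf x y) (hc e he) hx hy,
    hN e he x hx y hy]

/-- The tensor F² id − y ⊗ g(y, ·) of F₁ is u⁻² times that of F, so the factor K + (2λu − N) u⁻²
must be multiplied by u². -/
theorem HasFlagCurvature.change (h : HasFlagCurvature F K) : HasFlagCurvature F₁
    (fun v => K v * u v.proj ^ 2 + 2 * lam v.proj * u v.proj - N v.proj) := by
  intro e he x hx y hy i k
  have hL := isLocalExpr hF he
  have hl : lowerY (localExpr e F₁) k x y
      = (u (e.symm x) ^ 2)⁻¹ * lowerY (localExpr e F) k x y := by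
    rw [(isLocalExpr hF₁ he).lowerY_eq hx hy, hL.lowerY_eq hx hy,
      pY_eq_of_hasFDerivAt hy ((hL.smooth_energy.hasFDerivAt_right hL.isOpen hx hy).const_mul
        (u (e.symm x) ^ 2)⁻¹) fun z _ => energy_conformal hconf x z, smul_apply, smul_eq_mul]
  have hu0 := (hu_pos (e.symm x)).ne'
  rw [riemann_change hF hu hu_pos hc hN hF₁ hconf he hx hy, h e he x hx y hy, hl,
    localExpr_conformal hconf]
  change _ = (K (tangentVec e x y) * u (e.symm x) ^ 2 + 2 * lam (e.symm x) * u (e.symm x)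
    - N (e.symm x)) * _
  field_simp
  ring

theorem HasRicciScalar.change (h : HasRicciScalar F K) : HasRicciScalar F₁
    (fun v => K v * u v.proj ^ 2 + 2 * lam v.proj * u v.proj - N v.proj) := by
  intro e he x hx y hy
  have hu0 := (hu_pos (e.symm x)).ne'
  have h1 := h e he x hx y hy
  rw [ricci] at h1 ⊢
  rw [Finset.sum_congr rfl fun m _ => riemann_change hF hu hu_pos hc hN hF₁ hconf he hx hy m m,
    Finset.sum_add_distrib, ← Finset.mul_sum, (isLocalExpr hF he).trace_flag hx hy, h1,
    localExpr_conformal hconf]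
  change _ = (_ - 1) * (K (tangentVec e x y) * u (e.symm x) ^ 2
    + 2 * lam (e.symm x) * u (e.symm x) - N (e.symm x)) * _
  field_simp
  ring

theorem curvatureRelation (hn : 2 ≤ n) (h : HasRicciScalar F K) (h₁ : HasRicciScalar F₁ K₁) :
    CurvatureRelation F u lam K K₁ := by
  intro e he x hx y hy
  rw [h₁.eq hn hF₁ (h.change hF hu hu_pos hc hN hF₁ hconf) he hx hy,
    IsLocalExpr.sum_grad_gradUp, hN e he x hx y hy]
  rfl

omit hN in
theorem IsOfScalarFlagCurvature.change (hn : 2 ≤ n) (h : IsOfScalarFlagCurvature F) :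
    IsOfScalarFlagCurvature F₁ := by
  obtain ⟨N, hN⟩ := hc.exists_isNormSqGrad hF hu hu_pos hn
  obtain ⟨K, hK⟩ := h
  exact ⟨_, hK.change hF hu hu_pos hc hN hF₁ hconf⟩

omit hN in
theorem IsOfIsotropicFlagCurvature.change (hn : 2 ≤ n) (h : IsOfIsotropicFlagCurvature F) :
    IsOfIsotropicFlagCurvature F₁ := by
  obtain ⟨N, hN⟩ := hc.exists_isNormSqGrad hF hu hu_pos hn
  obtain ⟨K, hK⟩ := h
  exact ⟨fun p => K p * u p ^ 2 + 2 * lam p * u p - N p,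
    hK.change hF hu hu_pos hc hN hF₁ hconf⟩

omit hN in
theorem IsEinstein.change (hn : 2 ≤ n) (h : IsEinstein F) : IsEinstein F₁ := by
  obtain ⟨N, hN⟩ := hc.exists_isNormSqGrad hF hu hu_pos hn
  obtain ⟨K, hK⟩ := h
  exact ⟨fun p => K p * u p ^ 2 + 2 * lam p * u p - N p,
    hK.change hF hu hu_pos hc hN hF₁ hconf⟩

omit hF₁ hconf in
theorem isLocallyConstant_curvature (hn : 2 ≤ n) {K : ℝ} (h : HasFlagCurvature F fun _ => K) :
    IsLocallyConstant fun p => K * u p ^ 2 + 2 * lam p * u p - N p := by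
  rw [concircularEquations_iff hF hu hu_pos] at hc
  refine (IsLocallyConstant.iff_eventually_eq _).2 fun p => ?_
  have he : chartAt _ p ∈ charts n M := IsManifold.chart_mem_maximalAtlas _
  set e := chartAt (EuclideanSpace ℝ (Fin n)) p with he_def
  have hp : p ∈ e.source := mem_chart_source _ p
  have hL := isLocalExpr hF he
  have hK : ∀ x ∈ e.target, ∀ y ≠ 0, ∀ v, curv (sprayVec (localExpr e F)) x y v
      = K • ((2 * energy (localExpr e F) x y) • v - pY (energy (localExpr e F)) x y v • y) := by
    intro x hx y hy v
    have h1 : ∀ k, curv (sprayVec (localExpr e F)) x y (basisVec k)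
        = K • ((2 * energy (localExpr e F) x y) • basisVec k
          - pY (energy (localExpr e F)) x y (basisVec k) • y) := fun k => by
      ext i
      rw [← hL.riemann_eq hx hy, h e he x hx y hy, hL.lowerY_eq hx hy]
      simp only [energy, WithLp.ofLp_sub, WithLp.ofLp_smul, Pi.sub_apply, Pi.smul_apply,
        smul_eq_mul, basisVec, PiLp.single_apply]
      split_ifs <;> ring
    -- The curvature as a linear map in v, so that agreement on basis vectors suffices.
    let R : Coord n →L[ℝ] Coord n := (2 : ℝ) • pX (sprayVec (localExpr e F)) x y
      - pX (pY (sprayVec (localExpr e F))) x y y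
      + (2 : ℝ) • (pY (pY (sprayVec (localExpr e F))) x y).flip (sprayVec (localExpr e F) x y)
      - (pY (sprayVec (localExpr e F)) x y).comp (pY (sprayVec (localExpr e F)) x y)
    have h2 : R = K • ((2 * energy (localExpr e F) x y) • ContinuousLinearMap.id ℝ (Coord n)
        - (pY (energy (localExpr e F)) x y).smulRight y) :=
      IsLocalExpr.clm_ext_basis fun k => h1 k
    exact congrArg (fun f => f v) h2
  have key : ∀ x ∈ e.target, HasFDerivAt (fun z => K * u (e.symm z) ^ 2
      + 2 * lam (e.symm z) * u (e.symm z) - N (e.symm z)) (0 : Coord n →L[ℝ] ℝ) x := fun x hx =>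
    hasFDerivAt_curvature_const (one_lt_rank_coord hn) (isGradient_localExpr hF hu hu_pos he)
      hL.isLocalFinsler (hc e he) hK (fun x hx y hy => hN e he x hx y hy) hx
  obtain ⟨r, hr, hball⟩ := Metric.isOpen_iff.1 e.open_target (e p) (e.map_source hp)
  have hconst : ∀ x ∈ Metric.ball (e p) r, K * u (e.symm x) ^ 2
      + 2 * lam (e.symm x) * u (e.symm x) - N (e.symm x) = K * u (e.symm (e p)) ^ 2
      + 2 * lam (e.symm (e p)) * u (e.symm (e p)) - N (e.symm (e p)) := fun x hx =>
    Metric.isOpen_ball.is_const_of_fderiv_eq_zero (convex_ball _ _).isPreconnected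
      (fun z hz => (key z (hball hz)).differentiableAt.differentiableWithinAt)
      (fun z hz => (key z (hball hz)).fderiv) hx (Metric.mem_ball_self hr)
  filter_upwards [e.open_source.mem_nhds hp,
    (e.continuousAt hp).eventually_mem (Metric.ball_mem_nhds _ hr)] with q hq hqr
  have := hconst _ hqr
  rwa [e.left_inv hq, e.left_inv hp] at this

omit hN in
theorem IsOfConstantFlagCurvature.change [PreconnectedSpace M] (hn : 2 ≤ n)
    (h : IsOfConstantFlagCurvature F) : IsOfConstantFlagCurvature F₁ := by
  obtain ⟨N, hN⟩ := hc.exists_isNormSqGrad hF hu hu_pos hn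
  obtain ⟨K, hK⟩ := h
  have h1 := hK.change hF hu hu_pos hc hN hF₁ hconf
  have h2 := isLocallyConstant_curvature hF hu hu_pos hc hN hn hK
  rcases isEmpty_or_nonempty M with hM | ⟨⟨p⟩⟩
  -- Preconnectedness admits the empty manifold, where any constant will do.
  · exact ⟨0, fun e _ x _ => (IsEmpty.false (e.symm x)).elim⟩
  · refine ⟨K * u p ^ 2 + 2 * lam p * u p - N p, fun e he x hx y hy i k => ?_⟩
    rw [h1 e he x hx y hy i k]
    exact congrArg (· * _) (h2.apply_eq_of_preconnectedSpace _ _)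

end Curvature

end Finsler

/-! ### The theorem: both directions and all equivalences by symmetry. -/

theorem theorem1p3 {n : ℕ} (hn : 2 ≤ n) {M : Type*} [TopologicalSpace M]
    [ChartedSpace (EuclideanSpace ℝ (Fin n)) M] [IsManifold (𝓡 n) ∞ M]
    (F F₁ : TangentBundle (𝓡 n) M → ℝ)
    (hF : Finsler.IsFinslerMetric F) (hF₁ : Finsler.IsFinslerMetric F₁)
    (u : M → ℝ) (hu : ContMDiff (𝓡 n) 𝓘(ℝ, ℝ) ∞ u) (hu_pos : ∀ p, 0 < u p)
    (hconf : ∀ v : TangentBundle (𝓡 n) M, F₁ v = (u v.proj)⁻¹ * F v) :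
    (Finsler.Concircular F F₁ ↔ ∃ lam : M → ℝ, Finsler.ConcircularEquations F u lam) ∧
    (Finsler.Concircular F F₁ →
      (Finsler.IsOfScalarFlagCurvature F ↔ Finsler.IsOfScalarFlagCurvature F₁) ∧
      (Finsler.IsOfIsotropicFlagCurvature F ↔ Finsler.IsOfIsotropicFlagCurvature F₁) ∧
      (3 ≤ n → PreconnectedSpace M →
        (Finsler.IsOfConstantFlagCurvature F ↔ Finsler.IsOfConstantFlagCurvature F₁)) ∧
      (Finsler.IsEinstein F ↔ Finsler.IsEinstein F₁) ∧
      (∀ lam : M → ℝ, Finsler.ConcircularEquations F u lam →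
        (∀ K K₁ : TangentBundle (𝓡 n) M → ℝ,
          Finsler.HasFlagCurvature F K → Finsler.HasFlagCurvature F₁ K₁ →
            Finsler.CurvatureRelation F u lam K K₁) ∧
        (∀ K K₁ : TangentBundle (𝓡 n) M → ℝ,
          Finsler.HasRicciScalar F K → Finsler.HasRicciScalar F₁ K₁ →
            Finsler.CurvatureRelation F u lam K K₁))) := by
  have hui : ContMDiff (𝓡 n) 𝓘(ℝ, ℝ) ∞ fun p => (u p)⁻¹ := fun p =>
    (contDiffAt_inv ℝ (hu_pos p).ne').contMDiffAt.comp p (hu p)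
  have hui_pos : ∀ p, 0 < (u p)⁻¹ := fun p => inv_pos.2 (hu_pos p)
  have hconf' : ∀ v : TangentBundle (𝓡 n) M, F v = ((u v.proj)⁻¹)⁻¹ * F₁ v := fun v => by
    rw [hconf, inv_inv, mul_inv_cancel_left₀ (hu_pos _).ne']
  -- The roles of F and F₁ can be exchanged with 1/u in place of u, so each transfer statement is
  -- needed in one direction only.
  have hinv : ∀ lam, Finsler.ConcircularEquations F u lam →
      ∃ lam₁, Finsler.ConcircularEquations F₁ (fun p => (u p)⁻¹) lam₁ := fun lam hc => by
    obtain ⟨N, hN⟩ := hc.exists_isNormSqGrad hF hu hu_pos hn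
    exact ⟨_, hc.inv hF hu hu_pos hN hF₁ hconf⟩
  have h1 : Finsler.Concircular F F₁ ↔ ∃ lam : M → ℝ, Finsler.ConcircularEquations F u lam := by
    refine ⟨fun h => h.1.exists_concircularEquations hF hu hu_pos hn hF₁ hconf, ?_⟩
    rintro ⟨lam, hc⟩
    obtain ⟨lam₁, hc₁⟩ := hinv lam hc
    exact ⟨hc.circlesAreCircles hF hu hu_pos hF₁ hconf,
      hc₁.circlesAreCircles hF₁ hui hui_pos hF hconf'⟩
  refine ⟨h1, fun h => ?_⟩
  obtain ⟨lam, hc⟩ := h1.1 h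
  obtain ⟨lam₁, hc₁⟩ := hinv lam hc
  refine ⟨⟨fun h => h.change hF hu hu_pos hc hF₁ hconf hn,
      fun h => h.change hF₁ hui hui_pos hc₁ hF hconf' hn⟩,
    ⟨fun h => h.change hF hu hu_pos hc hF₁ hconf hn,
      fun h => h.change hF₁ hui hui_pos hc₁ hF hconf' hn⟩,
    fun _ _ => ⟨fun h => h.change hF hu hu_pos hc hF₁ hconf hn,
      fun h => h.change hF₁ hui hui_pos hc₁ hF hconf' hn⟩,
    ⟨fun h => h.change hF hu hu_pos hc hF₁ hconf hn,
      fun h => h.change hF₁ hui hui_pos hc₁ hF hconf' hn⟩, fun lam hc => ?_⟩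
  obtain ⟨N, hN⟩ := hc.exists_isNormSqGrad hF hu hu_pos hn
  -- A flag curvature is also a Ricci scalar, by taking the trace, so both relations follow from
  -- uniqueness of the latter.
  exact ⟨fun K K₁ h h₁ => Finsler.curvatureRelation hF hu hu_pos hc hN hF₁ hconf hn
      (h.hasRicciScalar hF) (h₁.hasRicciScalar hF₁),
    fun K K₁ h h₁ => Finsler.curvatureRelation hF hu hu_pos hc hN hF₁ hconf hn h h₁⟩
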